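/- Let $G$ be a directed graph with vertex set $\mathcal V$ and edge set $\mathcal E$ of arbitrary cardinality (loops and multiple edges are allowed); each edge $e$ has a source $s(e)$ and a range $r(e)$. Let $\mathbb F_G^+$ be the set of all directed paths of finite length in $G$, the vertices being the paths of length zero, and let $\mathcal H_G=\ell^2(\mathbb F_G^+)$ (over $\mathbb C$) with orthonormal basis $\{\xi_w : w\in\mathbb F_G^+\}$. For $e\in\mathcal E$ and $x\in\mathcal V$ define $L_e\xi_w=\xi_{ew}$ if $r(w)=s(e)$ and $L_e\xi_w=0$ otherwise, $L_x\xi_w=\xi_w$ if $r(w)=x$ and $L_x\xi_w=0$ otherwise. The tensor algebra $\mathcal A_G$ is the norm-closed (not necessarily unital) subalgebra of $B(\mathcal H_G)$ generated by $\{L_e,L_x : e\in\mathcal E,\ x\in\mathcal V\}$. A derivation on $\mathcal A_G$ is a linear map $\delta:\mathcal A_G\to\mathcal A_G$ with $\delta(AB)=\delta(A)B+A\delta(B)$; it is inner if there is $T\in\mathcal A_G$ with $\delta(A)=AT-TA$ for all $A\in\mathcal A_G$. $G$ is connected if it is nonempty and any two vertices are joined by an undirected path, and strongly connected if for all vertices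 $x,y$ there is a directed path from $x$ to $y$. A polygon of length $n\ge 1$ consists of distinct vertices $v_1,\dots,v_n$ and distinct edges $e_1,\dots,e_n$ with $\{r(e_j),s(e_j)\}=\{v_j,v_{j+1}\}$ (indices modulo $n$). A generalized tree is a connected directed graph with at least two vertices and no polygon; its leaves are its vertices of degree one. For $n\ge1$ the $n$-circle graph has $n$ distinct vertices $v_1,\dots,v_n$ and edges $e_1,\dots,e_n$ with $r(e_j)=v_j$, $s(e_j)=v_{j+1}$ (indices modulo $n$). A fruit tree is a directed graph with finitely many vertices obtained from a generalized tree $G_t$ and a (possibly empty) set $V$ of leaves of $G_t$, with $V$ not the whole vertex set of $G_t$, by attaching to each $v\in V$ an $n_v$-circle graph $\mathscr C_{n_v}$ ($n_v\ge1$), one vertex of which is identified with $v$, where the circle graphs are pairwise disjoint and otherwise disjoint from $G_t$. The fruit $\mathscr C_{n_v}$ is an out-fruit if the edge of $G_t$ at $v$ has source $v$, and an in-fruit otherwise. Corollary. Let $G$ be a connected directed graph that is not strongly connected. Then every bounded derivation on $\mathcal A_G$ is inner if and only if $G$ is a fruit tree that contains no in-fruit. -/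

import Mathlib

universe u v u' v'

namespace DiGraph

open Quiver

/-! Directed graphs (multigraphs, loops allowed, arbitrary vertex and edge sets) are quivers:
an edge `e : x ⟶ y` has source `s(e) = x` and range `r(e) = y`. -/

section Operators

/-- The coordinates of the vector obtained from `x` by sending `ξ_i` to `ξ_{σ i}`
(to `0` where `σ i` is undefined). -/
def moveCoords {ι : Type u} (σ : ι ≃. ι) (x : ι → ℂ) (i : ι) : ℂ :=
  (σ.symm i).elim 0 x

theorem sum_moveCoords_le {ι : Type u} (σ : ι ≃. ι) (x : lp (fun _ : ι => ℂ) 2) (s : Finset ι) :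
    ∑ i ∈ s, ‖moveCoords σ x i‖ ^ (2 : ENNReal).toReal ≤ ‖x‖ ^ (2 : ENNReal).toReal := by
  classical
  have h2 : 0 < (2 : ENNReal).toReal := by norm_num
  have h0 : (0 : ℝ) ^ (2 : ENNReal).toReal = 0 := Real.zero_rpow h2.ne'
  have key : ∑ i ∈ s, ‖moveCoords σ x i‖ ^ (2 : ENNReal).toReal
      = ∑ j ∈ s.filterMap σ.symm (fun a a' b hb hb' => σ.symm.inj hb hb'),
          ‖x j‖ ^ (2 : ENNReal).toReal := by
    symm
    rw [← Finset.sum_filter_of_ne (s := s) (p := fun i => (σ.symm i).isSome)]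
    · refine Finset.sum_bij' (fun j hj => (σ j).getD j) (fun i hi => (σ.symm i).getD i)
        ?_ ?_ ?_ ?_ ?_
      · intro j hj
        obtain ⟨i, hi, hij⟩ := (Finset.mem_filterMap _).1 hj
        have := σ.eq_some_iff.1 hij
        simp [this, hi, hij]
      · intro i hi
        obtain ⟨his, hi⟩ := Finset.mem_filter.1 hi
        obtain ⟨j, hj⟩ := Option.isSome_iff_exists.1 hi
        refine (Finset.mem_filterMap _).2 ⟨i, his, ?_⟩
        simp [hj]
      · intro j hj
        obtain ⟨i, hi, hij⟩ := (Finset.mem_filterMap _).1 hj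
        have := σ.eq_some_iff.1 hij
        simp [this, hij]
      · intro i hi
        obtain ⟨his, hi⟩ := Finset.mem_filter.1 hi
        obtain ⟨j, hj⟩ := Option.isSome_iff_exists.1 hi
        have := σ.eq_some_iff.1 hj
        simp [this, hj]
      · intro j hj
        obtain ⟨i, hi, hij⟩ := (Finset.mem_filterMap _).1 hj
        have := σ.eq_some_iff.1 hij
        simp [this, moveCoords, hij]
    · intro i _ hne
      by_contra hnone
      have : σ.symm i = none := by simpa using hnone
      exact hne (by simp [moveCoords, this])
  rw [key]
  exact lp.sum_rpow_le_norm_rpow h2 x _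

/-- The partial isometry of `ℓ²(ι)` with `ξ_i ↦ ξ_{σ i}` where the partial bijection `σ` is defined
at `i`, and `ξ_i ↦ 0` elsewhere. -/
noncomputable def partialIsometry {ι : Type u} (σ : ι ≃. ι) :
    lp (fun _ : ι => ℂ) 2 →L[ℂ] lp (fun _ : ι => ℂ) 2 :=
  LinearMap.mkContinuous
    { toFun := fun x => ⟨moveCoords σ x, memℓp_gen' (sum_moveCoords_le σ x)⟩
      map_add' := fun x y => by
        ext i
        change moveCoords σ (⇑(x + y)) i = moveCoords σ x i + moveCoords σ y i
        cases h : σ.symm i <;> simp [moveCoords, h, Option.elim]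
      map_smul' := fun c x => by
        ext i
        change moveCoords σ (⇑(c • x)) i = c • moveCoords σ x i
        cases h : σ.symm i <;> simp [moveCoords, h, Option.elim] }
    1 (fun x => by
      rw [one_mul]
      exact lp.norm_le_of_forall_sum_le (by norm_num) (norm_nonneg x) (sum_moveCoords_le σ x))

theorem partialIsometry_apply {ι : Type u} (σ : ι ≃. ι) (x : lp (fun _ : ι => ℂ) 2) (i : ι) :
    partialIsometry σ x i = (σ.symm i).elim 0 x := rfl

end Operators

section PathSpace

variable (V : Type u) [Quiver.{v} V]

/-- All directed paths of finite length; vertices are the paths of length zero. A path `w` is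
stored as `⟨s(w), r(w), w⟩`, and for an edge `e` with `s(e) = r(w)` the product `e w`
(first `w`, then `e`) is `w.cons e`. -/
abbrev PathSpace : Type (max u v) := Σ x y : V, Path x y

/-- The Hilbert space with orthonormal basis `ξ_w` indexed by the paths `w`. -/
abbrev PathHilbert : Type (max u v) := lp (fun _ : PathSpace V => ℂ) 2

variable {V}

open Classical in
/-- Left multiplication `w ↦ e w` by the edge `e`, defined on the paths `w` with `r(w) = s(e)`. -/
noncomputable def edgeMul {x y : V} (e : x ⟶ y) : PathSpace V ≃. PathSpace V where
  toFun w := if h : w.2.1 = x then some ⟨w.1, y, (h ▸ w.2.2 : Path w.1 x).cons e⟩ else none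
  invFun w := if h : ∃ a, ∃ p : Path a x, w = ⟨a, y, p.cons e⟩
    then some ⟨h.choose, x, h.choose_spec.choose⟩ else none
  inv := by
    have inj : ∀ {a a' : V} {p : Path a x} {p' : Path a' x},
        (⟨a, y, p.cons e⟩ : PathSpace V) = ⟨a', y, p'.cons e⟩ →
          (⟨a, x, p⟩ : PathSpace V) = ⟨a', x, p'⟩ := by
      intro a a' p p' h
      obtain ⟨rfl, h⟩ := Sigma.mk.inj_iff.1 h
      have h := eq_of_heq (Sigma.mk.inj_iff.1 (eq_of_heq h)).2
      rw [eq_of_heq (Path.heq_of_cons_eq_cons h)]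
    rintro ⟨a, b, p⟩ w
    constructor
    · intro hw
      split_ifs at hw with h
      have h1 := h.choose_spec.choose_spec
      have h2 := Option.some.inj hw
      obtain ⟨rfl, h3⟩ := Sigma.mk.inj_iff.1 h2
      obtain ⟨rfl, h4⟩ := Sigma.mk.inj_iff.1 (eq_of_heq h3)
      have h4 := eq_of_heq h4
      rw [dif_pos rfl]
      rw [h4] at h1
      exact congrArg some h1.symm
    · intro hw
      split_ifs at hw with h
      have h2 := Option.some.inj hw
      cases h
      have h' : ∃ a, ∃ p : Path a b, w = ⟨a, y, p.cons e⟩ := ⟨a, p, h2.symm⟩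
      rw [dif_pos h']
      exact congrArg some (inj (h'.choose_spec.choose_spec.symm.trans h2.symm))

/-- The operator `L_e`: `ξ_w ↦ ξ_{ew}` if `r(w) = s(e)`, and `ξ_w ↦ 0` otherwise. -/
noncomputable def leftEdge {x y : V} (e : x ⟶ y) : PathHilbert V →L[ℂ] PathHilbert V :=
  partialIsometry (edgeMul e)

open Classical in
/-- The operator `L_x`: `ξ_w ↦ ξ_w` if `r(w) = x`, and `ξ_w ↦ 0` otherwise. -/
noncomputable def leftVertex (x : V) : PathHilbert V →L[ℂ] PathHilbert V :=
  partialIsometry (PEquiv.ofSet {w : PathSpace V | w.2.1 = x})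

theorem partialIsometry_single {ι : Type u} [DecidableEq ι] (σ : ι ≃. ι) (i : ι) :
    partialIsometry σ (lp.single 2 i 1) = (σ i).elim 0 (fun j => lp.single 2 j 1) := by
  ext k
  rw [partialIsometry_apply]
  cases h : σ i with
  | none =>
    cases hk : σ.symm k with
    | none => simp
    | some l =>
      have h1 := σ.eq_some_iff.1 hk
      have : l ≠ i := by rintro rfl; simp [h] at h1
      simp [lp.single_apply, this]
  | some j =>
    cases hk : σ.symm k with
    | none =>
      have : k ≠ j := by rintro rfl; simp [σ.eq_some_iff.2 h] at hk
      simp [lp.single_apply, this]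
    | some l =>
      have h1 := σ.eq_some_iff.1 hk
      by_cases hl : l = i
      · subst hl
        obtain rfl : k = j := by simpa [h1] using h
        simp [lp.single_apply]
      · have : k ≠ j := by
          rintro rfl
          exact hl (by simpa [σ.eq_some_iff.2 h] using hk.symm)
        simp [lp.single_apply, this, hl]

theorem leftEdge_single {a x y : V} [DecidableEq (PathSpace V)] (e : x ⟶ y) (p : Path a x) :
    leftEdge e (lp.single 2 (⟨a, x, p⟩ : PathSpace V) 1) =
      lp.single 2 (⟨a, y, p.cons e⟩ : PathSpace V) 1 := by
  simp [leftEdge, partialIsometry_single, edgeMul]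

theorem leftEdge_single_of_ne {x y : V} [DecidableEq (PathSpace V)] (e : x ⟶ y) (w : PathSpace V) (h : w.2.1 ≠ x) :
    leftEdge e (lp.single 2 w 1) = 0 := by
  simp [leftEdge, partialIsometry_single, edgeMul, h]

theorem leftVertex_single [DecidableEq (PathSpace V)] [DecidableEq V] (x : V) (w : PathSpace V) :
    leftVertex x (lp.single 2 w 1) = if w.2.1 = x then lp.single 2 w 1 else 0 := by
  by_cases h : w.2.1 = x <;>
    simp [leftVertex, partialIsometry_single, PEquiv.ofSet, h]

variable (V)

/-- The tensor algebra `𝒜_G`: the norm closure of the (not necessarily unital) algebra generated by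
all `L_e` and all `L_x`. -/
noncomputable def tensorAlgebra : NonUnitalSubalgebra ℂ (PathHilbert V →L[ℂ] PathHilbert V) :=
  (NonUnitalAlgebra.adjoin ℂ
    ({T | ∃ (x y : V) (e : x ⟶ y), T = leftEdge e} ∪ {T | ∃ x : V, T = leftVertex x})
    ).topologicalClosure

end PathSpace

section Derivations

variable {R : Type u} [NonUnitalNormedRing R] [NormedSpace ℂ R]

/-- The bounded linear map `δ` is a derivation. -/
def IsDerivation (δ : R →L[ℂ] R) : Prop :=
  ∀ A B : R, δ (A * B) = δ A * B + A * δ B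

/-- The map `δ` is implemented by an element of the algebra itself. -/
def IsInner (δ : R →L[ℂ] R) : Prop :=
  ∃ T : R, ∀ A : R, δ A = A * T - T * A

end Derivations

section Graphs

variable (V : Type u) [Quiver.{v} V]

/-- Connected: nonempty, and any two vertices are joined by an undirected path. -/
def IsConnected : Prop :=
  Nonempty V ∧ ∀ a b : V, Nonempty (@Path (Symmetrify V) _ a b)

/-- `G` contains a polygon: for some `n ≥ 1` there are distinct vertices `v_j` and distinct edges
`e_j` (`j` modulo `n`) such that `e_j` joins `v_j` and `v_{j+1}`, in either direction.
A loop is a polygon with `n = 1`. -/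
def HasPolygon : Prop :=
  ∃ (n : ℕ) (_ : 1 ≤ n) (p : ZMod n → V) (e : ZMod n → Total V),
    Function.Injective p ∧ Function.Injective e ∧
      ∀ j, ({(e j).right, (e j).left} : Set V) = {p j, p (j + 1)}

/-- Generalized tree: connected, at least two vertices, no polygon. -/
def IsGeneralizedTree : Prop :=
  IsConnected V ∧ Nontrivial V ∧ ¬ HasPolygon V

variable {V}

/-- The number of edges with source `x`. -/
noncomputable def outDegree (x : V) : ℕ∞ := {e : Total V | e.left = x}.encard

/-- The number of edges with range `x`. -/
noncomputable def inDegree (x : V) : ℕ∞ := {e : Total V | e.right = x}.encard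

/-- A vertex of degree one. -/
def IsLeaf (x : V) : Prop := outDegree x + inDegree x = 1

/-- Isomorphism of directed graphs: a bijection of the vertices together with bijections of the
edge sets between corresponding pairs of vertices. -/
def IsIsomorphic (V : Type u) [Quiver.{v} V] (W : Type u') [Quiver.{v'} W] : Prop :=
  ∃ φ : V ≃ W, ∀ a b : V, Nonempty ((a ⟶ b) ≃ (φ a ⟶ φ b))

/-- The vertices of the `n`-circle graph. -/
def CircleGraph (n : ℕ) : Type := ZMod n

/-- For each `j` modulo `n` there is exactly one edge `e_j`, with `s(e_j) = v_{j+1}` and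
`r(e_j) = v_j`. -/
instance circleQuiver (n : ℕ) : Quiver.{0} (CircleGraph n) where
  Hom a b := PLift ((show ZMod n from a) = (show ZMod n from b) + 1)

/-- Being an `n`-circle graph for some `n ≥ 1`. -/
def IsCircle (V : Type u) [Quiver.{v} V] : Prop :=
  ∃ n : ℕ, 1 ≤ n ∧ IsIsomorphic V (CircleGraph n)

/-- A subgraph: sets of vertices and edges, containing the end points of its edges. -/
structure Subgraph (V : Type u) [Quiver.{v} V] where
  verts : Set V
  edges : ∀ a b : V, Set (a ⟶ b)
  left_mem : ∀ {a b : V} {e : a ⟶ b}, e ∈ edges a b → a ∈ verts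
  right_mem : ∀ {a b : V} {e : a ⟶ b}, e ∈ edges a b → b ∈ verts

/-- The vertex type of a subgraph, so that the subgraph is a directed graph in its own right. -/
def Subgraph.Vert (H : Subgraph V) : Type u := {x : V // x ∈ H.verts}

instance Subgraph.quiver (H : Subgraph V) : Quiver.{v} H.Vert where
  Hom a b := {e : a.1 ⟶ b.1 // e ∈ H.edges a.1 b.1}

/-- A presentation of `G` as a generalized fruit tree: `G` is the amalgamation over the vertex set
`attach` of the generalized tree `tree` and of the disjoint union of the circle graphs `fruit x`,
one for each `x` in `attach`. Here `attach` is a set of leaves of `tree`, it is not the set of all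
vertices of `tree`, and `x` is the only common vertex of `tree` and `fruit x`. -/
structure GeneralizedFruitTree (V : Type u) [Quiver.{v} V] where
  tree : Subgraph V
  isGeneralizedTree : IsGeneralizedTree tree.Vert
  attach : Set tree.Vert
  isLeaf : ∀ x ∈ attach, IsLeaf x
  attach_ne : attach ≠ Set.univ
  fruit : attach → Subgraph V
  isCircle : ∀ x, IsCircle (fruit x).Vert
  fruit_disjoint : ∀ x y, x ≠ y → Disjoint (fruit x).verts (fruit y).verts
  tree_inter_fruit : ∀ x : attach, tree.verts ∩ (fruit x).verts = {x.1.1}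
  verts_cover : ∀ a : V, a ∈ tree.verts ∨ ∃ x, a ∈ (fruit x).verts
  edges_cover : ∀ {a b : V} (e : a ⟶ b), e ∈ tree.edges a b ∨ ∃ x, e ∈ (fruit x).edges a b
  edges_disjoint : ∀ {a b : V} (e : a ⟶ b) (x : attach),
    ¬ (e ∈ tree.edges a b ∧ e ∈ (fruit x).edges a b)

/-- The fruit at `x` is an out-fruit: the tree edge at `x` has source `x`. -/
def GeneralizedFruitTree.IsOutFruit (D : GeneralizedFruitTree V) (x : D.attach) : Prop :=
  outDegree x.1 = 1

/-- A fruit that is not an out-fruit is an in-fruit. -/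
def GeneralizedFruitTree.IsInFruit (D : GeneralizedFruitTree V) (x : D.attach) : Prop :=
  ¬ D.IsOutFruit x

/-- `G` is a fruit tree (a generalized fruit tree with finitely many vertices) that contains
no in-fruit. -/
def IsFruitTreeWithoutInFruit (V : Type u) [Quiver.{v} V] : Prop :=
  Finite V ∧ ∃ D : GeneralizedFruitTree V, ∀ x : D.attach, ¬ D.IsInFruit x

end Graphs

end DiGraph

/-! Write 𝒜 for `tensorAlgebra V`. Elements of 𝒜 commute with right multiplication by paths, so they
are determined by their Fourier coefficients `coef`, and most of the argument compares coefficients.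
An edge is external if no path leads from its range back to its source; all other edges lie inside
strongly connected components.

Necessity. A bounded operator X whose commutators with all L_e and L_x lie in 𝒜 defines a bounded
derivation; innerness replaces X by some T in 𝒜 (`exists_implementing`). Taking for X the projection
onto the paths that end in an infinite, co-infinite set of vertices shows that there are finitely
many vertices, because vertex coefficients of T vanish at infinity. A path crosses an external edge
f at most once, so inserting closed paths c before and d after the crossing is a partial isometry
(`insertOp`). It commutes with all generators except L_f, and its commutator with L_f is a multiple
of the operator of the path "c, then f, then d". Coefficients of the implementing T then show that
the characteristic function of f is a coboundary (so external edges form no polygon), that closed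
paths at the source of f commute (so its component, if cyclic, is a circle), and that f is the only
external edge leaving a cyclic component. Excluding a closed path c at the range of f takes analysis
(`closed_path_eq_nil`): along the paths f c^k an element of 𝒜 has a power series that is continuous
at 1, whereas inserting the singular inner function exp(-1/(1-z)) of c still yields a derivation of
𝒜. Its implementing T would have this discontinuous function as symbol, up to a constant. Hence the
external edges form the tree and the cyclic components are out-fruits.

Sufficiency. With finitely many vertices a derivation can be normalized to vanish at all vertices;
then δ(L_p) lies in the corner of p. On a tree edge e outside the fruits this corner is spanned by
L_e, so δ(L_e) = c_e L_e, and c is a coboundary because the tree has no polygon. On a fruit closed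
paths commute, and boundedness forces δ(L_r) = 0 for closed r, since δ(L_r^k) = k L_r^(k-1) δ(L_r).
For a fruit vertex x with shortest exit path s, every path from x to the range of s is s preceded by
a closed path, so L_s can be divided out on the left, and this determines the component at x of the
implementing operator. -/

namespace DiGraph

open Quiver

/-! ### Partial isometries attached to injective partial relations -/

section RelationOperators

variable {ι : Type u}

/-- A functional and injective relation. -/
def IsPartialBij (R : ι → ι → Prop) : Prop :=
  (∀ i j k, R i j → R i k → j = k) ∧ ∀ i j k, R i k → R j k → i = j

open Classical in
/-- The partial bijection whose graph is a given functional and injective relation. -/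
noncomputable def pequivOfRel (R : ι → ι → Prop) (hR : IsPartialBij R) : ι ≃. ι where
  toFun i := if h : ∃ j, R i j then some h.choose else none
  invFun j := if h : ∃ i, R i j then some h.choose else none
  inv i j := by
    constructor
    · intro h
      split_ifs at h with h1
      obtain rfl := Option.some.inj h
      have h2 : ∃ k, R h1.choose k := ⟨j, h1.choose_spec⟩
      rw [dif_pos h2]
      exact congrArg some (hR.1 _ _ _ h2.choose_spec h1.choose_spec)
    · intro h
      split_ifs at h with h1
      obtain rfl := Option.some.inj h
      have h2 : ∃ k, R k h1.choose := ⟨i, h1.choose_spec⟩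
      rw [dif_pos h2]
      exact congrArg some (hR.2 _ _ _ h2.choose_spec h1.choose_spec)

/-- The partial isometry with `ξ_i ↦ ξ_j` whenever `R i j`. -/
noncomputable def relOp (R : ι → ι → Prop) (hR : IsPartialBij R) :
    lp (fun _ : ι => ℂ) 2 →L[ℂ] lp (fun _ : ι => ℂ) 2 :=
  partialIsometry (pequivOfRel R hR)

variable {R : ι → ι → Prop} (hR : IsPartialBij R)

theorem relOp_apply {i j : ι} (h : R i j) (u : lp (fun _ : ι => ℂ) 2) :
    relOp R hR u j = u i := by
  classical
  have h1 : ∃ k, R k j := ⟨i, h⟩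
  have h2 : (pequivOfRel R hR).symm j = some i := by
    change (if h : ∃ i, R i j then some h.choose else none) = some i
    rw [dif_pos h1]
    exact congrArg some (hR.2 _ _ _ h1.choose_spec h)
  rw [relOp, partialIsometry_apply, h2]
  rfl

theorem relOp_apply_eq_zero {j : ι} (h : ∀ i, ¬ R i j) (u : lp (fun _ : ι => ℂ) 2) :
    relOp R hR u j = 0 := by
  classical
  have h2 : (pequivOfRel R hR).symm j = none := by
    change (if h : ∃ i, R i j then some h.choose else none) = none
    rw [dif_neg (by simpa using h)]
  rw [relOp, partialIsometry_apply, h2]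
  rfl

theorem relOp_single [DecidableEq ι] {i j : ι} (h : R i j) :
    relOp R hR (lp.single 2 i 1) = lp.single 2 j 1 := by
  classical
  have h1 : ∃ k, R i k := ⟨j, h⟩
  have h2 : pequivOfRel R hR i = some j := by
    change (if h : ∃ j, R i j then some h.choose else none) = some j
    rw [dif_pos h1]
    exact congrArg some (hR.1 _ _ _ h1.choose_spec h)
  rw [relOp, partialIsometry_single, h2]
  rfl

theorem relOp_single_eq_zero [DecidableEq ι] {i : ι} (h : ∀ j, ¬ R i j) :
    relOp R hR (lp.single 2 i 1) = 0 := by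
  classical
  have h2 : pequivOfRel R hR i = none := by
    change (if h : ∃ j, R i j then some h.choose else none) = none
    rw [dif_neg (by simpa using h)]
  rw [relOp, partialIsometry_single, h2]
  rfl

theorem norm_partialIsometry_le (σ : ι ≃. ι) : ‖partialIsometry σ‖ ≤ 1 :=
  LinearMap.mkContinuous_norm_le _ zero_le_one _

theorem norm_relOp_le : ‖relOp R hR‖ ≤ 1 := norm_partialIsometry_le _

theorem clm_ext_single [DecidableEq ι] {F : Type*} [NormedAddCommGroup F] [NormedSpace ℂ F]
    {S T : lp (fun _ : ι => ℂ) 2 →L[ℂ] F}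
    (h : ∀ i, S (lp.single 2 i 1) = T (lp.single 2 i 1)) : S = T := by
  ext u
  have h1 := lp.hasSum_single (E := fun _ : ι => ℂ) (p := 2) (by norm_num) u
  refine (h1.mapL S).unique ?_
  convert! h1.mapL T using 2 with i
  have : lp.single 2 i (u i) = u i • (lp.single 2 i 1 : lp (fun _ : ι => ℂ) 2) := by
    rw [← lp.single_smul]; simp
  rw [this, map_smul, map_smul, h]

end RelationOperators

/-! ### Left and right multiplication by paths, Fourier coefficients -/

section LeftRight

variable {V : Type u} [Quiver.{v} V]

/-- The basis vector `ξ_p`. -/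
noncomputable def ket {a b : V} (p : Path a b) : PathHilbert V :=
  letI : DecidableEq (PathSpace V) := Classical.decEq _
  lp.single 2 ⟨a, b, p⟩ 1

theorem clm_ext_ket {F : Type*} [NormedAddCommGroup F] [NormedSpace ℂ F]
    {S T : PathHilbert V →L[ℂ] F} (h : ∀ (a b : V) (p : Path a b), S (ket p) = T (ket p)) :
    S = T := by
  let _ : DecidableEq (PathSpace V) := Classical.decEq _
  exact clm_ext_single fun ⟨a, b, p⟩ => h a b p

theorem ket_apply_self {a b : V} (p : Path a b) : (ket p : PathHilbert V) ⟨a, b, p⟩ = 1 := by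
  simp [ket, lp.single_apply]

theorem ket_apply_of_ne {a b : V} {p : Path a b} {w : PathSpace V} (h : w ≠ ⟨a, b, p⟩) :
    (ket p : PathHilbert V) w = 0 := by
  simp [ket, lp.single_apply, h]

theorem ket_apply_path_of_ne {a b : V} {p q : Path a b} (h : q ≠ p) :
    (ket p : PathHilbert V) ⟨a, b, q⟩ = 0 :=
  ket_apply_of_ne (by simpa using h)

theorem norm_ket {a b : V} (p : Path a b) : ‖(ket p : PathHilbert V)‖ = 1 := by
  simp [ket, lp.norm_single]

theorem norm_apply_le (u : PathHilbert V) (w : PathSpace V) : ‖u w‖ ≤ ‖u‖ :=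
  lp.norm_apply_le_norm (by norm_num) u w

/-- The relation between `w` and `p w`. -/
def leftRel {x y : V} (p : Path x y) (w w' : PathSpace V) : Prop :=
  ∃ (a : V) (q : Path a x), w = ⟨a, x, q⟩ ∧ w' = ⟨a, y, q.comp p⟩

/-- The relation between `w` and `w q`. -/
def rightRel {x y : V} (q : Path x y) (w w' : PathSpace V) : Prop :=
  ∃ (b : V) (p : Path y b), w = ⟨y, b, p⟩ ∧ w' = ⟨x, b, q.comp p⟩

theorem IsPartialBij.flip {ι : Type u} {R : ι → ι → Prop} (hR : IsPartialBij R) :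
    IsPartialBij (fun i j => R j i) :=
  ⟨fun _ _ _ h h' => hR.2 _ _ _ h h', fun _ _ _ h h' => hR.1 _ _ _ h h'⟩

theorem isPartialBij_leftRel {x y : V} (p : Path x y) : IsPartialBij (leftRel p) := by
  constructor
  · rintro _ _ _ ⟨a, q, rfl, rfl⟩ ⟨a', q', h, rfl⟩
    obtain ⟨rfl, h⟩ := Sigma.mk.inj_iff.1 h
    obtain rfl := (Sigma.mk.inj_iff.1 (eq_of_heq h)).2.eq
    rfl
  · rintro _ _ _ ⟨a, q, rfl, rfl⟩ ⟨a', q', rfl, h⟩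
    obtain ⟨rfl, h⟩ := Sigma.mk.inj_iff.1 h
    obtain h := (Sigma.mk.inj_iff.1 (eq_of_heq h)).2.eq
    rw [Path.comp_inj_left.1 h]

theorem isPartialBij_rightRel {x y : V} (q : Path x y) : IsPartialBij (rightRel q) := by
  constructor
  · rintro _ _ _ ⟨a, q, rfl, rfl⟩ ⟨a', q', h, rfl⟩
    obtain ⟨rfl, h⟩ := Sigma.mk.inj_iff.1 (Sigma.mk.inj_iff.1 h).2.eq
    rw [h.eq]
  · rintro _ _ _ ⟨a, q, rfl, rfl⟩ ⟨a', q', rfl, h⟩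
    obtain ⟨rfl, h⟩ := Sigma.mk.inj_iff.1 (Sigma.mk.inj_iff.1 h).2.eq
    rw [Path.comp_inj_right.1 h.eq]

/-- The operator of left multiplication by a path: `ξ_q ↦ ξ_{pq}`, where the product `p q`
(first `q`, then `p`) is `q.comp p`. -/
noncomputable def leftPath {x y : V} (p : Path x y) : PathHilbert V →L[ℂ] PathHilbert V :=
  relOp _ (isPartialBij_leftRel p)

/-- The operator that removes the path `p` on the left: `ξ_{pq} ↦ ξ_q`. -/
noncomputable def leftPathInv {x y : V} (p : Path x y) : PathHilbert V →L[ℂ] PathHilbert V :=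
  relOp _ (isPartialBij_leftRel p).flip

/-- The operator of right multiplication by a path: `ξ_p ↦ ξ_{pq}`. -/
noncomputable def rightPath {x y : V} (q : Path x y) : PathHilbert V →L[ℂ] PathHilbert V :=
  relOp _ (isPartialBij_rightRel q)

theorem leftPath_ket {a x y : V} (p : Path x y) (q : Path a x) :
    leftPath p (ket q) = ket (q.comp p) := by
  let _ : DecidableEq (PathSpace V) := Classical.decEq _
  exact relOp_single (isPartialBij_leftRel _) ⟨a, q, rfl, rfl⟩

theorem leftPath_ket_of_ne {a b x y : V} (p : Path x y) (q : Path a b) (h : b ≠ x) :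
    leftPath p (ket q) = 0 := by
  let _ : DecidableEq (PathSpace V) := Classical.decEq _
  exact relOp_single_eq_zero (isPartialBij_leftRel _) fun _ ⟨_, _, h1, _⟩ => h (congrArg (fun w : PathSpace V => w.2.1) h1)

theorem leftPath_apply_comp {a x y : V} (p : Path x y) (q : Path a x) (u : PathHilbert V) :
    leftPath p u ⟨a, y, q.comp p⟩ = u ⟨a, x, q⟩ := by
  exact relOp_apply (isPartialBij_leftRel _) ⟨a, q, rfl, rfl⟩ u

theorem leftPath_apply_eq_zero {x y : V} (p : Path x y) (u : PathHilbert V) {w : PathSpace V}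
    (h : ∀ (a : V) (q : Path a x), w ≠ ⟨a, y, q.comp p⟩) : leftPath p u w = 0 := by
  exact relOp_apply_eq_zero (isPartialBij_leftRel _) (fun _ ⟨_, _, _, h1⟩ => h _ _ h1) u

theorem leftPathInv_ket {a x y : V} (p : Path x y) (q : Path a x) :
    leftPathInv p (ket (q.comp p)) = ket q := by
  let _ : DecidableEq (PathSpace V) := Classical.decEq _
  exact relOp_single (isPartialBij_leftRel _).flip ⟨a, q, rfl, rfl⟩

theorem norm_leftPathInv_le {x y : V} (p : Path x y) : ‖leftPathInv p‖ ≤ 1 := by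
  exact norm_relOp_le (isPartialBij_leftRel _).flip

theorem norm_leftPath_le {x y : V} (p : Path x y) : ‖leftPath p‖ ≤ 1 := by
  exact norm_relOp_le (isPartialBij_leftRel _)

theorem rightPath_ket {b x y : V} (q : Path x y) (p : Path y b) :
    rightPath q (ket p) = ket (q.comp p) := by
  let _ : DecidableEq (PathSpace V) := Classical.decEq _
  exact relOp_single (isPartialBij_rightRel _) ⟨b, p, rfl, rfl⟩

theorem rightPath_ket_of_ne {a b x y : V} (q : Path x y) (p : Path a b) (h : a ≠ y) :
    rightPath q (ket p) = 0 := by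
  let _ : DecidableEq (PathSpace V) := Classical.decEq _
  exact relOp_single_eq_zero (isPartialBij_rightRel _) fun _ ⟨_, _, h1, _⟩ => h (congrArg (fun w : PathSpace V => w.1) h1)

theorem rightPath_apply_comp {b x y : V} (q : Path x y) (p : Path y b) (u : PathHilbert V) :
    rightPath q u ⟨x, b, q.comp p⟩ = u ⟨y, b, p⟩ := by
  exact relOp_apply (isPartialBij_rightRel _) ⟨b, p, rfl, rfl⟩ u

theorem rightPath_apply_eq_zero {x y : V} (q : Path x y) (u : PathHilbert V) {w : PathSpace V}
    (h : ∀ (b : V) (p : Path y b), w ≠ ⟨x, b, q.comp p⟩) : rightPath q u w = 0 := by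
  exact relOp_apply_eq_zero (isPartialBij_rightRel _) (fun _ ⟨_, _, _, h1⟩ => h _ _ h1) u

theorem leftVertex_ket {a b : V} (q : Path a b) : leftVertex b (ket q) = ket q := by
  classical
  let _ : DecidableEq (PathSpace V) := Classical.decEq _
  have := leftVertex_single b (⟨a, b, q⟩ : PathSpace V)
  simpa [ket] using this

theorem leftVertex_ket_of_ne {a b x : V} (q : Path a b) (h : b ≠ x) :
    leftVertex x (ket q) = 0 := by
  classical
  let _ : DecidableEq (PathSpace V) := Classical.decEq _
  have := leftVertex_single x (⟨a, b, q⟩ : PathSpace V)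
  simpa [ket, h] using this

theorem leftPath_nil (x : V) : leftPath (Path.nil : Path x x) = leftVertex x := by
  refine clm_ext_ket fun a b p => ?_
  by_cases h : b = x
  · subst h
    rw [leftPath_ket, leftVertex_ket, Path.comp_nil]
  · rw [leftPath_ket_of_ne _ _ h, leftVertex_ket_of_ne _ h]

theorem leftPath_toPath {x y : V} (e : x ⟶ y) : leftPath e.toPath = leftEdge e := by
  let _ : DecidableEq (PathSpace V) := Classical.decEq _
  refine clm_ext_ket fun a b p => ?_
  by_cases h : b = x
  · subst h
    rw [leftPath_ket]
    exact (leftEdge_single e p).symm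
  · rw [leftPath_ket_of_ne _ _ h]
    exact (leftEdge_single_of_ne e (⟨a, b, p⟩ : PathSpace V) h).symm

theorem leftPath_mul {x y z : V} (p : Path y z) (q : Path x y) :
    leftPath p * leftPath q = leftPath (q.comp p) := by
  refine clm_ext_ket fun a b r => ?_
  rw [mul_apply_eq_comp]
  by_cases h : b = x
  · subst h
    rw [leftPath_ket, leftPath_ket, leftPath_ket, Path.comp_assoc]
  · rw [leftPath_ket_of_ne _ _ h, leftPath_ket_of_ne _ _ h, map_zero]

theorem leftPath_mul_of_ne {x y z w : V} (p : Path y z) (q : Path x w) (h : w ≠ y) :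
    leftPath p * leftPath q = 0 := by
  refine clm_ext_ket fun a b r => ?_
  rw [mul_apply_eq_comp]
  by_cases h' : b = x
  · subst h'
    rw [leftPath_ket, leftPath_ket_of_ne _ _ h]
    rfl
  · rw [leftPath_ket_of_ne _ _ h', map_zero]
    rfl

theorem leftPath_cons {x y z : V} (p : Path x y) (e : y ⟶ z) :
    leftPath (p.cons e) = leftEdge e * leftPath p := by
  rw [← leftPath_toPath, leftPath_mul]
  rfl

theorem leftPathInv_mul_leftPath {x y : V} (p : Path x y) :
    leftPathInv p * leftPath p = leftVertex x := by
  refine clm_ext_ket fun a b q => ?_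
  rw [mul_apply_eq_comp]
  by_cases h : b = x
  · subst h
    rw [leftPath_ket, leftPathInv_ket, leftVertex_ket]
  · rw [leftPath_ket_of_ne _ _ h, leftVertex_ket_of_ne _ h, map_zero]

theorem leftVertex_mul_leftPath {x y : V} (p : Path x y) :
    leftVertex y * leftPath p = leftPath p := by
  rw [← leftPath_nil, leftPath_mul, Path.comp_nil]

theorem leftPath_mul_leftVertex {x y : V} (p : Path x y) :
    leftPath p * leftVertex x = leftPath p := by
  rw [← leftPath_nil, leftPath_mul, Path.nil_comp]

theorem leftVertex_mul_leftPath_of_ne {x y z : V} (p : Path x y) (h : y ≠ z) :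
    leftVertex z * leftPath p = 0 := by
  rw [← leftPath_nil, leftPath_mul_of_ne _ _ h]

theorem leftPath_mul_leftVertex_of_ne {x y z : V} (p : Path x y) (h : z ≠ x) :
    leftPath p * leftVertex z = 0 := by
  rw [← leftPath_nil, leftPath_mul_of_ne _ _ h]

theorem rightPath_mul_leftPath {x y z w : V} (q : Path x y) (p : Path z w) :
    rightPath q * leftPath p = leftPath p * rightPath q := by
  refine clm_ext_ket fun a b r => ?_
  rw [mul_apply_eq_comp, mul_apply_eq_comp]
  by_cases h : b = z
  · subst h
    rw [leftPath_ket]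
    by_cases h' : a = y
    · subst h'
      rw [rightPath_ket, rightPath_ket, leftPath_ket, Path.comp_assoc]
    · rw [rightPath_ket_of_ne _ _ h', rightPath_ket_of_ne _ _ h', map_zero]
  · rw [leftPath_ket_of_ne _ _ h, map_zero]
    by_cases h' : a = y
    · subst h'
      rw [rightPath_ket, leftPath_ket_of_ne _ _ h]
    · rw [rightPath_ket_of_ne _ _ h', map_zero]

theorem leftEdge_mem {x y : V} (e : x ⟶ y) : leftEdge e ∈ tensorAlgebra V :=
  subset_closure (NonUnitalAlgebra.subset_adjoin ℂ (Or.inl ⟨x, y, e, rfl⟩))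

theorem leftVertex_mem (x : V) : leftVertex x ∈ tensorAlgebra V :=
  subset_closure (NonUnitalAlgebra.subset_adjoin ℂ (Or.inr ⟨x, rfl⟩))

theorem leftPath_mem {x y : V} (p : Path x y) : leftPath p ∈ tensorAlgebra V := by
  induction p with
  | nil => exact leftPath_nil x ▸ leftVertex_mem x
  | cons p e ih => exact leftPath_cons p e ▸ mul_mem (leftEdge_mem e) ih

theorem isClosed_tensorAlgebra : IsClosed (tensorAlgebra V : Set (PathHilbert V →L[ℂ] PathHilbert V)) :=
  isClosed_closure

variable (V) in
/-- The operators `L_p`. -/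
def pathOperators : Set (PathHilbert V →L[ℂ] PathHilbert V) :=
  {T | ∃ (x y : V) (p : Path x y), T = leftPath p}

/-- A product of two operators L_p is again such an operator or zero, so their span is already
closed under multiplication. Hence closed linear conditions on 𝒜 need only be tested on the L_p. -/
theorem adjoin_le_span : ((NonUnitalAlgebra.adjoin ℂ
    ({T | ∃ (x y : V) (e : x ⟶ y), T = leftEdge e} ∪ {T | ∃ x : V, T = leftVertex x}) :
      NonUnitalSubalgebra ℂ (PathHilbert V →L[ℂ] PathHilbert V)) :
        Set (PathHilbert V →L[ℂ] PathHilbert V)) ⊆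
      (Submodule.span ℂ (pathOperators V) : Set (PathHilbert V →L[ℂ] PathHilbert V)) := by
  intro T hT
  induction hT using NonUnitalAlgebra.adjoin_induction with
  | mem T hT =>
    rcases hT with ⟨x, y, e, rfl⟩ | ⟨x, rfl⟩
    · exact Submodule.subset_span ⟨x, y, e.toPath, (leftPath_toPath e).symm⟩
    · exact Submodule.subset_span ⟨x, x, Path.nil, (leftPath_nil x).symm⟩
  | add S T _ _ hS hT => exact add_mem hS hT
  | zero => exact zero_mem _
  | smul c T _ hT => exact Submodule.smul_mem _ c hT
  | mul S T _ _ hS hT =>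
    have := Submodule.mul_mem_mul hS hT
    rw [Submodule.span_mul_span] at this
    refine Submodule.span_le.2 ?_ this
    rintro _ ⟨_, ⟨x, y, p, rfl⟩, _, ⟨x', y', p', rfl⟩, rfl⟩
    by_cases h : y' = x
    · subst h
      exact Submodule.subset_span ⟨_, _, p'.comp p, leftPath_mul p p'⟩
    · simp only [leftPath_mul_of_ne p p' h]
      exact zero_mem _

theorem mem_closure_span {T : PathHilbert V →L[ℂ] PathHilbert V} (hT : T ∈ tensorAlgebra V) :
    T ∈ closure (Submodule.span ℂ (pathOperators V) : Set (PathHilbert V →L[ℂ] PathHilbert V)) :=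
  closure_mono adjoin_le_span hT

/-- A closed property of operators that is stable under linear combinations holds on the tensor
algebra as soon as it holds for all `L_p`. -/
theorem tensorAlgebra_induction {M : Submodule ℂ (PathHilbert V →L[ℂ] PathHilbert V)}
    (hM : IsClosed (M : Set (PathHilbert V →L[ℂ] PathHilbert V)))
    (h : ∀ (x y : V) (p : Path x y), leftPath p ∈ M)
    {T : PathHilbert V →L[ℂ] PathHilbert V} (hT : T ∈ tensorAlgebra V) : T ∈ M := by
  refine closure_minimal (Submodule.span_le.2 ?_) hM (mem_closure_span hT)
  rintro _ ⟨x, y, p, rfl⟩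
  exact h x y p

/-- The closed subspace of operators on which two bounded linear maps agree. -/
def eqSubmodule {E F : Type*} [NormedAddCommGroup E] [NormedSpace ℂ E] [NormedAddCommGroup F]
    [NormedSpace ℂ F] (f g : E →L[ℂ] F) : Submodule ℂ E :=
  LinearMap.eqLocus (f : E →ₗ[ℂ] F) (g : E →ₗ[ℂ] F)

theorem isClosed_eqSubmodule {E F : Type*} [NormedAddCommGroup E] [NormedSpace ℂ E]
    [NormedAddCommGroup F] [NormedSpace ℂ F] (f g : E →L[ℂ] F) :
    IsClosed (eqSubmodule f g : Set E) :=
  isClosed_eq f.continuous g.continuous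

/-- Two bounded linear maps that agree on all `L_p` agree on the tensor algebra. -/
theorem eq_of_eq_leftPath {F : Type*} [NormedAddCommGroup F] [NormedSpace ℂ F]
    (f g : (PathHilbert V →L[ℂ] PathHilbert V) →L[ℂ] F)
    (h : ∀ (x y : V) (p : Path x y), f (leftPath p) = g (leftPath p))
    {T : PathHilbert V →L[ℂ] PathHilbert V} (hT : T ∈ tensorAlgebra V) : f T = g T :=
  tensorAlgebra_induction (isClosed_eqSubmodule f g) h hT

/-- Left and right multiplications commute. Consequently an element of 𝒜 is determined by its action
on the vertex vectors, which is what makes `coef` a complete set of invariants. -/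
theorem mul_rightPath {T : PathHilbert V →L[ℂ] PathHilbert V} (hT : T ∈ tensorAlgebra V)
    {x y : V} (q : Path x y) : T * rightPath q = rightPath q * T :=
  eq_of_eq_leftPath ((ContinuousLinearMap.mul ℂ _).flip (rightPath q))
    (ContinuousLinearMap.mul ℂ _ (rightPath q))
    (fun _ _ p => (rightPath_mul_leftPath q p).symm) hT

/-- The Fourier coefficient of an operator at a path. -/
noncomputable def coef (T : PathHilbert V →L[ℂ] PathHilbert V) {a b : V} (p : Path a b) : ℂ :=
  T (ket (Path.nil : Path a a)) ⟨a, b, p⟩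

theorem apply_ket {T : PathHilbert V →L[ℂ] PathHilbert V} (hT : T ∈ tensorAlgebra V)
    {a b : V} (q : Path a b) : T (ket q) = rightPath q (T (ket (Path.nil : Path b b))) := by
  have := DFunLike.congr_fun (mul_rightPath hT q) (ket (Path.nil : Path b b))
  rwa [mul_apply_eq_comp, mul_apply_eq_comp, rightPath_ket,
    Path.comp_nil] at this

theorem apply_ket_comp {T : PathHilbert V →L[ℂ] PathHilbert V} (hT : T ∈ tensorAlgebra V)
    {a b c : V} (q : Path a b) (p : Path b c) : T (ket q) ⟨a, c, q.comp p⟩ = coef T p := by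
  rw [apply_ket hT, rightPath_apply_comp, coef]

theorem apply_ket_eq_zero {T : PathHilbert V →L[ℂ] PathHilbert V} (hT : T ∈ tensorAlgebra V)
    {a b c : V} (q : Path a b) {r : Path a c} (h : ∀ p : Path b c, r ≠ q.comp p) :
    T (ket q) ⟨a, c, r⟩ = 0 := by
  rw [apply_ket hT]
  refine rightPath_apply_eq_zero _ _ fun d p hp => ?_
  obtain ⟨rfl, h1⟩ := Sigma.mk.inj_iff.1 (Sigma.mk.inj_iff.1 hp).2.eq
  exact h p h1.eq

theorem coef_leftPath_mul {T : PathHilbert V →L[ℂ] PathHilbert V} {a x y : V} (p : Path x y)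
    (q : Path a x) : coef (leftPath p * T) (q.comp p) = coef T q := by
  rw [coef, mul_apply_eq_comp, leftPath_apply_comp, coef]

theorem coef_mul_leftPath {T : PathHilbert V →L[ℂ] PathHilbert V} (hT : T ∈ tensorAlgebra V)
    {x y b : V} (q : Path x y) (p : Path y b) : coef (T * leftPath q) (q.comp p) = coef T p := by
  rw [coef, mul_apply_eq_comp, leftPath_ket, Path.nil_comp, apply_ket_comp hT]

theorem coef_mul_leftPath_eq_zero {T : PathHilbert V →L[ℂ] PathHilbert V}
    (hT : T ∈ tensorAlgebra V) {x y b : V} (q : Path x y) {r : Path x b}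
    (h : ∀ p : Path y b, r ≠ q.comp p) : coef (T * leftPath q) r = 0 := by
  rw [coef, mul_apply_eq_comp, leftPath_ket, Path.nil_comp, apply_ket_eq_zero hT _ h]

theorem coef_leftPath_self {x y : V} (p : Path x y) : coef (leftPath p) p = 1 := by
  rw [coef, leftPath_ket, Path.nil_comp, ket_apply_self]

theorem coef_leftPath_of_ne {x y : V} {p q : Path x y} (h : q ≠ p) : coef (leftPath p) q = 0 := by
  rw [coef, leftPath_ket, Path.nil_comp, ket_apply_path_of_ne h]

end LeftRight

end DiGraph

namespace DiGraph

open Quiver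

/-! ### Derivations implemented by bounded operators; finiteness of the vertex set -/

section SpatialDerivations

variable {V : Type u} [Quiver.{v} V]

/-- The Leibniz rule carries membership from generators to all L_p, and closedness of 𝒜 carries it
to limits. So X only has to be tested on vertices and edges. -/
theorem commutator_mem {X : PathHilbert V →L[ℂ] PathHilbert V}
    (hv : ∀ x : V, leftVertex x * X - X * leftVertex x ∈ tensorAlgebra V)
    (he : ∀ (x y : V) (e : x ⟶ y), leftEdge e * X - X * leftEdge e ∈ tensorAlgebra V)
    {A : PathHilbert V →L[ℂ] PathHilbert V} (hA : A ∈ tensorAlgebra V) :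
    A * X - X * A ∈ tensorAlgebra V := by
  let f : (PathHilbert V →L[ℂ] PathHilbert V) →L[ℂ] (PathHilbert V →L[ℂ] PathHilbert V) :=
    (ContinuousLinearMap.mul ℂ _).flip X - ContinuousLinearMap.mul ℂ _ X
  have hf : ∀ A, f A = A * X - X * A := fun A => rfl
  let M : Submodule ℂ (PathHilbert V →L[ℂ] PathHilbert V) :=
    (tensorAlgebra V).toSubmodule.comap (f : _ →ₗ[ℂ] _)
  have hM : IsClosed (M : Set (PathHilbert V →L[ℂ] PathHilbert V)) :=
    isClosed_tensorAlgebra.preimage f.continuous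
  refine tensorAlgebra_induction (M := M) hM (fun x y p => ?_) hA
  change leftPath p * X - X * leftPath p ∈ tensorAlgebra V
  induction p with
  | nil => rw [leftPath_nil]; exact hv x
  | cons p e ih =>
    have : leftPath (p.cons e) * X - X * leftPath (p.cons e) =
        leftEdge e * (leftPath p * X - X * leftPath p) +
          (leftEdge e * X - X * leftEdge e) * leftPath p := by
      rw [leftPath_cons]; noncomm_ring
    rw [this]
    exact add_mem (mul_mem (leftEdge_mem e) ih) (mul_mem (he _ _ e) (leftPath_mem p))

/-- If all bounded derivations are inner, then a derivation of the tensor algebra that is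
implemented by a bounded operator is implemented by an element of the tensor algebra. -/
theorem exists_implementing (h : ∀ δ : tensorAlgebra V →L[ℂ] tensorAlgebra V,
      IsDerivation δ → IsInner δ) {X : PathHilbert V →L[ℂ] PathHilbert V}
    (hv : ∀ x : V, leftVertex x * X - X * leftVertex x ∈ tensorAlgebra V)
    (he : ∀ (x y : V) (e : x ⟶ y), leftEdge e * X - X * leftEdge e ∈ tensorAlgebra V) :
    ∃ T ∈ tensorAlgebra V, ∀ (x y : V) (p : Path x y),
      leftPath p * X - X * leftPath p = leftPath p * T - T * leftPath p := by
  let δ : tensorAlgebra V →L[ℂ] tensorAlgebra V :=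
    { toFun := fun A => ⟨A.1 * X - X * A.1, commutator_mem hv he A.2⟩
      map_add' := fun A B => by
        apply Subtype.ext
        change (A.1 + B.1) * X - X * (A.1 + B.1) = (A.1 * X - X * A.1) + (B.1 * X - X * B.1)
        noncomm_ring
      map_smul' := fun c A => by
        apply Subtype.ext
        change (c • A.1) * X - X * (c • A.1) = c • (A.1 * X - X * A.1)
        rw [smul_mul_assoc, mul_smul_comm, smul_sub]
      cont := by
        refine Continuous.subtype_mk ?_ _
        exact (continuous_subtype_val.mul continuous_const).sub
          (continuous_const.mul continuous_subtype_val) }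
  have hδ : ∃ T : tensorAlgebra V, ∀ A, δ A = A * T - T * A := by
    refine h δ fun A B => ?_
    apply Subtype.ext
    change (A.1 * B.1) * X - X * (A.1 * B.1) =
      (A.1 * X - X * A.1) * B.1 + A.1 * (B.1 * X - X * B.1)
    noncomm_ring
  obtain ⟨T, hT⟩ := hδ
  exact ⟨T.1, T.2, fun x y p => congrArg Subtype.val (hT ⟨leftPath p, leftPath_mem p⟩)⟩

theorem isPartialBij_eq_and (A : Set V) :
    IsPartialBij (fun w w' : PathSpace V => w = w' ∧ w.2.1 ∈ A) :=
  ⟨fun _ _ _ h h' => h.1.symm.trans h'.1, fun _ _ _ h h' => h.1.trans h'.1.symm⟩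

/-- The projection onto the paths with range in a set of vertices. -/
noncomputable def rangeProj (A : Set V) : PathHilbert V →L[ℂ] PathHilbert V :=
  relOp _ (isPartialBij_eq_and A)

theorem rangeProj_ket {A : Set V} {a b : V} (p : Path a b) (hb : b ∈ A) :
    rangeProj A (ket p) = ket p := by
  let _ : DecidableEq (PathSpace V) := Classical.decEq _
  exact relOp_single (isPartialBij_eq_and A) ⟨rfl, hb⟩

theorem rangeProj_ket_of_not_mem {A : Set V} {a b : V} (p : Path a b) (hb : b ∉ A) :
    rangeProj A (ket p) = 0 := by
  let _ : DecidableEq (PathSpace V) := Classical.decEq _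
  exact relOp_single_eq_zero (isPartialBij_eq_and A) fun _ h => hb h.2

open Classical in
theorem rangeProj_mul_leftPath (A : Set V) {x y : V} (p : Path x y) :
    rangeProj A * leftPath p = (if y ∈ A then (1 : ℂ) else 0) • leftPath p := by
  refine clm_ext_ket fun a b q => ?_
  rw [mul_apply_eq_comp, smul_apply]
  by_cases h : b = x
  · subst h
    rw [leftPath_ket]
    split_ifs with hy
    · rw [rangeProj_ket _ hy, one_smul]
    · rw [rangeProj_ket_of_not_mem _ hy, zero_smul]
  · rw [leftPath_ket_of_ne _ _ h, map_zero, smul_zero]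

open Classical in
theorem leftPath_mul_rangeProj (A : Set V) {x y : V} (p : Path x y) :
    leftPath p * rangeProj A = (if x ∈ A then (1 : ℂ) else 0) • leftPath p := by
  refine clm_ext_ket fun a b q => ?_
  rw [mul_apply_eq_comp, smul_apply]
  by_cases h : b ∈ A
  · rw [rangeProj_ket _ h]
    by_cases hb : b = x
    · subst hb; rw [if_pos h, one_smul]
    · rw [leftPath_ket_of_ne _ _ hb, smul_zero]
  · rw [rangeProj_ket_of_not_mem _ h, map_zero]
    by_cases hb : b = x
    · subst hb; rw [if_neg h, zero_smul]
    · rw [leftPath_ket_of_ne _ _ hb, smul_zero]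

theorem norm_coef_le (T : PathHilbert V →L[ℂ] PathHilbert V) {a b : V} (p : Path a b) :
    ‖coef T p‖ ≤ ‖T‖ := by
  refine (norm_apply_le _ _).trans ((T.le_opNorm _).trans ?_)
  rw [norm_ket, mul_one]

theorem coef_sub (S T : PathHilbert V →L[ℂ] PathHilbert V) {a b : V} (p : Path a b) :
    coef (S - T) p = coef S p - coef T p := rfl

theorem coef_smul (c : ℂ) (T : PathHilbert V →L[ℂ] PathHilbert V) {a b : V} (p : Path a b) :
    coef (c • T) p = c * coef T p := rfl

/-- The vertex coefficients of an element of the tensor algebra vanish at infinity. -/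
theorem tendsto_coef_nil {T : PathHilbert V →L[ℂ] PathHilbert V} (hT : T ∈ tensorAlgebra V) :
    Filter.Tendsto (fun x : V => coef T (Path.nil : Path x x)) Filter.cofinite (nhds 0) := by
  let M : Submodule ℂ (PathHilbert V →L[ℂ] PathHilbert V) :=
    { carrier := {T | Filter.Tendsto (fun x : V => coef T (Path.nil : Path x x))
        Filter.cofinite (nhds 0)}
      add_mem' := fun {S T} hS hT => by
        have := Filter.Tendsto.add hS hT
        rwa [add_zero] at this
      zero_mem' := tendsto_const_nhds
      smul_mem' := fun c T hT => by
        have := Filter.Tendsto.const_mul c hT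
        rwa [mul_zero] at this }
  -- Coefficients are bounded by the operator norm, uniformly in the vertex, so decay at infinity
  -- survives norm limits.
  have hM : IsClosed (M : Set (PathHilbert V →L[ℂ] PathHilbert V)) := by
    refine isClosed_of_closure_subset fun T hT => ?_
    change Filter.Tendsto _ _ _
    rw [Metric.tendsto_nhds]
    intro ε hε
    obtain ⟨S, hS, hST⟩ := Metric.mem_closure_iff.1 hT (ε / 2) (half_pos hε)
    filter_upwards [Metric.tendsto_nhds.1 hS (ε / 2) (half_pos hε)] with x hx
    rw [dist_zero_right] at hx ⊢
    rw [dist_eq_norm] at hST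
    have h1 := norm_coef_le (T - S) (Path.nil : Path x x)
    rw [coef_sub] at h1
    have h2 := norm_add_le (coef T (Path.nil : Path x x) - coef S (Path.nil : Path x x))
      (coef S (Path.nil : Path x x))
    rw [sub_add_cancel] at h2
    linarith
  refine tensorAlgebra_induction (M := M) hM (fun x y p => ?_) hT
  change Filter.Tendsto _ _ _
  refine tendsto_const_nhds.congr' ?_
  have : {x}ᶜ ∈ (Filter.cofinite : Filter V) := (Set.finite_singleton x).compl_mem_cofinite
  filter_upwards [this] with z hz
  have hz : z ≠ x := hz
  rw [coef, leftPath_ket_of_ne _ _ hz]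
  rfl

theorem coef_leftEdge_mul_sub {T : PathHilbert V →L[ℂ] PathHilbert V} (hT : T ∈ tensorAlgebra V)
    {x y : V} (e : x ⟶ y) :
    coef (leftPath e.toPath * T - T * leftPath e.toPath) e.toPath =
      coef T (Path.nil : Path x x) - coef T (Path.nil : Path y y) := by
  rw [coef_sub]
  have h1 := coef_leftPath_mul (T := T) e.toPath (Path.nil : Path x x)
  have h2 := coef_mul_leftPath hT e.toPath (Path.nil : Path y y)
  rw [Path.nil_comp] at h1
  rw [Path.comp_nil] at h2
  rw [h1, h2]

/-- Invariance along edges in both directions. With α = Prop this is the way connectedness is used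
below: a property that is preserved both ways by every edge holds everywhere or nowhere. -/
theorem eq_of_forall_edge_eq {α : Type*} {f : V → α} (hconn : IsConnected V)
    (h : ∀ (x y : V), (x ⟶ y) → f x = f y) (a b : V) : f a = f b := by
  obtain ⟨p⟩ := hconn.2 a b
  have key : ∀ c : Symmetrify V, @Path (Symmetrify V) _ a c → f a = f c := by
    intro c p
    induction p with
    | nil => rfl
    | cons p e ih =>
      rw [ih]
      rcases e with e | e
      · exact h _ _ e
      · exact (h _ _ e).symm
  exact key b p

/-- If all bounded derivations are inner, then there are only finitely many vertices. -/
theorem finite_of_forall_isInner (hconn : IsConnected V)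
    (h : ∀ δ : tensorAlgebra V →L[ℂ] tensorAlgebra V, IsDerivation δ → IsInner δ) :
    Finite V := by
  classical
  by_contra hfin
  rw [not_finite_iff_infinite] at hfin
  let φ := Infinite.natEmbedding V
  let A : Set V := φ '' {n | Even n}
  have hA : A.Infinite := by
    refine Set.Infinite.image φ.injective.injOn ?_
    exact Set.infinite_of_injective_forall_mem (f := fun n : ℕ => 2 * n)
      (fun a b h => by simpa using h) fun n => even_two_mul n
  have hB : (Aᶜ).Infinite := by
    have : (φ '' {n | Odd n}).Infinite := by
      refine Set.Infinite.image φ.injective.injOn ?_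
      exact Set.infinite_of_injective_forall_mem (f := fun n : ℕ => 2 * n + 1)
        (fun a b h => by simpa using h) fun n => odd_two_mul_add_one n
    refine this.mono ?_
    rintro _ ⟨n, hn, rfl⟩ ⟨m, hm, hmn⟩
    obtain rfl := φ.injective hmn
    exact (Nat.not_even_iff_odd.2 hn) hm
  -- Each L_p is an eigenvector of the commutator with this projection, with eigenvalue in {0, 1,
  -- -1}, so the derivation preserves 𝒜 although the projection need not belong to it.
  obtain ⟨T, hT, hTX⟩ := exists_implementing h (X := rangeProj A)
    (fun x => by
      rw [← leftPath_nil, leftPath_mul_rangeProj, rangeProj_mul_leftPath, sub_self]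
      exact zero_mem _)
    (fun x y e => by
      rw [← leftPath_toPath, leftPath_mul_rangeProj, rangeProj_mul_leftPath, ← sub_smul]
      exact SMulMemClass.smul_mem _ (leftPath_mem _))
  have h1 : ∀ (x y : V), (x ⟶ y) → (if x ∈ A then (1 : ℂ) else 0) - coef T (Path.nil : Path x x) =
      (if y ∈ A then (1 : ℂ) else 0) - coef T (Path.nil : Path y y) := by
    intro x y e
    have h2 := coef_leftEdge_mul_sub hT e
    rw [← hTX, leftPath_mul_rangeProj, rangeProj_mul_leftPath, coef_sub, coef_smul, coef_smul,
      coef_leftPath_self] at h2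
    linear_combination h2
  have h2 := eq_of_forall_edge_eq (f := fun x : V => (if x ∈ A then (1 : ℂ) else 0) -
    coef T (Path.nil : Path x x)) hconn h1
  have ht := tendsto_coef_nil hT
  obtain ⟨⟨x0⟩, -⟩ := hconn
  set κ := (if x0 ∈ A then (1 : ℂ) else 0) - coef T (Path.nil : Path x0 x0)
  -- The indicator of A minus the vertex coefficient of T is a constant κ. On an infinite set where
  -- the indicator is c the coefficients are constantly c - κ, yet tend to zero; with A and its
  -- complement this gives κ = 1 and κ = 0.
  have h3 : ∀ (B : Set V) (c : ℂ), B.Infinite → (∀ x ∈ B, (if x ∈ A then (1 : ℂ) else 0) = c) →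
      c - κ = 0 := by
    intro B c hB hc
    have hfr : ∃ᶠ x in (Filter.cofinite : Filter V), x ∈ B := Filter.frequently_cofinite_iff_infinite.2 hB
    have : Filter.NeBot ((Filter.cofinite : Filter V) ⊓ Filter.principal B) :=
      Filter.frequently_mem_iff_neBot.1 hfr
    have h4 := ht.mono_left (inf_le_left : Filter.cofinite ⊓ Filter.principal B ≤ Filter.cofinite)
    refine tendsto_nhds_unique (tendsto_const_nhds.congr' ?_) h4
    filter_upwards [Filter.mem_inf_of_right (Filter.mem_principal_self B)] with x hx
    have := h2 x x0
    simp only [hc x hx] at this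
    linear_combination this
  have h5 := h3 A 1 hA fun x hx => if_pos hx
  have h6 := h3 Aᶜ 0 hB fun x hx => if_neg hx
  have : (1 : ℂ) = 0 := by linear_combination h5 - h6
  exact one_ne_zero this

end SpatialDerivations

end DiGraph

namespace DiGraph

open Quiver

/-! ### Insertion of closed paths at an external edge -/

section Insertion

variable {V : Type u} [Quiver.{v} V]

/-- An edge from `x` to `y` is external if no path leads back from `y` to `x`. -/
def IsExternal {x y : V} (_f : x ⟶ y) : Prop := IsEmpty (Path y x)

/-- An external edge is crossed at most once: between two crossings a path would lead from y back to
x. Peeling off last edges, a mismatch produces exactly such a path. -/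
theorem IsExternal.decomposition_unique {x y : V} {f : x ⟶ y} (hf : IsExternal f) {a b : V}
    {p p' : Path a x} {q q' : Path y b} (h : (p.cons f).comp q = (p'.cons f).comp q') :
    p = p' ∧ q = q' := by
  induction q with
  | nil =>
    cases q' with
    | nil =>
      rw [Path.comp_nil, Path.comp_nil] at h
      exact ⟨(Path.heq_of_cons_eq_cons h).eq, rfl⟩
    | cons q' e =>
      rw [Path.comp_nil, Path.comp_cons] at h
      obtain rfl := Path.obj_eq_of_cons_eq_cons h
      exact (hf.false q').elim
  | cons q e ih =>
    cases q' with
    | nil =>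
      rw [Path.comp_nil, Path.comp_cons] at h
      obtain rfl := Path.obj_eq_of_cons_eq_cons h
      exact (hf.false q).elim
    | cons q' e' =>
      rw [Path.comp_cons, Path.comp_cons] at h
      obtain rfl := Path.obj_eq_of_cons_eq_cons h
      obtain ⟨rfl, rfl⟩ := ih (Path.heq_of_cons_eq_cons h).eq
      obtain rfl := (Path.hom_heq_of_cons_eq_cons h).eq
      exact ⟨rfl, rfl⟩

/-- The relation between a path through `f` and the path obtained from it by inserting the closed
path `c` before `f` and the closed path `d` after `f`. -/
def insertRel {x y : V} (f : x ⟶ y) (c : Path x x) (d : Path y y) (w w' : PathSpace V) : Prop :=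
  ∃ (a b : V) (p : Path a x) (q : Path y b), w = ⟨a, b, (p.cons f).comp q⟩ ∧
    w' = ⟨a, b, ((p.comp c).cons f).comp (d.comp q)⟩

theorem isPartialBij_insertRel {x y : V} {f : x ⟶ y} (hf : IsExternal f) (c : Path x x)
    (d : Path y y) : IsPartialBij (insertRel f c d) := by
  constructor
  · rintro _ _ _ ⟨a, b, p, q, rfl, rfl⟩ ⟨a', b', p', q', h, rfl⟩
    obtain ⟨rfl, h⟩ := Sigma.mk.inj_iff.1 h
    obtain ⟨rfl, h⟩ := Sigma.mk.inj_iff.1 h.eq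
    obtain ⟨rfl, rfl⟩ := hf.decomposition_unique h.eq
    rfl
  · rintro _ _ _ ⟨a, b, p, q, rfl, rfl⟩ ⟨a', b', p', q', rfl, h⟩
    obtain ⟨rfl, h⟩ := Sigma.mk.inj_iff.1 h
    obtain ⟨rfl, h⟩ := Sigma.mk.inj_iff.1 h.eq
    obtain ⟨h1, h2⟩ := hf.decomposition_unique h.eq
    rw [Path.comp_inj_left.1 h1, Path.comp_inj_right.1 h2]

/-- The operator that inserts `c` before `f` and `d` after `f`, and annihilates the paths that do
not pass through `f`. -/
noncomputable def insertOp {x y : V} {f : x ⟶ y} (hf : IsExternal f) (c : Path x x)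
    (d : Path y y) : PathHilbert V →L[ℂ] PathHilbert V :=
  relOp _ (isPartialBij_insertRel hf c d)

variable {x y : V} {f : x ⟶ y} (hf : IsExternal f) (c : Path x x) (d : Path y y)

theorem insertOp_ket {a b : V} (p : Path a x) (q : Path y b) :
    insertOp hf c d (ket ((p.cons f).comp q)) = ket (((p.comp c).cons f).comp (d.comp q)) := by
  let _ : DecidableEq (PathSpace V) := Classical.decEq _
  exact relOp_single (isPartialBij_insertRel hf c d) ⟨a, b, p, q, rfl, rfl⟩

theorem insertOp_ket_eq_zero {a b : V} {r : Path a b}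
    (h : ∀ (p : Path a x) (q : Path y b), r ≠ (p.cons f).comp q) :
    insertOp hf c d (ket r) = 0 := by
  let _ : DecidableEq (PathSpace V) := Classical.decEq _
  refine relOp_single_eq_zero (isPartialBij_insertRel hf c d) ?_
  rintro _ ⟨a', b', p, q, h1, rfl⟩
  obtain ⟨rfl, h1⟩ := Sigma.mk.inj_iff.1 h1
  obtain ⟨rfl, h1⟩ := Sigma.mk.inj_iff.1 h1.eq
  exact h p q h1.eq

theorem norm_insertOp_le : ‖insertOp hf c d‖ ≤ 1 := norm_relOp_le _

theorem insertOp_apply {a b : V} (p : Path a x) (q : Path y b) (u : PathHilbert V) :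
    insertOp hf c d u ⟨a, b, ((p.comp c).cons f).comp (d.comp q)⟩ =
      u ⟨a, b, (p.cons f).comp q⟩ :=
  relOp_apply (isPartialBij_insertRel hf c d) ⟨a, b, p, q, rfl, rfl⟩ u

theorem insertOp_apply_eq_zero {a b : V} {r : Path a b} (u : PathHilbert V)
    (h : ∀ (p : Path a x) (q : Path y b), r ≠ ((p.comp c).cons f).comp (d.comp q)) :
    insertOp hf c d u ⟨a, b, r⟩ = 0 := by
  refine relOp_apply_eq_zero (isPartialBij_insertRel hf c d) ?_ u
  rintro _ ⟨a', b', p, q, rfl, h1⟩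
  obtain ⟨rfl, h1⟩ := Sigma.mk.inj_iff.1 h1
  obtain ⟨rfl, h1⟩ := Sigma.mk.inj_iff.1 h1.eq
  exact h p q h1.eq

theorem leftEdge_ket {a x y : V} (e : x ⟶ y) (p : Path a x) :
    leftEdge e (ket p) = ket (p.cons e) := by
  rw [← leftPath_toPath, leftPath_ket]; rfl

theorem leftEdge_ket_of_ne {a b x y : V} (e : x ⟶ y) (p : Path a b) (h : b ≠ x) :
    leftEdge e (ket p) = 0 := by
  rw [← leftPath_toPath, leftPath_ket_of_ne _ _ h]

theorem insertOp_mul_leftEdge_self :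
    insertOp hf c d * leftEdge f = leftPath ((c.cons f).comp d) := by
  refine clm_ext_ket fun a b r => ?_
  rw [mul_apply_eq_comp]
  by_cases h : b = x
  · subst h
    rw [leftEdge_ket, leftPath_ket]
    have := insertOp_ket hf c d r Path.nil
    simpa [← Path.comp_assoc] using this
  · rw [leftEdge_ket_of_ne _ _ h, leftPath_ket_of_ne _ _ h, map_zero]

/-- A path that has crossed f ends at a vertex reachable from y, hence not at x, so f cannot be
appended again. -/
theorem leftEdge_self_mul_insertOp : leftEdge f * insertOp hf c d = 0 := by
  refine clm_ext_ket fun a b r => ?_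
  rw [mul_apply_eq_comp]
  by_cases h : ∃ (p : Path a x) (q : Path y b), r = (p.cons f).comp q
  · obtain ⟨p, q, rfl⟩ := h
    rw [insertOp_ket, leftEdge_ket_of_ne]
    · rfl
    · rintro rfl
      exact hf.false q
  · push Not at h
    rw [insertOp_ket_eq_zero hf c d h, map_zero]
    rfl

theorem insertOp_mul_leftVertex (z : V) :
    insertOp hf c d * leftVertex z = leftVertex z * insertOp hf c d := by
  refine clm_ext_ket fun a b r => ?_
  rw [mul_apply_eq_comp, mul_apply_eq_comp]
  by_cases h : ∃ (p : Path a x) (q : Path y b), r = (p.cons f).comp q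
  · obtain ⟨p, q, rfl⟩ := h
    rw [insertOp_ket]
    by_cases hb : b = z
    · subst hb
      rw [leftVertex_ket, leftVertex_ket, insertOp_ket]
    · rw [leftVertex_ket_of_ne _ hb, leftVertex_ket_of_ne _ hb, map_zero]
  · push Not at h
    rw [insertOp_ket_eq_zero hf c d h, map_zero]
    by_cases hb : b = z
    · subst hb
      rw [leftVertex_ket, insertOp_ket_eq_zero hf c d h]
    · rw [leftVertex_ket_of_ne _ hb, map_zero]

theorem exists_eq_of_cons_eq {a b z : V} {e : b ⟶ z} {r : Path a b} {p : Path a x} {q : Path y z}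
    (hef : (⟨b, z, e⟩ : Total V) ≠ ⟨x, y, f⟩) (h : r.cons e = (p.cons f).comp q) :
    ∃ q' : Path y b, q = q'.cons e ∧ r = (p.cons f).comp q' := by
  cases q with
  | nil =>
    rw [Path.comp_nil] at h
    obtain rfl := Path.obj_eq_of_cons_eq_cons h
    obtain rfl := (Path.hom_heq_of_cons_eq_cons h).eq
    exact (hef rfl).elim
  | cons q g =>
    rw [Path.comp_cons] at h
    obtain rfl := Path.obj_eq_of_cons_eq_cons h
    obtain rfl := (Path.hom_heq_of_cons_eq_cons h).eq
    exact ⟨q, rfl, (Path.heq_of_cons_eq_cons h).eq⟩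

/-- Appending an edge other than f neither creates nor destroys a crossing of f and happens after
the place of insertion. -/
theorem insertOp_mul_leftEdge {s z : V} {e : s ⟶ z} (hef : (⟨s, z, e⟩ : Total V) ≠ ⟨x, y, f⟩) :
    insertOp hf c d * leftEdge e = leftEdge e * insertOp hf c d := by
  refine clm_ext_ket fun a b r => ?_
  rw [mul_apply_eq_comp, mul_apply_eq_comp]
  by_cases hb : b = s
  · subst hb
    rw [leftEdge_ket]
    by_cases h : ∃ (p : Path a x) (q : Path y b), r = (p.cons f).comp q
    · obtain ⟨p, q, rfl⟩ := h
      rw [insertOp_ket, leftEdge_ket, ← Path.comp_cons, insertOp_ket]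
      rfl
    · rw [insertOp_ket_eq_zero, insertOp_ket_eq_zero, map_zero]
      · push Not at h
        exact h
      · intro p q hpq
        obtain ⟨q', rfl, hq⟩ := exists_eq_of_cons_eq hef hpq
        exact h ⟨p, q', hq⟩
  · rw [leftEdge_ket_of_ne _ _ hb, map_zero]
    by_cases h : ∃ (p : Path a x) (q : Path y b), r = (p.cons f).comp q
    · obtain ⟨p, q, rfl⟩ := h
      rw [insertOp_ket, leftEdge_ket_of_ne _ _ hb]
    · push Not at h
      rw [insertOp_ket_eq_zero hf c d h, map_zero]

theorem insertOp_nil_mul : insertOp hf Path.nil Path.nil * insertOp hf c d = insertOp hf c d := by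
  refine clm_ext_ket fun a b r => ?_
  rw [mul_apply_eq_comp]
  by_cases h : ∃ (p : Path a x) (q : Path y b), r = (p.cons f).comp q
  · obtain ⟨p, q, rfl⟩ := h
    rw [insertOp_ket, insertOp_ket, Path.comp_nil, Path.nil_comp]
  · push Not at h
    rw [insertOp_ket_eq_zero hf c d h, map_zero]

theorem mul_insertOp_nil : insertOp hf c d * insertOp hf Path.nil Path.nil = insertOp hf c d := by
  refine clm_ext_ket fun a b r => ?_
  rw [mul_apply_eq_comp]
  by_cases h : ∃ (p : Path a x) (q : Path y b), r = (p.cons f).comp q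
  · obtain ⟨p, q, rfl⟩ := h
    have := insertOp_ket hf Path.nil Path.nil p q
    rw [Path.comp_nil, Path.nil_comp] at this
    rw [this]
  · push Not at h
    rw [insertOp_ket_eq_zero hf c d h, insertOp_ket_eq_zero hf _ _ h, map_zero]

end Insertion

/-! ### Consequences of innerness for external edges -/

section ExternalEdges

variable {V : Type u} [Quiver.{v} V] {x y : V} {f : x ⟶ y}

/-- The commutators of the insertion operator with the generators vanish except at L_f, where the
commutator is again a path operator up to sign. So insertion gives a derivation of 𝒜, and an
implementing T inherits all these commutation relations. -/
theorem exists_implementing_insertOp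
    (h : ∀ δ : tensorAlgebra V →L[ℂ] tensorAlgebra V, IsDerivation δ → IsInner δ)
    (hf : IsExternal f) (c : Path x x) (d : Path y y) :
    ∃ T ∈ tensorAlgebra V,
      (∀ (s z : V) (e : s ⟶ z), (⟨s, z, e⟩ : Total V) ≠ ⟨x, y, f⟩ →
        leftEdge e * T = T * leftEdge e) ∧
      (∀ z : V, leftVertex z * T = T * leftVertex z) ∧
      T * leftEdge f - leftEdge f * T = leftPath ((c.cons f).comp d) := by
  obtain ⟨T, hT, hTX⟩ := exists_implementing h (X := insertOp hf c d)
    (fun z => by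
      rw [insertOp_mul_leftVertex, sub_self]
      exact zero_mem _)
    (fun s z e => by
      by_cases hef : (⟨s, z, e⟩ : Total V) = ⟨x, y, f⟩
      · cases hef
        rw [leftEdge_self_mul_insertOp, insertOp_mul_leftEdge_self, zero_sub]
        exact neg_mem (leftPath_mem _)
      · rw [insertOp_mul_leftEdge hf c d hef, sub_self]
        exact zero_mem _)
  refine ⟨T, hT, fun s z e hef => ?_, fun z => ?_, ?_⟩
  · have := hTX _ _ e.toPath
    rw [leftPath_toPath, insertOp_mul_leftEdge hf c d hef, sub_self] at this
    exact sub_eq_zero.1 this.symm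
  · have := hTX _ _ (Path.nil : Path z z)
    rw [leftPath_nil, insertOp_mul_leftVertex, sub_self] at this
    exact sub_eq_zero.1 this.symm
  · have := hTX _ _ f.toPath
    rw [leftPath_toPath, leftEdge_self_mul_insertOp, insertOp_mul_leftEdge_self, zero_sub] at this
    rw [← neg_inj, this, neg_sub]

open Classical in
/-- If all bounded derivations are inner, then the characteristic function of an external edge is
a coboundary. -/
theorem exists_potential_of_forall_isInner
    (h : ∀ δ : tensorAlgebra V →L[ℂ] tensorAlgebra V, IsDerivation δ → IsInner δ)
    (hf : IsExternal f) :
    ∃ t : V → ℂ, ∀ (s z : V) (e : s ⟶ z),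
      t s - t z = if (⟨s, z, e⟩ : Total V) = ⟨x, y, f⟩ then 1 else 0 := by
  obtain ⟨T, hT, h1, -, h2⟩ := exists_implementing_insertOp h hf Path.nil Path.nil
  refine ⟨fun z => -coef T (Path.nil : Path z z), fun s z e => ?_⟩
  have h3 := coef_leftEdge_mul_sub hT e
  rw [leftPath_toPath] at h3
  split_ifs with hef
  · cases hef
    have h4 := congrArg (fun S => coef S f.toPath) h2
    rw [← neg_sub, Path.comp_nil] at h4
    have h5 : coef (-(leftEdge f * T - T * leftEdge f)) f.toPath =
        coef (leftPath f.toPath) f.toPath := h4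
    rw [coef_leftPath_self, ← neg_one_smul ℂ, coef_smul, h3] at h5
    linear_combination h5
  · rw [h1 _ _ e hef, sub_self] at h3
    have h4 : coef (0 : PathHilbert V →L[ℂ] PathHilbert V) e.toPath = 0 := rfl
    rw [h4] at h3
    linear_combination h3

/-- A path from whose end x can still be reached has not used f, so only generators commuting with T
occur in it. -/
theorem leftPath_mul_comm_of_path {T : PathHilbert V →L[ℂ] PathHilbert V}
    (hf : IsExternal f)
    (h1 : ∀ (s z : V) (e : s ⟶ z), (⟨s, z, e⟩ : Total V) ≠ ⟨x, y, f⟩ →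
        leftEdge e * T = T * leftEdge e)
    (h2 : ∀ z : V, leftVertex z * T = T * leftVertex z) {a b : V} (p : Path a b)
    (hb : Nonempty (Path b x)) : leftPath p * T = T * leftPath p := by
  induction p with
  | nil => rw [leftPath_nil, h2]
  | cons p e ih =>
    obtain ⟨q⟩ := hb
    rw [leftPath_cons, mul_assoc, ih ⟨e.toPath.comp q⟩, ← mul_assoc, h1, mul_assoc]
    intro hef
    cases hef
    exact hf.false q

/-- Compare coefficients at "p, then f". The term T L_f only sees paths that begin with f, and since
f is crossed once this would force p to be trivial; only L_f T contributes. -/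
theorem coef_eq_of_insertOp {T : PathHilbert V →L[ℂ] PathHilbert V} (hT : T ∈ tensorAlgebra V)
    (hf : IsExternal f) {c : Path x x}
    (h3 : T * leftEdge f - leftEdge f * T = leftPath (c.cons f)) {p : Path x x}
    (hp : p ≠ Path.nil) : coef T p = - coef (leftPath c) p := by
  have h4 := congrArg (fun S => coef S (p.cons f)) h3
  rw [← leftPath_toPath, coef_sub, coef_mul_leftPath_eq_zero hT] at h4
  · have h5 := coef_leftPath_mul (T := T) f.toPath p
    rw [Path.comp_toPath_eq_cons] at h5
    rw [h5] at h4
    by_cases hpc : p = c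
    · subst hpc
      rw [coef_leftPath_self] at h4 ⊢
      linear_combination -h4
    · rw [coef_leftPath_of_ne hpc]
      rw [coef_leftPath_of_ne] at h4
      · linear_combination -h4
      · intro h6
        exact hpc (Path.heq_of_cons_eq_cons h6).eq
  · intro q hq
    have : ((Path.nil : Path x x).cons f).comp q = (p.cons f).comp Path.nil := hq.symm
    exact hp (hf.decomposition_unique this).1.symm

/-- Closed paths at the source of an external edge commute. -/
theorem closed_paths_commute
    (h : ∀ δ : tensorAlgebra V →L[ℂ] tensorAlgebra V, IsDerivation δ → IsInner δ)
    (hf : IsExternal f) (c d : Path x x) : c.comp d = d.comp c := by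
  by_cases hc : c = Path.nil
  · subst hc; simp
  obtain ⟨T, hT, h1, h2, h3⟩ := exists_implementing_insertOp h hf c Path.nil
  rw [Path.comp_nil] at h3
  have h4 := leftPath_mul_comm_of_path hf h1 h2 d ⟨Path.nil⟩
  -- The coefficient of L_d T = T L_d at `c.comp d` is -1. Nonvanishing for T L_d forces `c.comp d`
  -- to begin with d, and the rest to be the only nontrivial closed path with nonzero coefficient,
  -- namely c.
  have h5 := coef_leftPath_mul (T := T) d c
  rw [coef_eq_of_insertOp hT hf h3 hc, coef_leftPath_self, h4] at h5
  by_cases h6 : ∃ p : Path x x, c.comp d = d.comp p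
  · obtain ⟨p, hp⟩ := h6
    rw [hp, coef_mul_leftPath hT] at h5
    have hp0 : p ≠ Path.nil := by
      rintro rfl
      have := congrArg Path.length hp
      simp only [Path.length_comp, Path.length_nil] at this
      exact hc (Path.eq_nil_of_length_zero c (by omega))
    rw [coef_eq_of_insertOp hT hf h3 hp0] at h5
    by_cases hpc : p = c
    · rw [hp, hpc]
    · rw [coef_leftPath_of_ne hpc] at h5
      norm_num at h5
  · push Not at h6
    rw [coef_mul_leftPath_eq_zero hT _ h6] at h5
    norm_num at h5

/-- At most one external edge leaves a strongly connected component that contains a closed path of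
positive length. -/
theorem external_edge_unique
    (h : ∀ δ : tensorAlgebra V →L[ℂ] tensorAlgebra V, IsDerivation δ → IsInner δ)
    (hf : IsExternal f) {c : Path x x} (hc : c ≠ Path.nil) {x' y' : V} {g : x' ⟶ y'}
    (hg : IsExternal g) (q : Path x x') (q' : Path x' x) :
    (⟨x', y', g⟩ : Total V) = ⟨x, y, f⟩ := by
  by_contra hgf
  obtain ⟨T, hT, h1, h2, h3⟩ := exists_implementing_insertOp h hf c Path.nil
  rw [Path.comp_nil] at h3
  have h4 : leftPath (q.cons g) * T = T * leftPath (q.cons g) := by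
    rw [leftPath_cons, mul_assoc, leftPath_mul_comm_of_path hf h1 h2 q ⟨q'⟩, ← mul_assoc,
      h1 _ _ g hgf, mul_assoc]
  -- The left product has coefficient -1 at "c, q, g". The right product sees only paths beginning
  -- with "q, g"; as g is crossed once, that would give `c.comp q = q`, impossible by length.
  have h5 := coef_leftPath_mul (T := T) (q.cons g) c
  rw [coef_eq_of_insertOp hT hf h3 hc, coef_leftPath_self, h4,
    coef_mul_leftPath_eq_zero hT] at h5
  · norm_num at h5
  · intro p hp
    have h6 : ((c.comp q).cons g).comp Path.nil = (q.cons g).comp p := hp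
    have h7 := (hg.decomposition_unique h6).1
    have := congrArg Path.length h7
    rw [Path.length_comp] at this
    exact hc (Path.eq_nil_of_length_zero c (by omega))

end ExternalEdges

end DiGraph

namespace DiGraph

/-! ### Weak limits of bounded sequences of operators -/

section WeakLimits

open Filter Topology

variable {H : Type*} [NormedAddCommGroup H] [InnerProductSpace ℂ H] [CompleteSpace H]

/-- A bounded sequence of operators converges weakly along every ultrafilter. -/
theorem exists_weak_limit (U : Ultrafilter ℕ) {X : ℕ → H →L[ℂ] H} {C : ℝ} (hX : ∀ n, ‖X n‖ ≤ C) :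
    ∃ Y : H →L[ℂ] H, ∀ u v : H,
      Tendsto (fun n => inner ℂ (X n u) v) U (𝓝 (inner ℂ (Y u) v)) := by
  have hC : 0 ≤ C := (norm_nonneg _).trans (hX 0)
  have hb : ∀ n u v, ‖inner ℂ (X n u) v‖ ≤ C * ‖u‖ * ‖v‖ := fun n u v =>
    (norm_inner_le_norm _ _).trans (mul_le_mul_of_nonneg_right
      (((X n).le_opNorm u).trans (mul_le_mul_of_nonneg_right (hX n) (norm_nonneg u)))
      (norm_nonneg v))
  -- Matrix entries stay in a compact disc and so converge along the ultrafilter; the limit form is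
  -- bounded by C and is represented by an operator through the Riesz theorem.
  have h1 : ∀ u v : H, ∃ l : ℂ, ‖l‖ ≤ C * ‖u‖ * ‖v‖ ∧
      Tendsto (fun n => inner ℂ (X n u) v) U (𝓝 l) := by
    intro u v
    have hK := isCompact_closedBall (0 : ℂ) (C * ‖u‖ * ‖v‖)
    obtain ⟨l, hl, hl'⟩ := hK.ultrafilter_le_nhds (U.map fun n => inner ℂ (X n u) v) (by
      rw [le_principal_iff]
      exact Filter.mem_map.2 (Filter.univ_mem' fun n => by
        simpa using hb n u v))
    exact ⟨l, by simpa using hl, hl'⟩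
  choose l hl hlt using h1
  have h2 : ∀ u : H, ∃ y : H, ‖y‖ ≤ C * ‖u‖ ∧ ∀ v, inner ℂ y v = l u v := by
    intro u
    let φ : H →L[ℂ] ℂ := LinearMap.mkContinuous
      { toFun := l u
        map_add' := fun v w => tendsto_nhds_unique (hlt u (v + w)) (by
          simpa only [inner_add_right] using (hlt u v).add (hlt u w))
        map_smul' := fun c v => tendsto_nhds_unique (hlt u (c • v)) (by
          simpa only [inner_smul_right, RingHom.id_apply, smul_eq_mul] using
            (hlt u v).const_mul c) } (C * ‖u‖) (hl u)
    refine ⟨(InnerProductSpace.toDual ℂ H).symm φ, ?_, fun v => ?_⟩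
    · rw [LinearIsometryEquiv.norm_map]
      exact LinearMap.mkContinuous_norm_le _ (by positivity) _
    · rw [InnerProductSpace.toDual_symm_apply]
      rfl
  choose y hy hyl using h2
  refine ⟨LinearMap.mkContinuous
    { toFun := y
      map_add' := fun u w => ext_inner_right ℂ fun v => by
        rw [inner_add_left, hyl, hyl, hyl]
        exact tendsto_nhds_unique (hlt (u + w) v) (by
          simpa only [map_add, inner_add_left] using (hlt u v).add (hlt w v))
      map_smul' := fun c u => ext_inner_right ℂ fun v => by
        rw [RingHom.id_apply, inner_smul_left, hyl, hyl]
        exact tendsto_nhds_unique (hlt (c • u) v) (by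
          simpa only [map_smul, inner_smul_left] using (hlt u v).const_mul _) } C hy, ?_⟩
  intro u v
  have : inner ℂ (y u) v = l u v := hyl u v
  change Tendsto _ _ (𝓝 (inner ℂ (y u) v))
  rw [this]
  exact hlt u v

end WeakLimits

/-! ### The singular inner function exp(-1/(1-z)) of a contraction, approximated by radii r < 1 -/

section Contractions

open NormedSpace

variable {H : Type*} [NormedAddCommGroup H] [InnerProductSpace ℂ H] [CompleteSpace H]

/-- The exponential of a dissipative operator is a contraction. -/
theorem norm_exp_neg_le {B : H →L[ℂ] H} (hB : ∀ x, 0 ≤ (inner ℂ (B x) x).re) :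
    ‖exp (-B)‖ ≤ 1 := by
  refine ContinuousLinearMap.opNorm_le_bound _ zero_le_one fun x => ?_
  let g : ℝ → H := fun t => exp (t • (-B)) x
  have hg : ∀ t, HasDerivAt g (-B (g t)) t := by
    intro t
    have h1 := hasDerivAt_exp_smul_const' (𝕂 := ℝ) (-B) t
    have h2 := ((ContinuousLinearMap.apply ℂ H x).restrictScalars ℝ).hasFDerivAt.comp_hasDerivAt
      t h1
    exact h2
  -- Since g' = -B g, the derivative of ‖g‖² is -2 Re⟨B g, g⟩ ≤ 0; the claim compares times 0 and 1.
  have h3 : Antitone (fun t => ‖g t‖ ^ 2) := by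
    let _ : InnerProductSpace ℝ H := InnerProductSpace.rclikeToReal ℂ H
    refine antitone_of_hasDerivAt_nonpos (fun t => (hg t).norm_sq) fun t => ?_
    have := hB (g t)
    rw [← inner_conj_symm, Complex.conj_re] at this
    rw [real_inner_eq_re_inner ℂ, inner_neg_right]
    change 2 * -(inner ℂ (g t) (B (g t))).re ≤ 0
    linarith
  have h4 := h3 zero_le_one
  have h5 : g 0 = x := by
    simp [g]
  have h6 : g 1 = exp (-B) x := by simp [g]
  simp only [h5, h6] at h4
  rw [one_mul]
  exact (pow_le_pow_iff_left₀ (norm_nonneg _) (norm_nonneg _) two_ne_zero).1 h4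

/-- The operator `exp (-(1 - r S)⁻¹)`. -/
noncomputable def expResolvent (S : H →L[ℂ] H) (r : ℝ) : H →L[ℂ] H :=
  exp (-Ring.inverse (1 - (r : ℂ) • S))

variable {S : H →L[ℂ] H}

theorem norm_smul_lt_one (hS : ‖S‖ ≤ 1) {r : ℝ} (hr0 : 0 ≤ r) (hr1 : r < 1) :
    ‖(r : ℂ) • S‖ < 1 := by
  rw [norm_smul, Complex.norm_real, Real.norm_of_nonneg hr0]
  exact (mul_le_of_le_one_right hr0 hS).trans_lt hr1

theorem one_sub_mul_resolvent (hS : ‖S‖ ≤ 1) {r : ℝ} (hr0 : 0 ≤ r) (hr1 : r < 1) :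
    (1 - (r : ℂ) • S) * Ring.inverse (1 - (r : ℂ) • S) = 1 :=
  Ring.mul_inverse_cancel _ (isUnit_one_sub_of_norm_lt_one (norm_smul_lt_one hS hr0 hr1))

/-- The resolvent R has nonnegative real part: with v = R x one has Re⟨v, v - r S v⟩ ≥ (1 - r)‖v‖².
The bound is uniform in r, which allows a weak limit as r tends to 1. -/
theorem norm_expResolvent_le (hS : ‖S‖ ≤ 1) {r : ℝ} (hr0 : 0 ≤ r) (hr1 : r < 1) :
    ‖expResolvent S r‖ ≤ 1 := by
  refine norm_exp_neg_le fun x => ?_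
  set R := Ring.inverse (1 - (r : ℂ) • S)
  have hx : x = R x - (r : ℂ) • S (R x) := by
    have := DFunLike.congr_fun (one_sub_mul_resolvent hS hr0 hr1) x
    exact this.symm
  have h1 : (inner ℂ (R x) x).re = ‖R x‖ ^ 2 - r * (inner ℂ (R x) (S (R x))).re := by
    have h0 : (inner ℂ (R x) x : ℂ) = inner ℂ (R x) (R x - (r : ℂ) • S (R x)) :=
      congrArg (fun v => inner ℂ (R x) v) hx
    rw [h0, inner_sub_right, inner_smul_right, inner_self_eq_norm_sq_to_K]
    simp only [Complex.sub_re, Complex.re_ofReal_mul]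
    norm_cast
  have h2 : (inner ℂ (R x) (S (R x))).re ≤ ‖R x‖ ^ 2 := by
    refine (Complex.re_le_norm _).trans ((norm_inner_le_norm _ _).trans ?_)
    rw [sq]
    refine mul_le_mul_of_nonneg_left ((S.le_opNorm _).trans ?_) (norm_nonneg _)
    exact mul_le_of_le_one_left (norm_nonneg _) hS
  rw [h1]
  nlinarith [sq_nonneg ‖R x‖]

theorem commute_expResolvent (hS : ‖S‖ ≤ 1) {r : ℝ} (hr0 : 0 ≤ r) (hr1 : r < 1)
    {A : H →L[ℂ] H} (hA : Commute A S) : Commute A (expResolvent S r) := by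
  refine Commute.exp_right (Commute.neg_right ?_)
  obtain ⟨u, hu⟩ := isUnit_one_sub_of_norm_lt_one (norm_smul_lt_one hS hr0 hr1)
  have h1 : Commute A (u : H →L[ℂ] H) := by
    rw [hu]
    exact (Commute.one_right A).sub_right (hA.smul_right _)
  rw [← hu, Ring.inverse_unit]
  exact h1.units_inv_right

theorem mem_of_hasSum {H : Type*} [NormedAddCommGroup H] [NormedSpace ℂ H] {M : Submodule ℂ H} (hM : IsClosed (M : Set H)) {g : ℕ → H} {u : H}
    (hg : HasSum g u) (h : ∀ n, g n ∈ M) : u ∈ M :=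
  hM.mem_of_tendsto hg (Filter.Eventually.of_forall fun _ => sum_mem fun n _ => h n)

/-- For r < 1 both the resolvent and the exponential are norm-convergent power series, so closed
S-invariant subspaces remain invariant. -/
theorem expResolvent_mem (hS : ‖S‖ ≤ 1) {r : ℝ} (hr0 : 0 ≤ r) (hr1 : r < 1)
    {M : Submodule ℂ H} (hM : IsClosed (M : Set H)) (hSM : ∀ u ∈ M, S u ∈ M) {u : H}
    (hu : u ∈ M) : expResolvent S r u ∈ M := by
  have hpow : ∀ B : H →L[ℂ] H, (∀ u ∈ M, B u ∈ M) → ∀ n : ℕ, ∀ u ∈ M, (B ^ n) u ∈ M := by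
    intro B hB n
    induction n with
    | zero => intro u hu; simpa using hu
    | succ n ih =>
      intro u hu
      rw [pow_succ', mul_apply_eq_comp]
      exact hB _ (ih u hu)
  have hR : ∀ u ∈ M, (-Ring.inverse (1 - (r : ℂ) • S)) u ∈ M := by
    intro u hu
    have h1 := (hasSum_geom_series_inverse _ (norm_smul_lt_one hS hr0 hr1)).mapL
      (ContinuousLinearMap.apply ℂ H u)
    exact M.neg_mem (mem_of_hasSum hM h1 fun n =>
      hpow _ (fun v hv => M.smul_mem _ (hSM v hv)) n u hu)
  have h2 := (exp_series_hasSum_exp' (𝕂 := ℂ) (-Ring.inverse (1 - (r : ℂ) • S))).mapL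
    (ContinuousLinearMap.apply ℂ H u)
  exact mem_of_hasSum hM h2 fun n => M.smul_mem _ (hpow _ hR n u hu)

/-- An eigenfunctional of S with eigenvalue z turns functional calculus in S into evaluation at z.
-/
theorem functional_expResolvent (hS : ‖S‖ ≤ 1) {r : ℝ} (hr0 : 0 ≤ r) (hr1 : r < 1)
    {φ : H →L[ℂ] ℂ} {z : ℂ} (hz : ‖z‖ < 1) (hφ : ∀ u, φ (S u) = z * φ u) (u : H) :
    φ (expResolvent S r u) = Complex.exp (-(1 - r * z)⁻¹) * φ u := by
  have hrz : (1 - r * z : ℂ) ≠ 0 := by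
    intro h0
    have h1 : ‖(r * z : ℂ)‖ = 1 := by rw [← sub_eq_zero.1 h0, norm_one]
    rw [norm_mul, Complex.norm_real, Real.norm_of_nonneg hr0] at h1
    nlinarith [norm_nonneg z]
  set B := -Ring.inverse (1 - (r : ℂ) • S) with hB
  have hR : ∀ u, φ (B u) = -(1 - r * z)⁻¹ * φ u := by
    intro u
    have h1 := DFunLike.congr_fun (one_sub_mul_resolvent hS hr0 hr1) u
    have h2 : Ring.inverse (1 - (r : ℂ) • S) u - (r : ℂ) • S (Ring.inverse (1 - (r : ℂ) • S) u) = u := h1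
    have h3 := congrArg φ h2
    rw [map_sub, map_smul, hφ, smul_eq_mul] at h3
    have h4 : φ (B u) = - φ (Ring.inverse (1 - (r : ℂ) • S) u) := by
      rw [hB, neg_apply, map_neg]
    rw [h4, ← h3]
    field_simp
  have hpow : ∀ (n : ℕ) u, φ ((B ^ n) u) = (-(1 - r * z)⁻¹) ^ n * φ u := by
    intro n
    induction n with
    | zero => intro u; simp
    | succ n ih =>
      intro u
      rw [pow_succ', mul_apply_eq_comp, hR, ih, pow_succ']
      ring
  have h2 := ((exp_series_hasSum_exp' (𝕂 := ℂ) B).mapL (ContinuousLinearMap.apply ℂ H u)).mapL φ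
  have h3 := (exp_series_hasSum_exp' (𝕂 := ℂ) (-(1 - r * z)⁻¹)).mul_right (φ u)
  rw [← Complex.exp_eq_exp_ℂ] at h3
  refine h2.unique ?_
  convert! h3 using 2 with n
  change φ (((n.factorial : ℂ)⁻¹ • B ^ n) u) = _
  rw [smul_apply, map_smul, hpow, smul_eq_mul, smul_eq_mul, mul_assoc]

end Contractions

/-! ### Operators with orthogonal columns -/

section Columns

theorem norm_sum_sq_of_orthogonal {ι H : Type*} [NormedAddCommGroup H] [InnerProductSpace ℂ H]
    {v : ι → H} (hv : ∀ i j, i ≠ j → inner ℂ (v i) (v j) = 0) (s : Finset ι) :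
    ‖∑ i ∈ s, v i‖ ^ 2 = ∑ i ∈ s, ‖v i‖ ^ 2 := by
  classical
  induction s using Finset.induction_on with
  | empty => simp
  | insert i s hi ih =>
    rw [Finset.sum_insert hi, Finset.sum_insert hi, sq, ← ih, sq, sq]
    refine norm_add_sq_eq_norm_sq_add_norm_sq_of_inner_eq_zero (𝕜 := ℂ) _ _ ?_
    rw [inner_sum]
    exact Finset.sum_eq_zero fun j hj => hv i j (by rintro rfl; exact hi hj)

/-- An operator on `ℓ²` with orthogonal columns is bounded by the norms of its columns. -/
theorem opNorm_le_of_orthogonal_columns {ι : Type*} [DecidableEq ι] {H : Type*}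
    [NormedAddCommGroup H] [InnerProductSpace ℂ H] {Y : lp (fun _ : ι => ℂ) 2 →L[ℂ] H} {C : ℝ}
    (hC : 0 ≤ C)
    (ho : ∀ i j, i ≠ j → inner ℂ (Y (lp.single 2 i 1)) (Y (lp.single 2 j 1)) = 0)
    (hn : ∀ i, ‖Y (lp.single 2 i 1)‖ ≤ C) : ‖Y‖ ≤ C := by
  refine Y.opNorm_le_bound hC fun u => ?_
  have h1 := (lp.hasSum_single (E := fun _ : ι => ℂ) (p := 2) (by norm_num) u).mapL Y
  have h2 : ∀ i, Y (lp.single 2 i (u i)) = u i • Y (lp.single 2 i 1) := by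
    intro i
    rw [← map_smul, ← lp.single_smul]
    simp
  simp only [h2] at h1
  refine le_of_tendsto h1.norm (Filter.Eventually.of_forall fun s => ?_)
  refine (pow_le_pow_iff_left₀ (norm_nonneg _) (by positivity) two_ne_zero).1 ?_
  rw [norm_sum_sq_of_orthogonal]
  · have h3 : ∀ i ∈ s, ‖u i • Y (lp.single 2 i 1)‖ ^ 2 ≤ C ^ 2 * ‖u i‖ ^ 2 := by
      intro i _
      rw [norm_smul, mul_pow, mul_comm]
      exact mul_le_mul_of_nonneg_right (pow_le_pow_left₀ (norm_nonneg _) (hn i) 2) (by positivity)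
    refine (Finset.sum_le_sum h3).trans ?_
    rw [← Finset.mul_sum, mul_pow]
    refine mul_le_mul_of_nonneg_left ?_ (by positivity)
    have h4 := lp.sum_rpow_le_norm_rpow (p := 2) (by norm_num) u s
    have h5 : (2 : ENNReal).toReal = ((2 : ℕ) : ℝ) := by norm_num
    simpa only [h5, Real.rpow_natCast] using h4
  · intro i j hij
    rw [inner_smul_left, inner_smul_right, ho i j hij, mul_zero, mul_zero]

end Columns

end DiGraph

namespace DiGraph

open Quiver Filter Topology

/-! ### Power series along the orbit f c^k of a closed path behind an external edge -/

section ClosedPathAfterExternalEdge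

variable {V : Type u} [Quiver.{v} V]

/-- Powers of a closed path. -/
def pathPow {y : V} (c : Path y y) : ℕ → Path y y
  | 0 => Path.nil
  | k + 1 => c.comp (pathPow c k)

theorem length_pathPow {y : V} (c : Path y y) (k : ℕ) :
    (pathPow c k).length = k * c.length := by
  induction k with
  | zero => simp [pathPow]
  | succ k ih => rw [pathPow, Path.length_comp, ih]; ring

theorem pathPow_injective {y : V} {c : Path y y} (hc : c ≠ Path.nil) :
    Function.Injective (pathPow c) := by
  intro j k hjk
  have h1 := congrArg Path.length hjk
  rw [length_pathPow, length_pathPow] at h1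
  refine Nat.eq_of_mul_eq_mul_right (Nat.pos_of_ne_zero fun h0 => hc ?_) h1
  exact Path.eq_nil_of_length_zero c h0

variable {x y : V} {f : x ⟶ y}

/-- The crossing of f cannot happen inside w, because w ends at x; so it happens in r. This is why
right multiplication by paths ending at x commutes with insertion behind f. -/
theorem IsExternal.through_of_comp (hf : IsExternal f) {a b : V} {w : Path a x} {r : Path x b}
    {p : Path a x} {q : Path y b} (h : w.comp r = (p.cons f).comp q) :
    ∃ p' : Path x x, r = (p'.cons f).comp q := by
  induction r with
  | nil => exact (hf.false q).elim
  | cons r e ih =>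
    cases q with
    | nil =>
      rw [Path.comp_nil, Path.comp_cons] at h
      obtain rfl := Path.obj_eq_of_cons_eq_cons h
      obtain rfl := (Path.hom_heq_of_cons_eq_cons h).eq
      exact ⟨r, rfl⟩
    | cons q g =>
      rw [Path.comp_cons, Path.comp_cons] at h
      obtain rfl := Path.obj_eq_of_cons_eq_cons h
      obtain rfl := (Path.hom_heq_of_cons_eq_cons h).eq
      obtain ⟨p', rfl⟩ := ih (Path.heq_of_cons_eq_cons h).eq
      exact ⟨p', rfl⟩

theorem rightPath_mul_insertOp (hf : IsExternal f) (d : Path y y) {a : V} (w : Path a x) :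
    Commute (rightPath w) (insertOp hf Path.nil d) := by
  refine clm_ext_ket fun a' b r => ?_
  rw [mul_apply_eq_comp, mul_apply_eq_comp]
  by_cases ha : a' = x
  · subst ha
    rw [rightPath_ket]
    by_cases h : ∃ (p : Path a' a') (q : Path y b), r = (p.cons f).comp q
    · obtain ⟨p, q, rfl⟩ := h
      have e1 : ∀ q' : Path y b,
          w.comp ((p.cons f).comp q') = ((w.comp p).cons f).comp q' := fun q' => by
        rw [← Path.comp_assoc, Path.comp_cons]
      rw [insertOp_ket, rightPath_ket, Path.comp_nil, e1, e1, insertOp_ket, Path.comp_nil]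
    · rw [insertOp_ket_eq_zero, insertOp_ket_eq_zero, map_zero]
      · intro p q hpq
        obtain ⟨p', hp'⟩ := hf.through_of_comp hpq
        exact h ⟨p', q, hp'⟩
      · push Not at h
        exact h
  · rw [rightPath_ket_of_ne _ _ ha, map_zero]
    by_cases h : ∃ (p : Path a' x) (q : Path y b), r = (p.cons f).comp q
    · obtain ⟨p, q, rfl⟩ := h
      rw [insertOp_ket, rightPath_ket_of_ne _ _ ha]
    · push Not at h
      rw [insertOp_ket_eq_zero hf _ _ h, map_zero]

theorem leftPath_mul_insertOp (hf : IsExternal f) (c : Path x x) (d : Path y y) {a b : V}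
    (p : Path a b) : leftPath p * insertOp hf c d =
      insertOp hf c d * leftPath p * insertOp hf Path.nil Path.nil := by
  refine clm_ext_ket fun a' b' r => ?_
  rw [mul_apply_eq_comp, mul_apply_eq_comp, mul_apply_eq_comp]
  by_cases h : ∃ (p : Path a' x) (q : Path y b'), r = (p.cons f).comp q
  · obtain ⟨p', q, rfl⟩ := h
    rw [insertOp_ket, insertOp_ket, Path.comp_nil, Path.nil_comp]
    by_cases hb : b' = a
    · subst hb
      rw [leftPath_ket, leftPath_ket, Path.comp_assoc (p'.cons f) q p, insertOp_ket,
        Path.comp_assoc _ (d.comp q) p, Path.comp_assoc d q p]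
    · rw [leftPath_ket_of_ne _ _ hb, leftPath_ket_of_ne _ _ hb, map_zero]
  · push Not at h
    rw [insertOp_ket_eq_zero hf _ _ h, insertOp_ket_eq_zero hf _ _ h, map_zero, map_zero]

/-- The last factor projects onto the paths through f. It is needed because T may itself create a
crossing of f, and such a new crossing must not receive an insertion. -/
theorem mul_insertOp (hf : IsExternal f) (c : Path x x) (d : Path y y)
    {T : PathHilbert V →L[ℂ] PathHilbert V} (hT : T ∈ tensorAlgebra V) :
    T * insertOp hf c d = insertOp hf c d * T * insertOp hf Path.nil Path.nil :=
  eq_of_eq_leftPath ((ContinuousLinearMap.mul ℂ _).flip (insertOp hf c d))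
    (((ContinuousLinearMap.mul ℂ _).flip (insertOp hf Path.nil Path.nil)).comp
      (ContinuousLinearMap.mul ℂ _ (insertOp hf c d)))
    (fun _ _ p => leftPath_mul_insertOp hf c d p) hT

theorem inner_ket {a b : V} (p : Path a b) (u : PathHilbert V) :
    inner ℂ (ket p) u = u ⟨a, b, p⟩ := by
  let _ : DecidableEq (PathSpace V) := Classical.decEq _
  refine (lp.inner_single_left (𝕜 := ℂ) (⟨a, b, p⟩ : PathSpace V) (1 : ℂ) u).trans ?_
  simp

/-- The paths `f c^k`. -/
noncomputable def orbitKet (f : x ⟶ y) (c : Path y y) (k : ℕ) : PathHilbert V :=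
  ket (f.toPath.comp (pathPow c k))

theorem insertOp_orbitKet (hf : IsExternal f) (c : Path y y) (k : ℕ) :
    insertOp hf Path.nil c (orbitKet f c k) = orbitKet f c (k + 1) :=
  insertOp_ket hf Path.nil c Path.nil (pathPow c k)

theorem insertOp_nil_orbitKet (hf : IsExternal f) (c : Path y y) (k : ℕ) :
    insertOp hf Path.nil Path.nil (orbitKet f c k) = orbitKet f c k := by
  have := insertOp_ket hf Path.nil Path.nil Path.nil (pathPow c k)
  rw [Path.nil_comp, Path.nil_comp] at this
  exact this

theorem apply_orbitKet_succ (hf : IsExternal f) (c : Path y y)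
    {T : PathHilbert V →L[ℂ] PathHilbert V} (hT : T ∈ tensorAlgebra V) (k : ℕ) :
    T (orbitKet f c (k + 1)) = insertOp hf Path.nil c (T (orbitKet f c k)) := by
  have := DFunLike.congr_fun (mul_insertOp hf Path.nil c hT) (orbitKet f c k)
  rwa [mul_apply_eq_comp, mul_apply_eq_comp, mul_apply_eq_comp, insertOp_orbitKet,
    insertOp_nil_orbitKet] at this

theorem norm_orbitKet (c : Path y y) (k : ℕ) : ‖orbitKet f c k‖ = 1 := norm_ket _

variable (f) in
/-- The vector `∑ z̄^k ξ_{f c^k}`. -/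
noncomputable def kernelVector (c : Path y y) (z : ℂ) : PathHilbert V :=
  ∑' k, (starRingEnd ℂ z) ^ k • orbitKet f c k

theorem hasSum_kernelVector (c : Path y y) {z : ℂ} (hz : ‖z‖ < 1) :
    HasSum (fun k => (starRingEnd ℂ z) ^ k • orbitKet f c k) (kernelVector f c z) := by
  refine Summable.hasSum (Summable.of_norm ?_)
  simp only [norm_smul, norm_pow, norm_orbitKet, mul_one, RCLike.norm_conj]
  exact summable_geometric_of_lt_one (norm_nonneg _) hz

/-- `kernelVector` is a Szegő kernel: pairing with it evaluates at z the power series whose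
coefficients are the coordinates of u along f c^k. The conjugate in its definition cancels that of
the inner product. -/
theorem hasSum_inner_kernelVector (c : Path y y) {z : ℂ} (hz : ‖z‖ < 1) (u : PathHilbert V) :
    HasSum (fun k => z ^ k * u ⟨x, y, f.toPath.comp (pathPow c k)⟩)
      (inner ℂ (kernelVector f c z) u) := by
  have h1 := ((hasSum_kernelVector (f := f) c hz).mapL (innerSL ℂ u)).star
  convert! h1 using 1
  · ext k
    simp only [innerSL_apply_apply, inner_smul_right]
    rw [star_mul', star_pow]
    have h2 : star (inner ℂ u (orbitKet f c k)) = inner ℂ (orbitKet f c k) u :=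
      inner_conj_symm _ _
    rw [h2, orbitKet, inner_ket]
    simp
  · exact (inner_conj_symm _ _).symm

/-- Inserting c shifts the coordinates along the orbit by one and leaves constant term zero, since f
alone does not arise from an insertion of c ≠ nil. -/
theorem inner_kernelVector_insertOp (hf : IsExternal f) {c : Path y y} (hc : c ≠ Path.nil) {z : ℂ}
    (hz : ‖z‖ < 1) (u : PathHilbert V) :
    inner ℂ (kernelVector f c z) (insertOp hf Path.nil c u) =
      z * inner ℂ (kernelVector f c z) u := by
  have h1 := hasSum_inner_kernelVector (f := f) c hz (insertOp hf Path.nil c u)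
  have h2 := (hasSum_inner_kernelVector (f := f) c hz u).mul_left z
  refine h1.unique ?_
  rw [← hasSum_nat_add_iff' 1]
  have h0 : insertOp hf Path.nil c u ⟨x, y, f.toPath.comp (pathPow c 0)⟩ = 0 := by
    refine insertOp_apply_eq_zero hf Path.nil c u fun p q hpq => hc ?_
    have h3 : ((Path.nil : Path x x).cons f).comp Path.nil =
        ((p.comp Path.nil).cons f).comp (c.comp q) := hpq
    have h4 := congrArg Path.length (hf.decomposition_unique h3).2
    rw [Path.length_comp, Path.length_nil] at h4
    exact Path.eq_nil_of_length_zero c (by omega)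
  simp only [Finset.range_one, Finset.sum_singleton, h0, mul_zero, sub_zero]
  convert! h2 using 2 with k
  have h5 := insertOp_apply hf Path.nil c Path.nil (pathPow c k) u
  have h6 : insertOp hf Path.nil c u ⟨x, y, f.toPath.comp (pathPow c (k + 1))⟩ =
    u ⟨x, y, f.toPath.comp (pathPow c k)⟩ := h5
  rw [h6, pow_succ]
  ring

theorem inner_kernelVector_leftEdge (hf : IsExternal f) {c : Path y y} (hc : c ≠ Path.nil) {z : ℂ}
    (hz : ‖z‖ < 1) (u : PathHilbert V) :
    inner ℂ (kernelVector f c z) (leftEdge f u) = u ⟨x, x, Path.nil⟩ := by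
  refine (hasSum_inner_kernelVector (f := f) c hz (leftEdge f u)).unique ?_
  have e : u ⟨x, x, Path.nil⟩ =
      z ^ 0 * leftEdge f u ⟨x, y, f.toPath.comp (pathPow c 0)⟩ := by
    rw [pow_zero, one_mul, ← leftPath_toPath]
    have := leftPath_apply_comp f.toPath Path.nil u
    rw [Path.nil_comp] at this
    exact this.symm
  rw [e]
  refine hasSum_single 0 fun k hk => ?_
  · rw [← leftPath_toPath, leftPath_apply_eq_zero, mul_zero]
    intro a q hq
    obtain ⟨rfl, hq⟩ := Sigma.mk.inj_iff.1 hq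
    have hq := (Sigma.mk.inj_iff.1 hq.eq).2.eq
    have h3 : ((Path.nil : Path x x).cons f).comp (pathPow c k) = (q.cons f).comp Path.nil := hq
    exact hk (pathPow_injective hc (hf.decomposition_unique h3).2)

theorem inner_kernelVector_orbitKet {c : Path y y} (hc : c ≠ Path.nil) {z : ℂ}
    (hz : ‖z‖ < 1) (k : ℕ) : inner ℂ (kernelVector f c z) (orbitKet f c k) = z ^ k := by
  refine (hasSum_inner_kernelVector (f := f) c hz (orbitKet f c k)).unique ?_
  have e : z ^ k = z ^ k * orbitKet f c k ⟨x, y, f.toPath.comp (pathPow c k)⟩ := by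
    rw [orbitKet, ket_apply_self, mul_one]
  have hs : HasSum (fun j => z ^ j * orbitKet f c k ⟨x, y, f.toPath.comp (pathPow c j)⟩)
      (z ^ k * orbitKet f c k ⟨x, y, f.toPath.comp (pathPow c k)⟩) := by
    refine hasSum_single k fun j hj => ?_
    rw [orbitKet, ket_apply_path_of_ne, mul_zero]
    intro h
    exact hj (pathPow_injective hc (Path.comp_inj_right.1 h))
  rw [← e] at hs
  exact hs

/-- Evaluation at a point of the disc of the power series attached to an element of the tensor
algebra and a closed path. -/
noncomputable def evalAt (f : x ⟶ y) (c : Path y y) (z : ℂ) :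
    (PathHilbert V →L[ℂ] PathHilbert V) →L[ℂ] ℂ :=
  (innerSL ℂ (kernelVector f c z)).comp
    (ContinuousLinearMap.apply ℂ (PathHilbert V) (orbitKet f c 0))

theorem evalAt_apply (c : Path y y) (z : ℂ) (T : PathHilbert V →L[ℂ] PathHilbert V) :
    evalAt f c z T = inner ℂ (kernelVector f c z) (T (orbitKet f c 0)) := rfl

/-- With g the kernel vector, ⟨g, T ξ⟩ is multiplied by z at each step along the orbit, so ⟨g, T g⟩
= `evalAt f c z T` · ⟨g, g⟩. Cauchy–Schwarz then gives a bound independent of z, although ‖g‖ blows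
up at the unit circle. -/
theorem norm_evalAt_le (hf : IsExternal f) {c : Path y y} (hc : c ≠ Path.nil) {z : ℂ}
    (hz : ‖z‖ < 1) {T : PathHilbert V →L[ℂ] PathHilbert V} (hT : T ∈ tensorAlgebra V) :
    ‖evalAt f c z T‖ ≤ ‖T‖ := by
  set g := kernelVector f c z with hg
  have h1 : ∀ k, inner ℂ g (T (orbitKet f c k)) = z ^ k * evalAt f c z T := by
    intro k
    induction k with
    | zero => rw [pow_zero, one_mul]; rfl
    | succ k ih =>
      rw [apply_orbitKet_succ hf c hT, hg, inner_kernelVector_insertOp hf hc hz, ← hg, ih, pow_succ]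
      ring
  have h2 := (hasSum_kernelVector (f := f) c hz).mapL ((innerSL ℂ g).comp T)
  have h3 := ((hasSum_kernelVector (f := f) c hz).mapL (innerSL ℂ g)).mul_left (evalAt f c z T)
  have h4 : inner ℂ g (T g) = evalAt f c z T * inner ℂ g g := by
    refine h2.unique ?_
    convert! h3 using 2 with k
    rw [map_smul, map_smul, ContinuousLinearMap.comp_apply, innerSL_apply_apply,
      innerSL_apply_apply, h1, hg, inner_kernelVector_orbitKet hc hz, smul_eq_mul, smul_eq_mul]
    ring
  have h5 : 0 < ‖g‖ := by
    rw [norm_pos_iff]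
    intro h0
    have := inner_kernelVector_orbitKet (f := f) hc hz 0
    rw [← hg, h0, inner_zero_left, pow_zero] at this
    exact zero_ne_one this
  have h6 : ‖(inner ℂ g (T g) : ℂ)‖ ≤ ‖T‖ * ‖g‖ ^ 2 := by
    refine (norm_inner_le_norm _ _).trans ?_
    have := T.le_opNorm g
    nlinarith [norm_nonneg g]
  rw [h4, norm_mul, inner_self_eq_norm_sq_to_K, norm_pow] at h6
  have h7 : ‖((‖g‖ : ℝ) : ℂ)‖ = ‖g‖ := by simp
  have h8 : ‖evalAt f c z T‖ * ‖g‖ ^ 2 ≤ ‖T‖ * ‖g‖ ^ 2 := by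
    simpa using h6
  exact le_of_mul_le_mul_right h8 (by positivity)

/-- On L_p evaluation is a monomial in z or zero, hence continuous at 1; the uniform bound
`norm_evalAt_le` transports this to norm limits, as for the disc algebra. -/
theorem tendsto_evalAt_sub (hf : IsExternal f) {c : Path y y} (hc : c ≠ Path.nil) {z z' : ℕ → ℂ}
    (hz : ∀ n, ‖z n‖ < 1) (hz' : ∀ n, ‖z' n‖ < 1) (hz1 : Tendsto z atTop (𝓝 1))
    (hz1' : Tendsto z' atTop (𝓝 1)) {T : PathHilbert V →L[ℂ] PathHilbert V}
    (hT : T ∈ tensorAlgebra V) :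
    Tendsto (fun n => evalAt f c (z n) T - evalAt f c (z' n) T) atTop (𝓝 0) := by
  let M : Submodule ℂ (PathHilbert V →L[ℂ] PathHilbert V) :=
    { carrier := {T | Tendsto (fun n => evalAt f c (z n) T - evalAt f c (z' n) T) atTop (𝓝 0)}
      add_mem' := fun {S T} hS hT => by
        have := Tendsto.add hS hT
        rw [add_zero] at this
        refine this.congr fun n => ?_
        rw [map_add, map_add]; ring
      zero_mem' := by
        change Tendsto _ _ _
        simp only [map_zero, sub_zero]
        exact tendsto_const_nhds
      smul_mem' := fun a T hT => by
        have := Tendsto.const_mul a hT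
        rw [mul_zero] at this
        refine this.congr fun n => ?_
        rw [map_smul, map_smul, smul_eq_mul, smul_eq_mul]; ring }
  have hspan : (Submodule.span ℂ (pathOperators V) : Set (PathHilbert V →L[ℂ] PathHilbert V)) ⊆
      M := by
    refine Submodule.span_le.2 ?_
    rintro _ ⟨a, b, p, rfl⟩
    change Tendsto _ _ _
    simp only [evalAt_apply]
    by_cases hp : ∃ k, leftPath p (orbitKet f c 0) = orbitKet f c k
    · obtain ⟨k, hk⟩ := hp
      rw [hk]
      simp only [inner_kernelVector_orbitKet hc (hz _), inner_kernelVector_orbitKet hc (hz' _)]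
      simpa using (hz1.pow k).sub (hz1'.pow k)
    · push Not at hp
      have h0 : ∀ w : ℂ, ‖w‖ < 1 →
          inner ℂ (kernelVector f c w) (leftPath p (orbitKet f c 0)) = (0 : ℂ) := by
        intro w hw
        refine (hasSum_inner_kernelVector (f := f) c hw _).unique ?_
        convert! hasSum_zero using 2 with k
        by_cases ha : y = a
        · subst ha
          have h1 : leftPath p (orbitKet f c 0) = ket (f.toPath.comp p) := by
            rw [orbitKet, leftPath_ket]; rfl
          rw [h1, ket_apply_of_ne, mul_zero]
          intro h2
          obtain ⟨rfl, h2⟩ := Sigma.mk.inj_iff.1 (Sigma.mk.inj_iff.1 h2).2.eq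
          obtain rfl := Path.comp_inj_right.1 h2.eq
          exact hp k h1
        · rw [orbitKet, leftPath_ket_of_ne _ _ ha]
          exact mul_zero _
      simp only [h0 _ (hz _), h0 _ (hz' _), sub_zero]
      exact tendsto_const_nhds
  rw [Metric.tendsto_nhds]
  intro ε hε
  obtain ⟨S, hS, hST⟩ := Metric.mem_closure_iff.1 (mem_closure_span hT) (ε / 3) (by positivity)
  have hSA : S ∈ tensorAlgebra V := by
    have : (Submodule.span ℂ (pathOperators V)) ≤ (tensorAlgebra V).toSubmodule := by
      refine Submodule.span_le.2 ?_
      rintro _ ⟨a, b, p, rfl⟩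
      exact leftPath_mem p
    exact this hS
  have h3 : Tendsto (fun n => evalAt f c (z n) S - evalAt f c (z' n) S) atTop (𝓝 0) := hspan hS
  filter_upwards [Metric.tendsto_nhds.1 h3 (ε / 3) (by positivity)] with n hn
  rw [dist_zero_right] at hn ⊢
  rw [dist_eq_norm] at hST
  have h4 := norm_evalAt_le hf hc (hz n) (sub_mem hT hSA)
  have h5 := norm_evalAt_le hf hc (hz' n) (sub_mem hT hSA)
  have h6 : evalAt f c (z n) T - evalAt f c (z' n) T =
      evalAt f c (z n) (T - S) - evalAt f c (z' n) (T - S) +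
        (evalAt f c (z n) S - evalAt f c (z' n) S) := by
    rw [map_sub, map_sub]; ring
  rw [h6]
  refine (norm_add_le _ _).trans_lt ?_
  have h7 := norm_sub_le (evalAt f c (z n) (T - S)) (evalAt f c (z' n) (T - S))
  linarith

end ClosedPathAfterExternalEdge

end DiGraph

namespace DiGraph

open Quiver Filter Topology

/-! ### Properties preserved by weak limits -/

section WeakLimits

variable {H : Type*} [NormedAddCommGroup H] [InnerProductSpace ℂ H] [CompleteSpace H]
  {U : Ultrafilter ℕ} {X : ℕ → H →L[ℂ] H} {Y : H →L[ℂ] H}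

theorem commute_weak_limit
    (hY : ∀ u v : H, Tendsto (fun n => inner ℂ (X n u) v) U (𝓝 (inner ℂ (Y u) v)))
    {A : H →L[ℂ] H} (hA : ∀ n, Commute A (X n)) : Commute A Y := by
  refine ContinuousLinearMap.ext fun u => ext_inner_right ℂ fun v => ?_
  rw [mul_apply_eq_comp, mul_apply_eq_comp, ← ContinuousLinearMap.adjoint_inner_right]
  refine tendsto_nhds_unique (hY u _) ((hY (A u) v).congr fun n => ?_)
  rw [ContinuousLinearMap.adjoint_inner_right]
  have h1 : A (X n u) = X n (A u) := DFunLike.congr_fun (hA n) u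
  rw [h1]

/-- A closed subspace is its double orthogonal complement, so membership is a family of scalar
equations stable under weak limits. -/
theorem weak_limit_mem
    (hY : ∀ u v : H, Tendsto (fun n => inner ℂ (X n u) v) U (𝓝 (inner ℂ (Y u) v)))
    {M : Submodule ℂ H} {u : H} (hu : ∀ n, X n u ∈ M.topologicalClosure) :
    Y u ∈ M.topologicalClosure := by
  rw [← Submodule.orthogonal_orthogonal_eq_closure, Submodule.mem_orthogonal']
  intro v hv
  refine tendsto_nhds_unique (hY u v) (tendsto_const_nhds.congr fun n => ?_)
  have h1 := hu n
  rw [← Submodule.orthogonal_orthogonal_eq_closure, Submodule.mem_orthogonal'] at h1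
  exact (h1 v hv).symm

end WeakLimits

/-! ### No closed path at the range of an external edge -/

section ClosedPathAfterExternalEdge

variable {V : Type u} [Quiver.{v} V] {x y : V} {f : x ⟶ y}

theorem inner_ket_ket_of_ne {a b a' b' : V} {p : Path a b} {q : Path a' b'}
    (h : (⟨a, b, p⟩ : PathSpace V) ≠ ⟨a', b', q⟩) : inner ℂ (ket p) (ket q) = (0 : ℂ) := by
  rw [inner_ket, ket_apply_of_ne h]

variable (f) in
/-- The closed linear span of the vectors `ξ_{f c^k}`. -/
noncomputable def orbitSpace (c : Path y y) : Submodule ℂ (PathHilbert V) :=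
  Submodule.span ℂ (Set.range (orbitKet f c))

/-- A path "w, f, c^k" determines w by uniqueness of the crossing, so distinct w give orthogonal
families of basis vectors; this extends to closed spans. -/
theorem inner_rightPath_orbitSpace (hf : IsExternal f) (c : Path y y) {a a' : V} {w : Path a x}
    {w' : Path a' x} (hw : (⟨a, x, w⟩ : PathSpace V) ≠ ⟨a', x, w'⟩) {u v : PathHilbert V}
    (hu : u ∈ (orbitSpace f c).topologicalClosure)
    (hv : v ∈ (orbitSpace f c).topologicalClosure) :
    inner ℂ (rightPath w u) (rightPath w' v) = (0 : ℂ) := by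
  have h0 : ∀ j k, inner ℂ (rightPath w (orbitKet f c j)) (rightPath w' (orbitKet f c k)) =
      (0 : ℂ) := by
    intro j k
    rw [orbitKet, orbitKet, rightPath_ket, rightPath_ket]
    refine inner_ket_ket_of_ne fun h => hw ?_
    obtain ⟨rfl, h⟩ := Sigma.mk.inj_iff.1 h
    have h1 := (Sigma.mk.inj_iff.1 h.eq).2.eq
    have e1 : ∀ (w : Path a x) (q : Path y y),
        w.comp (f.toPath.comp q) = (w.cons f).comp q := fun w q => by
      rw [← Path.comp_assoc]; rfl
    rw [e1, e1] at h1
    rw [(hf.decomposition_unique h1).1]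
  have h1 : ∀ j, inner ℂ (rightPath w (orbitKet f c j)) (rightPath w' v) = (0 : ℂ) := by
    intro j
    exact ContinuousLinearMap.eqOn_closure_span (s := Set.range (orbitKet f c))
      (f := (innerSL ℂ (rightPath w (orbitKet f c j))).comp (rightPath w')) (g := 0)
      (by rintro _ ⟨k, rfl⟩; exact h0 j k) hv
  have h2 : inner ℂ (rightPath w' v) (rightPath w u) = (0 : ℂ) :=
    ContinuousLinearMap.eqOn_closure_span (s := Set.range (orbitKet f c))
      (f := (innerSL ℂ (rightPath w' v)).comp (rightPath w)) (g := 0)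
      (by rintro _ ⟨k, rfl⟩; exact inner_eq_zero_symm.1 (h1 k)) hu
  exact inner_eq_zero_symm.1 h2

theorem exists_mem_tensorAlgebra_of_mem_orbitSpace (c : Path y y) {m : PathHilbert V}
    (hm : m ∈ orbitSpace f c) : ∃ P ∈ tensorAlgebra V,
      (∀ (a : V) (w : Path a x), P (ket w) = rightPath w m) ∧
      ∀ (a b : V) (w : Path a b), b ≠ x → P (ket w) = 0 := by
  refine Submodule.span_induction ?_ ?_ ?_ ?_ hm
  · rintro _ ⟨k, rfl⟩
    exact ⟨_, leftPath_mem (f.toPath.comp (pathPow c k)),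
      fun a w => by rw [leftPath_ket, orbitKet, rightPath_ket],
      fun a b w hb => leftPath_ket_of_ne _ _ hb⟩
  · exact ⟨0, zero_mem _, fun a w => by rw [map_zero]; rfl, fun a b w _ => rfl⟩
  · rintro m m' _ _ ⟨P, hP, hP1, hP2⟩ ⟨P', hP', hP1', hP2'⟩
    refine ⟨P + P', add_mem hP hP', fun a w => ?_, fun a b w hb => ?_⟩
    · rw [map_add, ← hP1, ← hP1']; rfl
    · have : (P + P') (ket w) = P (ket w) + P' (ket w) := rfl
      rw [this, hP2 _ _ w hb, hP2' _ _ w hb, add_zero]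
  · rintro s m _ ⟨P, hP, hP1, hP2⟩
    refine ⟨s • P, (tensorAlgebra V).smul_mem s hP, fun a w => ?_, fun a b w hb => ?_⟩
    · rw [map_smul, ← hP1]; rfl
    · have : (s • P) (ket w) = s • P (ket w) := rfl
      rw [this, hP2 _ _ w hb, smul_zero]

/-- The operator B L_f has the columns `rightPath w u` with u = B ξ_f, and these are mutually
orthogonal, so its operator norm is controlled by ‖u‖. Approximating u in the Hilbert space norm by
finite combinations of ξ_{f c^k} therefore approximates B L_f in operator norm by elements of 𝒜.
Thus B only needs square-summable coefficients, not a continuous symbol. -/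
theorem mul_leftEdge_mem_of_apply_mem (hf : IsExternal f) (c : Path y y)
    {B : PathHilbert V →L[ℂ] PathHilbert V}
    (hB : ∀ (a : V) (w : Path a x), Commute (rightPath w) B)
    (hBm : B (orbitKet f c 0) ∈ (orbitSpace f c).topologicalClosure) :
    B * leftEdge f ∈ tensorAlgebra V := by
  let _ : DecidableEq (PathSpace V) := Classical.decEq _
  have hcl : B * leftEdge f ∈
      closure (tensorAlgebra V : Set (PathHilbert V →L[ℂ] PathHilbert V)) := by
    rw [Metric.mem_closure_iff]
    intro ε hε
    obtain ⟨m, hm, hBm'⟩ := Metric.mem_closure_iff.1 hBm (ε / 2) (by positivity)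
    obtain ⟨P, hP, hP1, hP2⟩ := exists_mem_tensorAlgebra_of_mem_orbitSpace c hm
    refine ⟨P, hP, ?_⟩
    set u := B (orbitKet f c 0) - m with hu
    have huM : u ∈ (orbitSpace f c).topologicalClosure :=
      Submodule.sub_mem _ hBm (Submodule.le_topologicalClosure _ hm)
    have hZ1 : ∀ (a : V) (w : Path a x), (B * leftEdge f - P) (ket w) = rightPath w u := by
      intro a w
      have h1 : (B * leftEdge f - P) (ket w) = B (leftEdge f (ket w)) - P (ket w) := rfl
      have h2 : leftEdge f (ket w) = rightPath w (orbitKet f c 0) := by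
        rw [leftEdge_ket, orbitKet, rightPath_ket]; rfl
      have h3 : B (rightPath w (orbitKet f c 0)) = rightPath w (B (orbitKet f c 0)) :=
        (DFunLike.congr_fun (hB a w) (orbitKet f c 0)).symm
      rw [h1, h2, h3, hP1, hu, map_sub]
    have hZ2 : ∀ (a b : V) (w : Path a b), b ≠ x → (B * leftEdge f - P) (ket w) = 0 := by
      intro a b w hb
      have h1 : (B * leftEdge f - P) (ket w) = B (leftEdge f (ket w)) - P (ket w) := rfl
      rw [h1, leftEdge_ket_of_ne _ _ hb, hP2 _ _ w hb, map_zero, sub_zero]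
    rw [dist_eq_norm] at hBm' ⊢
    refine lt_of_le_of_lt ?_ (half_lt_self hε)
    refine opNorm_le_of_orthogonal_columns (by positivity) ?_ ?_
    · rintro ⟨a, b, w⟩ ⟨a', b', w'⟩ hne
      have hk : ∀ (a b : V) (w : Path a b),
        lp.single 2 (⟨a, b, w⟩ : PathSpace V) (1 : ℂ) = ket w := fun a b w => by
          rw [ket]
      rw [hk, hk]
      by_cases hb : b = x
      · by_cases hb' : b' = x
        · subst hb
          subst hb'
          rw [hZ1, hZ1]
          exact inner_rightPath_orbitSpace hf c hne huM huM
        · rw [hZ2 _ _ w' hb', inner_zero_right]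
      · rw [hZ2 _ _ w hb, inner_zero_left]
    · rintro ⟨a, b, w⟩
      have hk : lp.single 2 (⟨a, b, w⟩ : PathSpace V) (1 : ℂ) = ket w := by
        rw [ket]
      rw [hk]
      by_cases hb : b = x
      · subst hb
        rw [hZ1]
        have h1 : ‖rightPath w‖ ≤ 1 := norm_relOp_le _
        refine ((rightPath w).le_opNorm u).trans ?_
        nlinarith [norm_nonneg u]
      · rw [hZ2 _ _ w hb, norm_zero]
        positivity
  rwa [isClosed_tensorAlgebra.closure_eq] at hcl

/-- The sequence of radii `1 - 1 / (n + 1)`. -/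
noncomputable def radius (n : ℕ) : ℝ := 1 - 1 / (n + 1)

theorem radius_nonneg (n : ℕ) : 0 ≤ radius n := by
  have : (1 : ℝ) / (n + 1) ≤ 1 := by
    rw [div_le_one (by positivity)]
    linarith [(Nat.cast_nonneg n : (0 : ℝ) ≤ n)]
  rw [radius]; linarith

theorem radius_lt_one (n : ℕ) : radius n < 1 := by
  have : (0 : ℝ) < 1 / (n + 1) := by positivity
  rw [radius]; linarith

theorem tendsto_radius : Tendsto radius atTop (𝓝 1) := by
  have := (tendsto_one_div_add_atTop_nhds_zero_nat (𝕜 := ℝ)).const_sub 1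
  rwa [sub_zero] at this

/-- There is an operator `Y` in the weak closure of the functional calculus of `S`, with symbol
`exp (-(1 - z)⁻¹)`. -/
theorem exists_singular_inner_operator (hf : IsExternal f) {c : Path y y} (hc : c ≠ Path.nil) :
    ∃ Y : PathHilbert V →L[ℂ] PathHilbert V,
      (∀ A, Commute A (insertOp hf Path.nil c) → Commute A Y) ∧
      Y (orbitKet f c 0) ∈ (orbitSpace f c).topologicalClosure ∧
      ∀ z : ℂ, ‖z‖ < 1 →
        inner ℂ (kernelVector f c z) (Y (orbitKet f c 0)) = Complex.exp (-(1 - z)⁻¹) := by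
  set S := insertOp hf Path.nil c with hSdef
  have hS : ‖S‖ ≤ 1 := norm_insertOp_le _ _ _
  obtain ⟨Y, hY⟩ := exists_weak_limit (Filter.hyperfilter ℕ)
    (X := fun n => expResolvent S (radius n)) (C := 1)
    (fun n => norm_expResolvent_le hS (radius_nonneg n) (radius_lt_one n))
  refine ⟨Y, fun A hA => commute_weak_limit hY fun n =>
    commute_expResolvent hS (radius_nonneg n) (radius_lt_one n) hA, ?_, fun z hz => ?_⟩
  · refine weak_limit_mem hY fun n => expResolvent_mem hS (radius_nonneg n) (radius_lt_one n)
      (Submodule.isClosed_topologicalClosure _) ?_ ?_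
    · intro u hu
      have hmaps : Set.MapsTo S (orbitSpace f c : Set (PathHilbert V)) (orbitSpace f c) := by
        intro v hv
        refine Submodule.span_induction (p := fun v _ => S v ∈ orbitSpace f c) ?_ ?_ ?_ ?_ hv
        · rintro _ ⟨k, rfl⟩
          rw [hSdef, insertOp_orbitKet]
          exact Submodule.subset_span ⟨k + 1, rfl⟩
        · rw [map_zero]; exact zero_mem _
        · intro v w _ _ hv hw
          rw [map_add]; exact add_mem hv hw
        · intro a v _ hv
          rw [map_smul]; exact Submodule.smul_mem _ _ hv
      exact hmaps.closure S.continuous hu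
    · exact Submodule.le_topologicalClosure _ (Submodule.subset_span ⟨0, rfl⟩)
  · have h1 := (hY (orbitKet f c 0) (kernelVector f c z)).star
    have h2 : ∀ u v : PathHilbert V, star (inner ℂ u v : ℂ) = inner ℂ v u :=
      fun u v => inner_conj_symm _ _
    simp only [h2] at h1
    refine tendsto_nhds_unique h1 ?_
    have h3 : ∀ n, inner ℂ (kernelVector f c z) (expResolvent S (radius n) (orbitKet f c 0)) =
        Complex.exp (-(1 - radius n * z)⁻¹) := by
      intro n
      have := functional_expResolvent hS (radius_nonneg n) (radius_lt_one n)
        (φ := innerSL ℂ (kernelVector f c z)) hz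
        (fun u => inner_kernelVector_insertOp hf hc hz u) (orbitKet f c 0)
      simp only [innerSL_apply_apply] at this
      rw [this, inner_kernelVector_orbitKet hc hz, pow_zero, mul_one]
    simp only [h3]
    refine Tendsto.mono_left ?_ Nat.hyperfilter_le_atTop
    have hz1 : (1 - z : ℂ) ≠ 0 := by
      intro h0
      rw [← sub_eq_zero.1 h0, norm_one] at hz
      exact lt_irrefl _ hz
    have h4 : Tendsto (fun n => (1 - (radius n : ℂ) * z)) atTop (𝓝 (1 - z)) := by
      have := ((Complex.continuous_ofReal.tendsto 1).comp tendsto_radius).mul_const z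
      simpa using this.const_sub 1
    exact (Complex.continuous_exp.tendsto _).comp (h4.inv₀ hz1).neg

/-- If all bounded derivations are inner, then there is no cycle at the range of an external
edge. -/
theorem closed_path_eq_nil (h : ∀ δ : tensorAlgebra V →L[ℂ] tensorAlgebra V,
      IsDerivation δ → IsInner δ) (hf : IsExternal f) (c : Path y y) : c = Path.nil := by
  by_contra hc
  obtain ⟨Y, hYc, hYm, hYz⟩ := exists_singular_inner_operator hf hc
  set Q := insertOp hf (Path.nil : Path x x) (Path.nil : Path y y) with hQ
  have hQf : Q * leftEdge f = leftEdge f := by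
    rw [hQ, insertOp_mul_leftEdge_self, ← leftPath_toPath]; rfl
  have hfQ : leftEdge f * Q = 0 := leftEdge_self_mul_insertOp _ _ _
  have hYQ : Y * Q = Q * Y := by
    refine (hYc Q ?_).symm
    change Q * _ = _ * Q
    rw [hQ, insertOp_nil_mul, mul_insertOp_nil]
  have hYf : Y * leftEdge f ∈ tensorAlgebra V :=
    mul_leftEdge_mem_of_apply_mem hf c
      (fun a w => hYc _ (rightPath_mul_insertOp hf c w)) hYm
  -- Cutting Y down by the projection Q onto the paths through f makes L_f annihilate it, so its
  -- commutator with L_f is -Y L_f, which lies in 𝒜; with the other generators it commutes.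
  have hfX : leftEdge f * (Y * Q) = 0 := by rw [hYQ, ← mul_assoc, hfQ, zero_mul]
  have hXf : Y * Q * leftEdge f = Y * leftEdge f := by rw [mul_assoc, hQf]
  obtain ⟨T, hT, hTX⟩ := exists_implementing h (X := Y * Q)
    (fun z => by
      have h1 : Commute (leftVertex z) Y := hYc _ (insertOp_mul_leftVertex hf _ _ z).symm
      have h2 : Commute (leftVertex z) Q := (insertOp_mul_leftVertex hf _ _ z).symm
      rw [(h1.mul_right h2).eq, sub_self]
      exact zero_mem _)
    (fun s z e => by
      by_cases hef : (⟨s, z, e⟩ : Total V) = ⟨x, y, f⟩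
      · cases hef
        rw [hfX, hXf, zero_sub]
        exact neg_mem hYf
      · have h1 : Commute (leftEdge e) Y := hYc _ (insertOp_mul_leftEdge hf _ _ hef).symm
        have h2 : Commute (leftEdge e) Q := (insertOp_mul_leftEdge hf _ _ hef).symm
        rw [(h1.mul_right h2).eq, sub_self]
        exact zero_mem _)
  have h1 := hTX _ _ f.toPath
  rw [leftPath_toPath, hfX, hXf, zero_sub] at h1
  have h2 := DFunLike.congr_fun h1 (ket (Path.nil : Path x x))
  have h0 : leftEdge f (ket (Path.nil : Path x x)) = orbitKet f c 0 := leftEdge_ket f _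
  have h3 : -Y (orbitKet f c 0) =
      leftEdge f (T (ket (Path.nil : Path x x))) - T (orbitKet f c 0) := by
    rw [← h0]; exact h2
  -- Pairing with kernel vectors, the symbol of T along the orbit is the singular inner function
  -- plus the constant coming from L_f T.
  have h4 : ∀ z : ℂ, ‖z‖ < 1 → evalAt f c z T =
      Complex.exp (-(1 - z)⁻¹) + T (ket (Path.nil : Path x x)) ⟨x, x, Path.nil⟩ := by
    intro z hz
    have h5 := congrArg (fun u => inner ℂ (kernelVector f c z) u) h3
    simp only [inner_neg_right, inner_sub_right, hYz z hz,
      inner_kernelVector_leftEdge hf hc hz] at h5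
    rw [evalAt_apply]
    linear_combination h5
  -- Both sequences tend to 1. Radially 1/(1-z) = n + 1, so the inner function tends to 0; along z'
  -- one has 1/(1-z') = 1 + 2πi(n + 1), so it stays at exp(-1).
  let z : ℕ → ℂ := fun n => 1 - (n + 1 : ℂ)⁻¹
  let w : ℕ → ℂ := fun n => 1 + (n + 1) * (2 * Real.pi * Complex.I)
  let z' : ℕ → ℂ := fun n => 1 - (w n)⁻¹
  have hre : ∀ n, (w n).re = 1 := fun n => by simp [w]
  have him : ∀ n, (w n).im = (n + 1) * (2 * Real.pi) := fun n => by simp [w]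
  -- The map w ↦ 1 - 1/w sends the half plane Re w > 1/2 into the disc, as there |w - 1| < |w|.
  have key : ∀ w : ℂ, 1 ≤ w.re → ‖1 - w⁻¹‖ < 1 := by
    intro w hw
    have hw0 : w ≠ 0 := by
      rintro rfl
      simp at hw
      linarith
    have e : 1 - w⁻¹ = (w - 1) / w := by field_simp
    rw [e, norm_div, div_lt_one (norm_pos_iff.2 hw0)]
    refine (sq_lt_sq₀ (norm_nonneg _) (norm_nonneg _)).1 ?_
    rw [← Complex.normSq_eq_norm_sq, ← Complex.normSq_eq_norm_sq, Complex.normSq_apply,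
      Complex.normSq_apply]
    simp only [Complex.sub_re, Complex.sub_im, Complex.one_re, Complex.one_im]
    nlinarith
  have hz : ∀ n, ‖z n‖ < 1 := fun n => key _ (by simp)
  have hz' : ∀ n, ‖z' n‖ < 1 := fun n => key _ (by rw [hre])
  have hz1 : Tendsto z atTop (𝓝 1) := by
    have h5 : Tendsto (fun n : ℕ => (n + 1 : ℂ)⁻¹) atTop (𝓝 0) := by
      simpa [one_div] using (tendsto_one_div_add_atTop_nhds_zero_nat (𝕜 := ℂ))
    simpa using h5.const_sub 1
  have hz1' : Tendsto z' atTop (𝓝 1) := by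
    have h5 : Tendsto (fun n : ℕ => (w n)⁻¹) atTop (𝓝 0) := by
      rw [tendsto_zero_iff_norm_tendsto_zero]
      refine squeeze_zero (fun n => norm_nonneg _) (g := fun n : ℕ => 1 / ((n : ℝ) + 1))
        (fun n => ?_) tendsto_one_div_add_atTop_nhds_zero_nat
      rw [norm_inv, one_div]
      have hn' : (0 : ℝ) < n + 1 := by positivity
      refine inv_anti₀ hn' ?_
      refine le_trans ?_ (Complex.abs_im_le_norm _)
      rw [him, abs_of_nonneg (by positivity)]
      nlinarith [Real.pi_gt_three]
    simpa using h5.const_sub 1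
  have h6 := tendsto_evalAt_sub hf hc hz hz' hz1 hz1' hT
  have h7 : ∀ n, evalAt f c (z n) T - evalAt f c (z' n) T =
      Complex.exp (-(n + 1)) - Complex.exp (-1) := by
    intro n
    have e1 : (1 - z n)⁻¹ = n + 1 := by simp [z]
    have e2 : (1 - z' n)⁻¹ = w n := by simp [z']
    have e3 : Complex.exp (-w n) = Complex.exp (-1) := by
      refine Complex.exp_eq_exp_iff_exists_int.2 ⟨-(n + 1), ?_⟩
      push_cast
      simp only [w]
      ring
    rw [h4 _ (hz n), h4 _ (hz' n), e1, e2, e3]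
    ring
  simp only [h7] at h6
  have h8 : Tendsto (fun n : ℕ => Complex.exp (-(n + 1))) atTop (𝓝 0) := by
    rw [tendsto_zero_iff_norm_tendsto_zero]
    have e4 : ∀ n : ℕ, ‖Complex.exp (-(n + 1))‖ = Real.exp (-(n + 1 : ℝ)) := by
      intro n
      rw [Complex.norm_exp]
      simp
    simp only [e4]
    refine Real.tendsto_exp_neg_atTop_nhds_zero.comp ?_
    exact tendsto_atTop_add_const_right _ _ tendsto_natCast_atTop_atTop
  have h9 := tendsto_nhds_unique h6 (h8.sub_const _)
  rw [zero_sub] at h9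
  exact Complex.exp_ne_zero (-1) (neg_eq_zero.1 h9.symm)

end ClosedPathAfterExternalEdge

end DiGraph

namespace DiGraph

open Quiver

/-! ### Strongly connected components; commuting closed paths give circles -/

section StrongComponents

variable {V : Type u} [Quiver.{v} V]

/-- There is a closed path of positive length at `x`. -/
def IsCyclic (x : V) : Prop := ∃ p : Path x x, p ≠ Path.nil

/-- The strongly connected component of `x`. -/
def strongComponent (x : V) : Set V := {z | Nonempty (Path x z) ∧ Nonempty (Path z x)}

theorem mem_strongComponent_self (x : V) : x ∈ strongComponent x := ⟨⟨Path.nil⟩, ⟨Path.nil⟩⟩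

theorem mem_strongComponent_symm {x y : V} (h : y ∈ strongComponent x) : x ∈ strongComponent y :=
  ⟨h.2, h.1⟩

theorem mem_strongComponent_trans {x y z : V} (h : y ∈ strongComponent x)
    (h' : z ∈ strongComponent y) : z ∈ strongComponent x := by
  obtain ⟨⟨p⟩, ⟨q⟩⟩ := h
  obtain ⟨⟨p'⟩, ⟨q'⟩⟩ := h'
  exact ⟨⟨p.comp p'⟩, ⟨q'.comp q⟩⟩

theorem IsCyclic.of_mem {x z : V} (hx : IsCyclic x) (hz : z ∈ strongComponent x) : IsCyclic z := by
  obtain ⟨p, hp⟩ := hx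
  obtain ⟨⟨q⟩, ⟨r⟩⟩ := hz
  refine ⟨(r.comp p).comp q, fun h => hp ?_⟩
  have := congrArg Path.length h
  rw [Path.length_comp, Path.length_comp, Path.length_nil] at this
  exact Path.eq_nil_of_length_zero p (by omega)

theorem not_isExternal_iff {x y : V} {f : x ⟶ y} : ¬ IsExternal f ↔ Nonempty (Path y x) :=
  not_isEmpty_iff

theorem isCyclic_left_of_not_isExternal {x y : V} {f : x ⟶ y} (h : ¬ IsExternal f) :
    IsCyclic x := by
  obtain ⟨p⟩ := not_isExternal_iff.1 h
  refine ⟨f.toPath.comp p, fun h => ?_⟩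
  have := congrArg Path.length h
  rw [Path.length_comp, Path.length_nil, Path.length_toPath] at this
  omega

theorem mem_strongComponent_of_not_isExternal {x y : V} {f : x ⟶ y} (h : ¬ IsExternal f) :
    y ∈ strongComponent x :=
  ⟨⟨f.toPath⟩, not_isExternal_iff.1 h⟩

/-- The subgraph of the vertices of a strongly connected component. -/
def componentSubgraph (x : V) : Subgraph V where
  verts := strongComponent x
  edges a b := {_e | a ∈ strongComponent x ∧ b ∈ strongComponent x}
  left_mem h := h.1
  right_mem h := h.2

/-- Equal paths have equal first edges. Paths are built by appending last edges, so the induction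
strips from the far end. -/
theorem mk_eq_of_toPath_comp_eq {a b b' d : V} {e : a ⟶ b} {e' : a ⟶ b'} {p : Path b d}
    {p' : Path b' d} (h : e.toPath.comp p = e'.toPath.comp p') :
    (⟨b, e⟩ : Σ b, a ⟶ b) = ⟨b', e'⟩ := by
  induction p with
  | nil =>
    have hl := congrArg Path.length h
    rw [Path.length_comp, Path.length_comp, Path.length_toPath, Path.length_toPath,
      Path.length_nil] at hl
    obtain rfl := Path.eq_of_length_zero p' (by omega)
    obtain rfl := Path.eq_nil_of_length_zero p' (by omega)
    rw [(Path.hom_heq_of_cons_eq_cons h).eq]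
  | cons p g ih =>
    cases p' with
    | nil =>
      have hl := congrArg Path.length h
      simp only [Path.length_comp, Path.length_cons, Path.length_nil, Path.length_toPath] at hl
      omega
    | cons p' g' =>
      rw [Path.comp_cons, Path.comp_cons] at h
      obtain rfl := Path.obj_eq_of_cons_eq_cons h
      exact ih (Path.heq_of_cons_eq_cons h).eq

/-- If the closed paths at `x` commute, then at most one edge of the component of `x` starts at
each vertex. -/
theorem mk_eq_of_closed_paths_commute {x : V} (hcomm : ∀ c d : Path x x, c.comp d = d.comp c)
    {a b b' : V} (ha : a ∈ strongComponent x) (hb : b ∈ strongComponent x)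
    (hb' : b' ∈ strongComponent x) (e : a ⟶ b) (e' : a ⟶ b') :
    (⟨b, e⟩ : Σ b, a ⟶ b) = ⟨b', e'⟩ := by
  obtain ⟨⟨q⟩, -⟩ := ha
  obtain ⟨-, ⟨r⟩⟩ := hb
  obtain ⟨-, ⟨r'⟩⟩ := hb'
  -- Two closed paths through e and e' with the common prefix q: commuting makes the products equal,
  -- and cancelling q leaves paths beginning with e and e'.
  have h := hcomm (q.comp (e.toPath.comp r)) (q.comp (e'.toPath.comp r'))
  simp only [Path.comp_assoc] at h
  exact mk_eq_of_toPath_comp_eq (Path.comp_inj_right.1 h)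

theorem exists_equiv_zmod {α : Type*} (next : α → α) (x : α) (hx : ∃ k, 0 < k ∧ next^[k] x = x)
    (h : ∀ a, ∃ k, next^[k] x = a) :
    ∃ n : ℕ, 1 ≤ n ∧ ∃ φ : α ≃ ZMod n, ∀ a b, b = next a ↔ φ a = φ b + 1 := by
  obtain ⟨k, hk, hkx⟩ := hx
  have hn : 0 < Function.minimalPeriod next x :=
    Function.IsPeriodicPt.minimalPeriod_pos hk hkx
  set n := Function.minimalPeriod next x with hndef
  have : NeZero n := ⟨hn.ne'⟩
  -- Edges of `circleQuiver` lower the index by one, hence the sign.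
  let ψ : ZMod n → α := fun j => next^[(-j).val] x
  have hψ : ∀ k : ℕ, ψ (-(k : ZMod n)) = next^[k] x := by
    intro k
    simp only [ψ, neg_neg, ZMod.val_natCast]
    exact Function.iterate_mod_minimalPeriod_eq
  have hinj : Function.Injective ψ := by
    intro i j hij
    have h1 := Function.iterate_injOn_Iio_minimalPeriod (f := next) (x := x)
      (ZMod.val_lt (-i)) (ZMod.val_lt (-j)) hij
    exact neg_injective (ZMod.val_injective n h1)
  have hsurj : Function.Surjective ψ := by
    intro a
    obtain ⟨k, rfl⟩ := h a
    exact ⟨_, hψ k⟩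
  have hnext : ∀ j, ψ (j - 1) = next (ψ j) := by
    intro j
    have e1 : j = -(((-j).val : ℕ) : ZMod n) := by
      rw [ZMod.natCast_zmod_val, neg_neg]
    have e2 : j - 1 = -(((-j).val + 1 : ℕ) : ZMod n) := by
      push_cast
      rw [ZMod.natCast_zmod_val]; ring
    rw [e2, hψ, Function.iterate_succ_apply']
  let Φ := Equiv.ofBijective ψ ⟨hinj, hsurj⟩
  refine ⟨n, hn, Φ.symm, fun a b => ?_⟩
  obtain ⟨i, rfl⟩ := Φ.surjective a
  obtain ⟨j, rfl⟩ := Φ.surjective b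
  rw [Equiv.symm_apply_apply, Equiv.symm_apply_apply]
  change ψ j = next (ψ i) ↔ _
  rw [← hnext, hinj.eq_iff, eq_sub_iff_add_eq, eq_comm]

/-- Each vertex of the component has exactly one outgoing edge inside it, so paths are iterates of
the successor map. Strong connectedness makes the component a single orbit, and cyclicity makes it
periodic. -/
theorem isCircle_componentSubgraph {x : V} (hx : IsCyclic x)
    (hcomm : ∀ c d : Path x x, c.comp d = d.comp c) : IsCircle (componentSubgraph x).Vert := by
  have hout : ∀ a : (componentSubgraph x).Vert, ∃ b : (componentSubgraph x).Vert,
      Nonempty (a.1 ⟶ b.1) := by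
    rintro ⟨a, ha⟩
    obtain ⟨p, hp⟩ := hx.of_mem ha
    have h0 : p.length ≠ 0 := fun h => hp (Path.eq_nil_of_length_zero p h)
    obtain ⟨n, hn⟩ := Nat.exists_eq_succ_of_ne_zero h0
    obtain ⟨b, e, q, -, rfl⟩ := p.eq_toPath_comp_of_length_eq_succ hn
    exact ⟨⟨b, mem_strongComponent_trans ha ⟨⟨e.toPath⟩, ⟨q⟩⟩⟩, ⟨e⟩⟩
  choose next hnext using hout
  have huniq : ∀ (a b : (componentSubgraph x).Vert), (a.1 ⟶ b.1) → b = next a := by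
    rintro a b e
    obtain ⟨e'⟩ := hnext a
    have := mk_eq_of_closed_paths_commute hcomm a.2 b.2 (next a).2 e e'
    exact Subtype.ext (congrArg Sigma.fst this)
  have hpath : ∀ {a b : V} (p : Path a b) (ha : a ∈ strongComponent x)
      (hb : b ∈ strongComponent x), next^[p.length] ⟨a, ha⟩ = ⟨b, hb⟩ := by
    intro a b p ha hb
    induction p with
    | nil => rfl
    | cons p e ih =>
      have hb' := mem_strongComponent_trans ha
        ⟨⟨p⟩, ⟨e.toPath.comp (Classical.choice (hb.2.map fun q => q.comp (Classical.choice ha.1)))⟩⟩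
      exact (Function.iterate_succ_apply' next p.length _).trans
        ((congrArg next (ih hb')).trans (huniq ⟨_, hb'⟩ ⟨_, hb⟩ e).symm)
  obtain ⟨n, hn, φ, hφ⟩ := exists_equiv_zmod next ⟨x, mem_strongComponent_self x⟩ (by
    obtain ⟨p, hp⟩ := hx
    exact ⟨p.length, Nat.pos_of_ne_zero fun h => hp (Path.eq_nil_of_length_zero p h),
      hpath p _ _⟩) (by
    rintro ⟨a, ha⟩
    obtain ⟨p⟩ := ha.1
    exact ⟨p.length, hpath p _ _⟩)
  refine ⟨n, hn, φ, fun a b => ?_⟩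
  have hs : Subsingleton (a ⟶ b) := by
    refine ⟨fun e e' => Subtype.ext ?_⟩
    have := mk_eq_of_closed_paths_commute hcomm a.2 b.2 b.2 e.1 e'.1
    exact (Sigma.mk.inj_iff.1 this).2.eq
  by_cases hab : b = next a
  · subst hab
    obtain ⟨e⟩ := hnext a
    exact ⟨⟨fun _ => ⟨(hφ _ _).1 rfl⟩, fun _ => ⟨e, a.2, (next a).2⟩,
      fun _ => Subsingleton.elim _ _, fun _ => rfl⟩⟩
  · exact ⟨⟨fun e => (hab (huniq a b e.1)).elim, fun e => (hab ((hφ a b).2 e.down)).elim,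
      fun e => (hab (huniq a b e.1)).elim, fun e => (hab ((hφ a b).2 e.down)).elim⟩⟩

end StrongComponents

/-! ### The graph of external edges -/

section ExternalTree

variable {V : Type u} [Quiver.{v} V]

theorem exists_isExternal_of_not_isStronglyConnected (hconn : IsConnected V)
    (hns : ¬ IsStronglyConnected V) : ∃ (x y : V) (f : x ⟶ y), IsExternal f := by
  by_contra! hE
  refine hns fun a b => ?_
  have := eq_of_forall_edge_eq (f := fun z => Nonempty (Path a z)) hconn (fun x y e => ?_) a b
  · exact this.mp ⟨Path.nil⟩
  · obtain ⟨q⟩ := not_isExternal_iff.1 (hE x y e)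
    exact propext ⟨fun ⟨p⟩ => ⟨p.cons e⟩, fun ⟨p⟩ => ⟨p.comp q⟩⟩

/-- If no closed path meets the range of an external edge, then every component containing a
closed path of positive length has an exit. -/
theorem exists_exit (hconn : IsConnected V) (hns : ¬ IsStronglyConnected V)
    (hnil : ∀ {x y : V} {f : x ⟶ y}, IsExternal f → ¬ IsCyclic y) {x : V} (hx : IsCyclic x) :
    ∃ r ∈ strongComponent x, ∃ (y : V) (f : r ⟶ y), IsExternal f := by
  by_contra! hE
  -- Without an exit the component is closed under outgoing edges; an edge entering from outside
  -- would be external with cyclic range. So the component is everything, against the failure of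
  -- strong connectedness.
  have hall : ∀ a, a ∈ strongComponent x := by
    intro a
    refine (eq_of_forall_edge_eq (f := fun z => z ∈ strongComponent x) hconn
      (fun y z e => propext ⟨fun hy => ?_, fun hz => ?_⟩) x a).mp (mem_strongComponent_self x)
    · exact mem_strongComponent_trans hy (mem_strongComponent_of_not_isExternal (hE y hy z e))
    · have : ¬ IsExternal e := fun he => hnil he (hx.of_mem hz)
      exact mem_strongComponent_trans hz
        (mem_strongComponent_symm (mem_strongComponent_of_not_isExternal this))
  exact hns fun a b =>
    (mem_strongComponent_trans (mem_strongComponent_symm (hall a)) (hall b)).1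

variable (V) in
/-- The subgraph of the external edges and their end points. -/
def externalSubgraph : Subgraph V where
  verts := {z | ∃ (x y : V) (f : x ⟶ y), IsExternal f ∧ (z = x ∨ z = y)}
  edges _ _ := {f | IsExternal f}
  left_mem {_ _ f} h := ⟨_, _, f, h, Or.inl rfl⟩
  right_mem {_ _ f} h := ⟨_, _, f, h, Or.inr rfl⟩

theorem Subgraph.total_injective (H : Subgraph V) : Function.Injective
    (fun e : Total H.Vert => (⟨e.left.1, e.right.1, e.hom.1⟩ : Total V)) := by
  rintro ⟨⟨a, ha⟩, ⟨b, hb⟩, ⟨f, hf⟩⟩ ⟨⟨a', ha'⟩, ⟨b', hb'⟩, ⟨f', hf'⟩⟩ h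
  dsimp only at h
  cases h
  rfl

/-- The characteristic function of one edge of the polygon is a coboundary. The differences of its
potential around the polygon telescope to 0, but exactly one of them is ±1. -/
theorem not_hasPolygon_externalSubgraph
    (hpot : ∀ {x y : V} {f : x ⟶ y}, IsExternal f → ∃ t : V → ℂ, t x - t y = 1 ∧
      ∀ (s z : V) (e : s ⟶ z), (⟨s, z, e⟩ : Total V) ≠ ⟨x, y, f⟩ → t s = t z) :
    ¬ HasPolygon (externalSubgraph V).Vert := by
  rintro ⟨n, hn, p, e, -, he, hpe⟩
  have : NeZero n := ⟨by omega⟩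
  obtain ⟨t, ht1, ht2⟩ := hpot (f := (e 0).hom.1) (e 0).hom.2
  have hsum : ∑ j, (t (p j).1 - t (p (j + 1)).1) = 0 := by
    rw [Finset.sum_sub_distrib, sub_eq_zero]
    exact (Equiv.sum_comp (Equiv.addRight (1 : ZMod n)) fun j => t (p j).1).symm
  have hpair : ∀ j, ((e j).right = p j ∧ (e j).left = p (j + 1)) ∨
      ((e j).right = p (j + 1) ∧ (e j).left = p j) := fun j => Set.pair_eq_pair_iff.1 (hpe j)
  rw [Finset.sum_eq_single 0] at hsum
  · rcases hpair 0 with ⟨h1, h2⟩ | ⟨h1, h2⟩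
    · rw [← h1, ← h2] at hsum
      have : (1 : ℂ) = 0 := by linear_combination -hsum - ht1
      exact one_ne_zero this
    · rw [← h1, ← h2, ht1] at hsum
      exact one_ne_zero hsum
  · intro j _ hj
    have h3 := ht2 _ _ (e j).hom.1 (fun h => hj (he ?_))
    · rcases hpair j with ⟨h1, h2⟩ | ⟨h1, h2⟩
      · rw [← h1, ← h2, h3, sub_self]
      · rw [← h1, ← h2, h3, sub_self]
    · exact Subgraph.total_injective _ h
  · simp

end ExternalTree

/-! ### Assembling the fruit tree -/

section FruitTree

variable {V : Type u} [Quiver.{v} V]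

/-- The map k retracts the graph onto the external subgraph: it contracts each cyclic component to
the source of its unique exit and fixes the other vertices. External edges survive and internal ones
collapse, so undirected connectedness descends. -/
theorem isConnected_externalSubgraph (hconn : IsConnected V) (hns : ¬ IsStronglyConnected V)
    (hnil : ∀ {x y : V} {f : x ⟶ y}, IsExternal f → ¬ IsCyclic y)
    (hexit : ∀ {x y x' y' : V} {f : x ⟶ y} {g : x' ⟶ y'}, IsExternal f → IsExternal g →
      IsCyclic x → x' ∈ strongComponent x → (⟨x', y', g⟩ : Total V) = ⟨x, y, f⟩)
    (hmem : ∀ z : V, ¬ IsCyclic z → z ∈ (externalSubgraph V).verts) :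
    IsConnected (externalSubgraph V).Vert := by
  obtain ⟨x0, y0, f0, hf0⟩ := exists_isExternal_of_not_isStronglyConnected hconn hns
  refine ⟨⟨⟨x0, x0, y0, f0, hf0, Or.inl rfl⟩⟩, ?_⟩
  have hk : ∀ z : V, ∃ k : (externalSubgraph V).Vert, (¬ IsCyclic z → k.1 = z) ∧
      (IsCyclic z → k.1 ∈ strongComponent z ∧ ∃ (y : V) (f : k.1 ⟶ y), IsExternal f) := by
    intro z
    by_cases hz : IsCyclic z
    · obtain ⟨r, hr, y, f, hf⟩ := exists_exit hconn hns hnil hz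
      exact ⟨⟨r, r, y, f, hf, Or.inl rfl⟩, fun h => (h hz).elim, fun _ => ⟨hr, y, f, hf⟩⟩
    · exact ⟨⟨z, hmem z hz⟩, fun _ => rfl, fun h => (hz h).elim⟩
  choose k hk1 hk2 using hk
  have hkk : ∀ {x y : V} (f : x ⟶ y), IsExternal f → (k x).1 = x := by
    intro x y f hf
    by_cases hx : IsCyclic x
    · obtain ⟨hr, y', g, hg⟩ := hk2 x hx
      exact congrArg Total.left (hexit hf hg hx hr)
    · exact hk1 x hx
  have hkv : ∀ z : (externalSubgraph V).Vert, k z.1 = z := by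
    rintro ⟨z, x, y, f, hf, rfl | rfl⟩
    · exact Subtype.ext (hkk f hf)
    · exact Subtype.ext (hk1 _ (hnil hf))
  intro a b
  let W := Symmetrify (externalSubgraph V).Vert
  have := eq_of_forall_edge_eq (f := fun z => Nonempty (@Path W _ a (k z))) hconn
    (fun x y e => ?_) a.1 b.1
  · rw [hkv, hkv] at this
    exact this.mp ⟨Path.nil⟩
  · by_cases he : IsExternal e
    · have hx := hkk e he
      have hy := hk1 y (hnil he)
      have hedge : ∀ u w : (externalSubgraph V).Vert, u.1 = x → w.1 = y → Nonempty (u ⟶ w) := by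
        rintro ⟨_, _⟩ ⟨_, _⟩ rfl rfl
        exact ⟨⟨e, he⟩⟩
      obtain ⟨e'⟩ := hedge _ _ hx hy
      exact propext ⟨fun ⟨p⟩ => ⟨Path.cons (V := W) p (Sum.inl e')⟩,
        fun ⟨p⟩ => ⟨Path.cons (V := W) p (Sum.inr e')⟩⟩
    · have hx := isCyclic_left_of_not_isExternal he
      have hxy := mem_strongComponent_of_not_isExternal he
      obtain ⟨h1, u, f, hf⟩ := hk2 x hx
      obtain ⟨h2, w, g, hg⟩ := hk2 y (hx.of_mem hxy)
      have h3 := hexit hf hg (hx.of_mem h1) (mem_strongComponent_trans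
        (mem_strongComponent_trans (mem_strongComponent_symm h1) hxy) h2)
      have h4 : k y = k x := Subtype.ext (congrArg Total.left h3)
      change Nonempty (@Path W _ a (k x)) = Nonempty (@Path W _ a (k y))
      rw [h4]

/-- A connected graph, not strongly connected, is a fruit tree with external edges as tree edges
and cyclic components as out-fruits, if the cyclic components have exactly one external edge,
which leaves, their closed paths commute, and characteristic functions of external edges are
coboundaries. -/
theorem isFruitTreeWithoutInFruit_of_isExternal [Finite V] (hconn : IsConnected V)
    (hns : ¬ IsStronglyConnected V)
    (hnil : ∀ {x y : V} {f : x ⟶ y}, IsExternal f → ¬ IsCyclic y)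
    (hexit : ∀ {x y x' y' : V} {f : x ⟶ y} {g : x' ⟶ y'}, IsExternal f → IsExternal g →
      IsCyclic x → x' ∈ strongComponent x → (⟨x', y', g⟩ : Total V) = ⟨x, y, f⟩)
    (hcomm : ∀ {x y : V} {f : x ⟶ y}, IsExternal f → ∀ c d : Path x x, c.comp d = d.comp c)
    (hpot : ∀ {x y : V} {f : x ⟶ y}, IsExternal f → ∃ t : V → ℂ, t x - t y = 1 ∧
      ∀ (s z : V) (e : s ⟶ z), (⟨s, z, e⟩ : Total V) ≠ ⟨x, y, f⟩ → t s = t z) :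
    IsFruitTreeWithoutInFruit V := by
  obtain ⟨x0, y0, f0, hf0⟩ := exists_isExternal_of_not_isStronglyConnected hconn hns
  have hxy0 : x0 ≠ y0 := by
    rintro rfl
    exact hf0.false Path.nil
  have hmem : ∀ z : V, ¬ IsCyclic z → z ∈ (externalSubgraph V).verts := by
    intro z hz
    by_contra hz'
    -- A vertex that is neither cyclic nor on an external edge meets no edge at all, so by
    -- connectedness it would be the only vertex.
    have hall := eq_of_forall_edge_eq (f := fun w => w = z) hconn (fun x y e => ?_)
    · exact hxy0 (((hall x0 z).mpr rfl).trans ((hall y0 z).mpr rfl).symm)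
    · by_cases he : IsExternal e
      · have hx : x ≠ z := by
          rintro rfl
          exact hz' ⟨_, _, e, he, Or.inl rfl⟩
        have hy : y ≠ z := by
          rintro rfl
          exact hz' ⟨_, _, e, he, Or.inr rfl⟩
        simp [hx, hy]
      · have hx := isCyclic_left_of_not_isExternal he
        have hx' : x ≠ z := by
          rintro rfl
          exact hz hx
        have hy' : y ≠ z := by
          rintro rfl
          exact hz (hx.of_mem (mem_strongComponent_of_not_isExternal he))
        simp [hx', hy']
  have hleft : ∀ z ∈ (externalSubgraph V).verts, IsCyclic z →
      ∃ (y : V) (f : z ⟶ y), IsExternal f := by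
    rintro z ⟨x, y, f, hf, rfl | rfl⟩ hz
    · exact ⟨y, f, hf⟩
    · exact (hnil hf hz).elim
  have hsub : ∀ z ∈ (externalSubgraph V).verts, IsCyclic z →
      ∀ z' ∈ (externalSubgraph V).verts, z' ∈ strongComponent z → z' = z := by
    intro z hz hzc z' hz' hzz
    obtain ⟨y, f, hf⟩ := hleft z hz hzc
    obtain ⟨y', f', hf'⟩ := hleft z' hz' (hzc.of_mem hzz)
    exact congrArg Total.left (hexit hf hf' hzc hzz)
  have hout : ∀ x : (externalSubgraph V).Vert, IsCyclic x.1 → outDegree x = 1 := by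
    intro x hx
    obtain ⟨y, f, hf⟩ := hleft x.1 x.2 hx
    rw [outDegree, Set.encard_eq_one]
    refine ⟨⟨x, ⟨y, x.1, y, f, hf, Or.inr rfl⟩, ⟨f, hf⟩⟩, Set.eq_singleton_iff_unique_mem.2
      ⟨rfl, ?_⟩⟩
    rintro ⟨a, ⟨b, hb⟩, ⟨g, hg⟩⟩ rfl
    have h1 := hexit (g := g) hf hg hx (mem_strongComponent_self _)
    cases h1
    rfl
  have hin : ∀ x : (externalSubgraph V).Vert, IsCyclic x.1 → inDegree x = 0 := by
    intro x hx
    rw [inDegree, Set.encard_eq_zero, Set.eq_empty_iff_forall_notMem]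
    rintro ⟨a, b, ⟨g, hg⟩⟩ rfl
    exact hnil (f := g) hg hx
  refine ⟨inferInstance,
    { tree := externalSubgraph V
      isGeneralizedTree := ⟨isConnected_externalSubgraph hconn hns hnil hexit hmem,
        ⟨⟨⟨x0, x0, y0, f0, hf0, Or.inl rfl⟩, ⟨y0, x0, y0, f0, hf0, Or.inr rfl⟩,
          fun h => hxy0 (congrArg Subtype.val h)⟩⟩, not_hasPolygon_externalSubgraph hpot⟩
      attach := {x | IsCyclic x.1}
      isLeaf := fun x hx => by rw [IsLeaf, hout x hx, hin x hx, add_zero]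
      attach_ne := fun h => by
        have : (⟨y0, x0, y0, f0, hf0, Or.inr rfl⟩ : (externalSubgraph V).Vert) ∈
          {x : (externalSubgraph V).Vert | IsCyclic x.1} := by rw [h]; trivial
        exact hnil hf0 this
      fruit := fun x => componentSubgraph x.1.1
      isCircle := fun x => by
        obtain ⟨y, f, hf⟩ := hleft x.1.1 x.1.2 x.2
        exact isCircle_componentSubgraph x.2 (hcomm hf)
      fruit_disjoint := fun x y hxy => by
        refine Set.disjoint_left.2 fun z hz hz' => hxy ?_
        refine Subtype.ext (Subtype.ext ?_)
        exact hsub y.1.1 y.1.2 y.2 x.1.1 x.1.2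
          (mem_strongComponent_trans hz' (mem_strongComponent_symm hz))
      tree_inter_fruit := fun x => by
        refine Set.eq_singleton_iff_unique_mem.2 ⟨⟨x.1.2, mem_strongComponent_self _⟩, ?_⟩
        rintro z ⟨hz, hz'⟩
        exact hsub x.1.1 x.1.2 x.2 z hz hz'
      verts_cover := fun a => by
        by_cases ha : IsCyclic a
        · obtain ⟨r, hr, y, f, hf⟩ := exists_exit hconn hns hnil ha
          exact Or.inr ⟨⟨⟨r, r, y, f, hf, Or.inl rfl⟩, ha.of_mem hr⟩, mem_strongComponent_symm hr⟩
        · exact Or.inl (hmem a ha)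
      edges_cover := fun {a b} e => by
        by_cases he : IsExternal e
        · exact Or.inl he
        · have ha := isCyclic_left_of_not_isExternal he
          have hb := mem_strongComponent_of_not_isExternal he
          obtain ⟨r, hr, y, f, hf⟩ := exists_exit hconn hns hnil ha
          exact Or.inr ⟨⟨⟨r, r, y, f, hf, Or.inl rfl⟩, ha.of_mem hr⟩, mem_strongComponent_symm hr,
            mem_strongComponent_trans (mem_strongComponent_symm hr) hb⟩
      edges_disjoint := fun {a b} e x => by
        rintro ⟨h1, h2, h3⟩
        obtain ⟨p⟩ := (mem_strongComponent_trans (mem_strongComponent_symm h3) h2).1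
        exact h1.false p }, fun x hx => hx (hout x.1 x.2)⟩

theorem isFruitTreeWithoutInFruit_of_forall_isInner (hconn : IsConnected V)
    (hns : ¬ IsStronglyConnected V)
    (h : ∀ δ : tensorAlgebra V →L[ℂ] tensorAlgebra V, IsDerivation δ → IsInner δ) :
    IsFruitTreeWithoutInFruit V := by
  have := finite_of_forall_isInner hconn h
  refine isFruitTreeWithoutInFruit_of_isExternal hconn hns ?_ ?_ ?_ ?_
  · rintro x y f hf ⟨c, hc⟩
    exact hc (closed_path_eq_nil h hf c)
  · rintro x y x' y' f g hf hg ⟨c, hc⟩ ⟨⟨q⟩, ⟨q'⟩⟩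
    exact external_edge_unique h hf hc hg q q'
  · intro x y f hf c d
    exact closed_paths_commute h hf c d
  · intro x y f hf
    obtain ⟨t, ht⟩ := exists_potential_of_forall_isInner h hf
    refine ⟨t, ?_, fun s z e he => ?_⟩
    · rw [ht, if_pos rfl]
    · rw [← sub_eq_zero, ht, if_neg he]

end FruitTree

end DiGraph

namespace DiGraph

open Quiver

/-! ### Coboundaries on finite graphs without polygons -/

section Potentials

variable {W : Type u} [Quiver.{v} W]

/-- The simple graph of the edges other than `e`. -/
def deleteEdge (e : Total W) : SimpleGraph W where
  Adj a b := a ≠ b ∧ ∃ g : Total W, g ≠ e ∧ ({g.right, g.left} : Set W) = {a, b}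
  symm := ⟨fun _ _ ⟨h, g, hg, hab⟩ => ⟨h.symm, g, hg, by rw [hab, Set.pair_comm]⟩⟩
  loopless := ⟨fun _ h => h.1 rfl⟩

/-- An edge whose end points are joined by the remaining edges belongs to a polygon. -/
theorem hasPolygon_of_reachable {e : Total W} (h : (deleteEdge e).Reachable e.left e.right) :
    HasPolygon W := by
  classical
  obtain ⟨w, hw⟩ := h.exists_isPath
  have hadj : ∀ i : Fin w.length, ∃ g : Total W, g ≠ e ∧
      ({g.right, g.left} : Set W) = {w.getVert i, w.getVert (i + 1)} :=
    fun i => (w.adj_getVert_succ i.2).2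
  choose g hg1 hg2 using hadj
  have hinj := hw.getVert_injOn
  let p : Fin (w.length + 1) → W := fun j => w.getVert j
  -- The edge e closes the simple path w; a loop corresponds to the trivial path. `ZMod (w.length +
  -- 1)` unfolds to `Fin (w.length + 1)`.
  let E : Fin (w.length + 1) → Total W := Fin.snoc (α := fun _ => Total W) g e
  have hE1 : ∀ i, E i.castSucc = g i := fun i => Fin.snoc_castSucc (α := fun _ => Total W) e g i
  have hE2 : E (Fin.last _) = e := Fin.snoc_last (α := fun _ => Total W) e g
  have hpinj : ∀ {i j : ℕ}, i ≤ w.length → j ≤ w.length → w.getVert i = w.getVert j → i = j :=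
    fun hi hj hij => hinj hi hj hij
  refine ⟨w.length + 1, Nat.le_add_left _ _, p, E, fun i j hij => ?_, fun i j => ?_, fun j => ?_⟩
  · exact Fin.ext (hpinj (Nat.le_of_lt_succ i.2) (Nat.le_of_lt_succ j.2) hij)
  · refine Fin.lastCases ?_ (fun i => ?_) i <;> refine Fin.lastCases ?_ (fun j => ?_) j
    · exact fun _ => rfl
    · rw [hE1, hE2]
      exact fun h => (hg1 j h.symm).elim
    · rw [hE1, hE2]
      exact fun h => (hg1 i h).elim
    · rw [hE1, hE1]
      intro hij
      have h1 := (hg2 i).symm.trans ((congrArg (fun g : Total W =>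
        ({g.right, g.left} : Set W)) hij).trans (hg2 j))
      have hi := i.2
      have hj := j.2
      rcases Set.pair_eq_pair_iff.1 h1 with ⟨h2, -⟩ | ⟨h2, h3⟩
      · have := hpinj (by omega) (by omega) h2
        rw [Fin.ext this]
      · have h4 := hpinj (by omega) (by omega) h2
        have h5 := hpinj (by omega) (by omega) h3
        omega
  · change ({(E j).right, (E j).left} : Set W) = {p j, p ((show Fin (w.length + 1) from j) + 1)}
    refine Fin.lastCases ?_ (fun j => ?_) j
    · rw [hE2, Fin.last_add_one]
      change _ = ({w.getVert w.length, w.getVert 0} : Set W)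
      rw [w.getVert_length, w.getVert_zero]
    · rw [hE1, hg2, Fin.coeSucc_eq_succ]
      rfl

/-- In a finite graph without polygons every function on the edges is a coboundary. -/
theorem exists_potential_of_not_hasPolygon [Finite W] (h : ¬ HasPolygon W) (c : Total W → ℂ) :
    ∃ t : W → ℂ, ∀ e : Total W, t e.left - t e.right = c e := by
  classical
  have hreach : ∀ e g : Total W, g ≠ e → (deleteEdge e).Reachable g.left g.right := by
    intro e g hge
    by_cases hl : g.left = g.right
    · rw [hl]
    · exact SimpleGraph.Adj.reachable ⟨hl, g, hge, Set.pair_comm _ _⟩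
  -- Parallel edges would form a polygon, so an edge is determined by its end points.
  have hfin : Finite (Total W) := by
    refine Finite.of_injective (fun e : Total W => (e.left, e.right)) fun e g heg => ?_
    by_contra hne
    have h1 := hreach e g (Ne.symm hne)
    have h2 : e.left = g.left := congrArg Prod.fst heg
    have h3 : e.right = g.right := congrArg Prod.snd heg
    rw [← h2, ← h3] at h1
    exact h (hasPolygon_of_reachable h1)
  have := Fintype.ofFinite (Total W)
  -- Every edge is a bridge. The indicator of the side of its source after deletion is a potential
  -- for its characteristic function; general functions follow by summation.
  let τ : Total W → W → ℂ := fun e z => if (deleteEdge e).Reachable e.left z then 1 else 0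
  have hτ : ∀ e g : Total W, τ e g.left - τ e g.right = if g = e then 1 else 0 := by
    intro e g
    by_cases hge : g = e
    · subst hge
      have h1 : ¬ (deleteEdge g).Reachable g.left g.right := fun h1 => h (hasPolygon_of_reachable h1)
      simp only [τ, if_neg h1, if_pos (SimpleGraph.Reachable.refl g.left), if_true, sub_zero]
    · have h1 := hreach e g hge
      have h2 : (deleteEdge e).Reachable e.left g.left ↔ (deleteEdge e).Reachable e.left g.right :=
        ⟨fun h3 => h3.trans h1, fun h3 => h3.trans h1.symm⟩
      simp only [τ, h2, sub_self, if_neg hge]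
  refine ⟨fun z => ∑ e, c e * τ e z, fun g => ?_⟩
  rw [← Finset.sum_sub_distrib]
  simp only [← mul_sub, hτ]
  simp

end Potentials

/-! ### Paths in a fruit tree without in-fruits -/

section Fruits

variable {V : Type u} [Quiver.{v} V]

theorem GeneralizedFruitTree.exists_potential [Finite V] (D : GeneralizedFruitTree V)
    (c : Total V → ℂ) : ∃ t : V → ℂ, ∀ (a b : V) (e : a ⟶ b), e ∈ D.tree.edges a b →
      t a - t b = c ⟨a, b, e⟩ := by
  classical
  have : Finite D.tree.Vert := inferInstanceAs (Finite {x : V // x ∈ D.tree.verts})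
  obtain ⟨t, ht⟩ := exists_potential_of_not_hasPolygon D.isGeneralizedTree.2.2
    (fun e => c ⟨e.left.1, e.right.1, e.hom.1⟩)
  refine ⟨fun z => if hz : z ∈ D.tree.verts then t ⟨z, hz⟩ else 0, fun a b e he => ?_⟩
  have ha := D.tree.left_mem he
  have hb := D.tree.right_mem he
  simp only [dif_pos ha, dif_pos hb]
  exact ht ⟨⟨a, ha⟩, ⟨b, hb⟩, ⟨e, he⟩⟩

/-- The set of all vertices of the fruits. -/
def GeneralizedFruitTree.fruitVerts (D : GeneralizedFruitTree V) : Set V :=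
  {a | ∃ x, a ∈ (D.fruit x).verts}

theorem GeneralizedFruitTree.eq_of_mem (D : GeneralizedFruitTree V) {x y : D.attach} {a : V}
    (hx : a ∈ (D.fruit x).verts) (hy : a ∈ (D.fruit y).verts) : x = y := by
  by_contra h
  exact Set.disjoint_left.1 (D.fruit_disjoint x y h) hx hy

theorem GeneralizedFruitTree.eq_attach (D : GeneralizedFruitTree V) {x : D.attach} {a : V}
    (ha : a ∈ D.tree.verts) (hx : a ∈ (D.fruit x).verts) : a = x.1.1 := by
  have : a ∈ D.tree.verts ∩ (D.fruit x).verts := ⟨ha, hx⟩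
  rwa [D.tree_inter_fruit] at this

theorem GeneralizedFruitTree.inDegree_eq_zero (D : GeneralizedFruitTree V)
    (hD : ∀ x : D.attach, ¬ D.IsInFruit x) (x : D.attach) : inDegree x.1 = 0 := by
  have h1 : outDegree x.1 = 1 := not_not.1 (hD x)
  have h2 : outDegree x.1 + inDegree x.1 = 1 := D.isLeaf x.1 x.2
  rw [h1] at h2
  exact ENat.add_right_injective_of_ne_top (n := 1) (by simp) (h2.trans (add_zero 1).symm)

/-- Without in-fruits, all edges that end in a fruit belong to this fruit. -/
theorem GeneralizedFruitTree.mem_fruit_edges (D : GeneralizedFruitTree V)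
    (hD : ∀ x : D.attach, ¬ D.IsInFruit x) {x : D.attach} {a b : V} (e : a ⟶ b)
    (hb : b ∈ (D.fruit x).verts) : e ∈ (D.fruit x).edges a b := by
  rcases D.edges_cover e with he | ⟨y, he⟩
  · have h1 := D.inDegree_eq_zero hD x
    rw [inDegree, Set.encard_eq_zero, Set.eq_empty_iff_forall_notMem] at h1
    have ha := D.tree.left_mem he
    have hb' := D.tree.right_mem he
    exact (h1 ⟨⟨a, ha⟩, ⟨b, hb'⟩, ⟨e, he⟩⟩ (Subtype.ext (D.eq_attach hb' hb))).elim
  · obtain rfl := D.eq_of_mem hb ((D.fruit y).right_mem he)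
    exact he

theorem subsingleton_in_edges_of_isCircle {W : Type u} [Quiver.{v} W] (h : IsCircle W) (b : W) :
    Subsingleton (Σ a : W, a ⟶ b) := by
  obtain ⟨n, -, φ, hφ⟩ := h
  constructor
  rintro ⟨a, e⟩ ⟨a', e'⟩
  obtain ⟨ψ⟩ := hφ a b
  obtain ⟨ψ'⟩ := hφ a' b
  have h1 : φ a = φ a' := (ψ e).down.trans (ψ' e').down.symm
  obtain rfl := φ.injective h1
  have h0 : ∀ u v : φ a ⟶ φ b, u = v := by
    rintro ⟨_⟩ ⟨_⟩
    rfl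
  have h2 : e = e' := ψ.injective (h0 _ _)
  rw [h2]

theorem nonempty_path_of_isCircle {W : Type u} [Quiver.{v} W] (h : IsCircle W) (a b : W) :
    Nonempty (Path a b) := by
  obtain ⟨n, hn, φ, hφ⟩ := h
  have : NeZero n := ⟨by omega⟩
  have key : ∀ (k : ℕ) (a : W), (show ZMod n from φ a) = (show ZMod n from φ b) + k →
      Nonempty (Path a b) := by
    intro k
    induction k with
    | zero =>
      intro a ha
      rw [Nat.cast_zero, add_zero] at ha
      obtain rfl := φ.injective ha
      exact ⟨Path.nil⟩
    | succ k ih =>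
      intro a ha
      let a' := φ.symm (show ZMod n from (show ZMod n from φ b) + k)
      have ha' : φ a' = (show ZMod n from (show ZMod n from φ b) + k) := φ.apply_symm_apply _
      obtain ⟨p⟩ := ih a' ha'
      obtain ⟨ψ⟩ := hφ a a'
      refine ⟨(ψ.symm ⟨?_⟩).toPath.comp p⟩
      rw [ha', ha, Nat.cast_succ, add_assoc]
  refine key ((show ZMod n from φ a) - (show ZMod n from φ b)).val a ?_
  rw [ZMod.natCast_zmod_val]
  ring

/-- Two paths into a set with unique incoming edges: the longer one ends with the shorter one. -/
theorem exists_eq_comp_of_subsingleton {F : Set V} (hF : ∀ {a b : V}, (a ⟶ b) → b ∈ F → a ∈ F)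
    (hs : ∀ b ∈ F, Subsingleton (Σ a : V, a ⟶ b)) {b c : V} (q : Path b c) (hc : c ∈ F) {a : V}
    (p : Path a c) (hl : q.length ≤ p.length) : ∃ r : Path a b, p = r.comp q := by
  induction q with
  | nil => exact ⟨p, rfl⟩
  | cons q e ih =>
    cases p with
    | nil => simp at hl
    | cons p e' =>
      have := hs _ hc
      have h1 := Subsingleton.elim (⟨_, e⟩ : Σ a, a ⟶ _) ⟨_, e'⟩
      cases h1
      obtain ⟨r, rfl⟩ := ih (hF e hc) p (by simpa using hl)
      exact ⟨r, rfl⟩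

/-- Both products end at x and have the same length; tracing back along the unique incoming edges,
they coincide. -/
theorem closed_paths_commute_of_subsingleton {F : Set V}
    (hF : ∀ {a b : V}, (a ⟶ b) → b ∈ F → a ∈ F)
    (hs : ∀ b ∈ F, Subsingleton (Σ a : V, a ⟶ b)) {x : V} (hx : x ∈ F) (c d : Path x x) :
    c.comp d = d.comp c := by
  have hl : (d.comp c).length = (c.comp d).length := by
    rw [Path.length_comp, Path.length_comp, add_comm]
  obtain ⟨r, hr⟩ := exists_eq_comp_of_subsingleton hF hs (d.comp c) hx (c.comp d) hl.le
  have h1 : (c.comp d).length = r.length + (d.comp c).length := by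
    rw [← Path.length_comp, ← hr]
  rw [hr, Path.eq_nil_of_length_zero r (by omega), Path.nil_comp]

/-- Every vertex of a fruit has a well defined exit edge. -/
theorem GeneralizedFruitTree.exists_exit (D : GeneralizedFruitTree V)
    (hD : ∀ x : D.attach, ¬ D.IsInFruit x) : ∃ ex : V → Total V, ∀ x ∈ D.fruitVerts,
      (ex x).right ∉ D.fruitVerts ∧ Nonempty (Path x (ex x).left) ∧
      (ex x).left ∈ D.fruitVerts ∧ ∀ (b : V) (e : x ⟶ b), (b ∈ D.fruitVerts → ex b = ex x) ∧
        (b ∉ D.fruitVerts → ex x = ⟨x, b, e⟩) := by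
  classical
  have hout : ∀ v : D.attach, ∃ f : Total V, f.left = v.1.1 ∧
      f.hom ∈ D.tree.edges f.left f.right ∧
      ∀ (b : V) (e : v.1.1 ⟶ b), e ∈ D.tree.edges v.1.1 b → f = ⟨v.1.1, b, e⟩ := by
    intro v
    have h1 : outDegree v.1 = 1 := not_not.1 (hD v)
    rw [outDegree, Set.encard_eq_one] at h1
    obtain ⟨g, hg⟩ := h1
    have hgv : g.left = v.1 := (Set.ext_iff.1 hg g).2 rfl
    refine ⟨⟨g.left.1, g.right.1, g.hom.1⟩, congrArg Subtype.val hgv, g.hom.2, fun b e he => ?_⟩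
    have h2 : (⟨v.1, ⟨b, D.tree.right_mem he⟩, ⟨e, he⟩⟩ : Total D.tree.Vert) = g :=
      (Set.ext_iff.1 hg _).1 rfl
    rw [← h2]
  choose f hf1 hf2 hf3 using hout
  by_cases hne : Nonempty D.attach
  · let vx : V → D.attach := fun x =>
      if h : x ∈ D.fruitVerts then h.choose else Classical.choice hne
    have hvx : ∀ x ∈ D.fruitVerts, x ∈ (D.fruit (vx x)).verts := by
      intro x hx
      simp only [vx, dif_pos hx]
      exact hx.choose_spec
    have hv : ∀ x, (vx x).1.1 ∈ (D.fruit (vx x)).verts := by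
      intro x
      have : (vx x).1.1 ∈ D.tree.verts ∩ (D.fruit (vx x)).verts := by
        rw [D.tree_inter_fruit]; rfl
      exact this.2
    refine ⟨fun x => f (vx x), fun x hx => ⟨?_, ?_, ?_, fun b e => ⟨fun hb => ?_, fun hb => ?_⟩⟩⟩
    -- An edge that ends on a fruit is a fruit edge, whereas the exit is a tree edge.
    · rintro ⟨w, hw⟩
      exact D.edges_disjoint _ w ⟨hf2 (vx x), D.mem_fruit_edges hD _ hw⟩
    · obtain ⟨p⟩ := nonempty_path_of_isCircle (D.isCircle (vx x)) ⟨x, hvx x hx⟩ ⟨_, hv x⟩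
      rw [hf1]
      let F : Prefunctor (D.fruit (vx x)).Vert V := { obj := fun a => a.1, map := fun e => e.1 }
      exact ⟨F.mapPath p⟩
    · rw [hf1]
      exact ⟨_, hv x⟩
    · have h1 := D.mem_fruit_edges hD e (hvx b hb)
      have h2 : vx x = vx b := D.eq_of_mem (hvx x hx) ((D.fruit (vx b)).left_mem h1)
      simp only [h2]
    · rcases D.edges_cover e with he | ⟨y, he⟩
      · obtain h1 : x = (vx x).1.1 := D.eq_attach (D.tree.left_mem he) (hvx x hx)
        have key : ∀ (x : V) (e : x ⟶ b) (v : D.attach), x = v.1.1 → e ∈ D.tree.edges x b →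
            f v = ⟨x, b, e⟩ := by
          rintro x e v rfl he
          exact hf3 v b e he
        exact key x e _ h1 he
      · exact (hb ⟨y, (D.fruit y).right_mem he⟩).elim
  -- Without fruits only some edge is needed as a dummy value; the tree has one, being connected
  -- with at least two vertices.
  · refine ⟨fun x => Classical.choice ?_, fun x hx => (hne ⟨hx.choose⟩).elim⟩
    obtain ⟨a, b, hab⟩ := D.isGeneralizedTree.2.1
    by_contra hE
    refine hab (eq_of_forall_edge_eq (f := id) D.isGeneralizedTree.1 (fun x y e => ?_) a b)
    exact (hE ⟨⟨x.1, y.1, e.1⟩⟩).elim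

/-- The combinatorial structure of a fruit tree without in-fruits that is used for the
construction of an implementing operator: `F` is the set of the vertices on the fruits, and `s x`
is the shortest path that leaves the fruit at `x`. -/
theorem exists_structure_of_isFruitTreeWithoutInFruit (h : IsFruitTreeWithoutInFruit V) :
    ∃ (F : Set V) (y : V → V) (s : ∀ x, Path x (y x)),
      (∀ x ∈ F, ∀ p : Path x (y x), ∃ r : Path x x, p = r.comp (s x)) ∧
      (∀ x ∈ F, ∀ (x' : V) (e : x ⟶ x'), ∃ r : Path x x,
        (⟨y x', e.toPath.comp (s x')⟩ : Σ b, Quiver.Path x b) = ⟨y x, r.comp (s x)⟩) ∧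
      (∀ x ∈ F, ∀ c d : Path x x, c.comp d = d.comp c) ∧
      (∀ x ∉ F, (⟨y x, s x⟩ : Σ b, Quiver.Path x b) = ⟨x, Path.nil⟩) ∧
      (∀ x ∉ F, ∀ (x' : V) (e : x ⟶ x'), x' ∉ F ∧ ∀ p : Path x x', p = e.toPath) ∧
      ∀ c : Total V → ℂ, ∃ t : V → ℂ, ∀ x ∉ F, ∀ (x' : V) (e : x ⟶ x'),
        t x - t x' = c ⟨x, x', e⟩ := by
  classical
  obtain ⟨hfin, D, hD⟩ := h
  set F := D.fruitVerts with hFdef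
  have hF : ∀ {a b : V}, (a ⟶ b) → b ∈ F → a ∈ F := by
    rintro a b e ⟨w, hw⟩
    exact ⟨w, (D.fruit w).left_mem (D.mem_fruit_edges hD e hw)⟩
  have hs : ∀ b ∈ F, Subsingleton (Σ a : V, a ⟶ b) := by
    rintro b ⟨w, hw⟩
    have h1 := subsingleton_in_edges_of_isCircle (D.isCircle w) ⟨b, hw⟩
    constructor
    rintro ⟨a, e⟩ ⟨a', e'⟩
    have he := D.mem_fruit_edges hD e hw
    have he' := D.mem_fruit_edges hD e' hw
    have h2 := @Subsingleton.elim _ h1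
      ⟨⟨a, (D.fruit w).left_mem he⟩, ⟨e, he⟩⟩ ⟨⟨a', (D.fruit w).left_mem he'⟩, ⟨e', he'⟩⟩
    exact congrArg (fun z : Σ a : (D.fruit w).Vert, a ⟶ (⟨b, hw⟩ : (D.fruit w).Vert) =>
      (⟨z.1.1, z.2.1⟩ : Σ a : V, a ⟶ b)) h2
  have hpot : ∀ c : Total V → ℂ, ∃ t : V → ℂ, ∀ x ∉ F, ∀ (x' : V) (e : x ⟶ x'),
      t x - t x' = c ⟨x, x', e⟩ := by
    intro c
    obtain ⟨t, ht⟩ := D.exists_potential c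
    refine ⟨t, fun x hx x' e => ht x x' e ?_⟩
    rcases D.edges_cover e with he | ⟨w, he⟩
    · exact he
    · exact (hx ⟨w, (D.fruit w).left_mem he⟩).elim
  have hback : ∀ {a b : V} (p : Path a b), b ∈ F → a ∈ F := by
    intro a b p
    induction p with
    | nil => exact id
    | cons p e ih => exact fun hb => ih (hF e hb)
  have hout : ∀ x ∉ F, ∀ (x' : V), (x ⟶ x') → x' ∉ F := fun x hx x' e hx' => hx (hF e hx')
  have hforw : ∀ {a b : V} (p : Path a b), a ∉ F → b ∉ F := fun p ha hb => ha (hback p hb)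
  -- A potential that drops by one along each edge outside F: there, the length of a path depends
  -- only on its end points.
  obtain ⟨t1, ht1⟩ := hpot fun _ => 1
  have hlen : ∀ {a b : V} (p : Path a b), a ∉ F → t1 a - t1 b = p.length := by
    intro a b p ha
    induction p with
    | nil => simp
    | cons p e ih =>
      rw [Path.length_cons, Nat.cast_succ]
      linear_combination ih + ht1 _ (hforw p ha) _ e
  have huniq : ∀ x ∉ F, ∀ (x' : V) (e : x ⟶ x') (p : Path x x'), p = e.toPath := by
    intro x hx x' e p
    have h1 : p.length = 1 := by
      have := (hlen p hx).symm.trans (hlen e.toPath hx)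
      exact_mod_cast this
    cases p with
    | nil => simp at h1
    | cons p g =>
      have h2 : p.length = 0 := by simpa using h1
      obtain rfl := Path.eq_of_length_zero p h2
      obtain rfl := Path.eq_nil_of_length_zero p h2
      -- A parallel edge g would have the same potential difference as e, but only e has difference
      -- 1.
      obtain ⟨t, ht⟩ := hpot fun f => if f = ⟨x, x', e⟩ then 1 else 0
      have h3 := (ht x hx x' e).symm.trans (ht x hx x' g)
      by_cases h4 : (⟨x, x', g⟩ : Total V) = ⟨x, x', e⟩
      · cases h4
        rfl
      · simp only [if_true, if_neg h4] at h3
        exact (one_ne_zero h3).elim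
  obtain ⟨ex, hex⟩ := D.exists_exit hD
  have hexc : ∀ {a b : V} (p : Path a b), b ∈ F → ex b = ex a := by
    intro a b p
    induction p with
    | nil => exact fun _ => rfl
    | cons p e ih =>
      exact fun hb => (((hex _ (hF e hb)).2.2.2 _ e).1 hb).trans (ih (hF e hb))
  have hmin : ∀ x ∈ F, ∃ q : Path x (ex x).left, ∀ p : Path x (ex x).left, q.length ≤ p.length := by
    intro x hx
    obtain ⟨p0⟩ := (hex x hx).2.1
    have hne : (Set.range fun p : Path x (ex x).left => p.length).Nonempty := ⟨_, p0, rfl⟩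
    obtain ⟨q, hq⟩ := Nat.sInf_mem hne
    exact ⟨q, fun p => hq.trans_le (Nat.sInf_le ⟨p, rfl⟩)⟩
  -- The complement of F is never left again, and the exit edge is constant along the part of the
  -- path inside F, so the step out of F is the exit edge of x.
  have hthrough : ∀ x ∈ F, ∀ (b : V) (p : Path x b), b ∉ F → ∃ (q : Path x (ex x).left)
      (q' : Path (ex x).right b), p = (q.cons (ex x).hom).comp q' := by
    intro x hx b p
    induction p with
    | nil => exact fun h => (h hx).elim
    | @cons a b p e ih =>
      intro hb
      by_cases ha : a ∈ F
      · have h1 := ((hex a ha).2.2.2 b e).2 hb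
        rw [hexc p ha] at h1
        rw [h1]
        exact ⟨p, Path.nil, rfl⟩
      · obtain ⟨q, q', rfl⟩ := ih ha
        exact ⟨q, q'.cons e, rfl⟩
  let yS : ∀ x, Σ b, Quiver.Path x b := fun x =>
    if hx : x ∈ F then ⟨(ex x).right, (hmin x hx).choose.cons (ex x).hom⟩ else ⟨x, Path.nil⟩
  have hyS1 : ∀ x (hx : x ∈ F), yS x = ⟨(ex x).right, (hmin x hx).choose.cons (ex x).hom⟩ :=
    fun x hx => dif_pos hx
  have hyS2 : ∀ x, x ∉ F → yS x = ⟨x, Path.nil⟩ := fun x hx => dif_neg hx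
  have hfactor : ∀ x ∈ F, ∀ p : Path x (yS x).1, ∃ r : Path x x, p = r.comp (yS x).2 := by
    intro x hx
    rw [hyS1 x hx]
    intro p
    obtain ⟨q, q', hqq⟩ := hthrough x hx _ p (hex x hx).1
    -- The part of p behind the exit edge is a closed path outside F, hence trivial by the potential
    -- `t1`.
    have h1 : q'.length = 0 := by
      have := hlen q' (hex x hx).1
      rw [sub_self] at this
      exact_mod_cast this.symm
    rw [Path.eq_nil_of_length_zero q' h1, Path.comp_nil] at hqq
    obtain ⟨r, hr⟩ := exists_eq_comp_of_subsingleton hF hs (hmin x hx).choose (hex x hx).2.2.1 q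
      ((hmin x hx).choose_spec q)
    exact ⟨r, by rw [hqq, hr]; rfl⟩
  refine ⟨F, fun x => (yS x).1, fun x => (yS x).2, hfactor, fun x hx x' e => ?_,
    fun x hx => closed_paths_commute_of_subsingleton hF hs hx, hyS2,
    fun x hx x' e => ⟨hout x hx x' e, huniq x hx x' e⟩, hpot⟩
  have hy : (yS x').1 = (yS x).1 := by
    by_cases hx' : x' ∈ F
    · rw [hyS1 x hx, hyS1 x' hx']
      exact congrArg Total.right (((hex x hx).2.2.2 x' e).1 hx')
    · rw [hyS1 x hx, hyS2 x' hx']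
      exact (congrArg Total.right (((hex x hx).2.2.2 x' e).2 hx')).symm
  have key : ∀ (b : V) (p : Path x b), b = (yS x).1 →
      ∃ r : Path x x, (⟨b, p⟩ : Σ b, Quiver.Path x b) = ⟨(yS x).1, r.comp (yS x).2⟩ := by
    rintro b p rfl
    obtain ⟨r, rfl⟩ := hfactor x hx p
    exact ⟨r, rfl⟩
  exact key _ _ hy

end Fruits

end DiGraph

namespace DiGraph

open Quiver Filter Topology

/-! ### Corners of the tensor algebra -/

section Corners

variable {V : Type u} [Quiver.{v} V]

/-- The closed linear span of the operators `L_p` for the paths `p` from `a` to `b`. -/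
noncomputable def corner (a b : V) : Submodule ℂ (PathHilbert V →L[ℂ] PathHilbert V) :=
  (Submodule.span ℂ (Set.range fun p : Path a b => leftPath p)).topologicalClosure

theorem isClosed_corner (a b : V) :
    IsClosed (corner a b : Set (PathHilbert V →L[ℂ] PathHilbert V)) :=
  Submodule.isClosed_topologicalClosure _

theorem leftPath_mem_corner {a b : V} (p : Path a b) : leftPath p ∈ corner a b :=
  Submodule.le_topologicalClosure _ (Submodule.subset_span ⟨p, rfl⟩)

theorem corner_le {a b : V} {M : Submodule ℂ (PathHilbert V →L[ℂ] PathHilbert V)}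
    (hM : IsClosed (M : Set (PathHilbert V →L[ℂ] PathHilbert V)))
    (h : ∀ p : Path a b, leftPath p ∈ M) : corner a b ≤ M :=
  Submodule.topologicalClosure_minimal _ (Submodule.span_le.2 (by rintro _ ⟨p, rfl⟩; exact h p)) hM

theorem corner_le_tensorAlgebra (a b : V) : corner a b ≤ (tensorAlgebra V).toSubmodule :=
  corner_le isClosed_tensorAlgebra leftPath_mem

theorem eq_of_mem_corner {F : Type*} [NormedAddCommGroup F] [NormedSpace ℂ F] {a b : V}
    (f g : (PathHilbert V →L[ℂ] PathHilbert V) →L[ℂ] F)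
    (h : ∀ p : Path a b, f (leftPath p) = g (leftPath p))
    {T : PathHilbert V →L[ℂ] PathHilbert V} (hT : T ∈ corner a b) : f T = g T := by
  have h1 : corner a b ≤ eqSubmodule f g := corner_le (isClosed_eqSubmodule f g) h
  exact h1 hT

theorem map_mem_corner {a b c d : V}
    (f : (PathHilbert V →L[ℂ] PathHilbert V) →L[ℂ] (PathHilbert V →L[ℂ] PathHilbert V))
    (h : ∀ p : Path a b, f (leftPath p) ∈ corner c d)
    {T : PathHilbert V →L[ℂ] PathHilbert V} (hT : T ∈ corner a b) : f T ∈ corner c d := by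
  have h1 : corner a b ≤ (corner c d).comap (f : _ →ₗ[ℂ] _) :=
    corner_le ((isClosed_corner _ _).preimage f.continuous) h
  exact h1 hT

theorem leftVertex_mul_of_mem_corner {a b : V} {T : PathHilbert V →L[ℂ] PathHilbert V}
    (hT : T ∈ corner a b) : leftVertex b * T = T :=
  eq_of_mem_corner (ContinuousLinearMap.mul ℂ (PathHilbert V →L[ℂ] PathHilbert V) (leftVertex b)) (ContinuousLinearMap.id ℂ (PathHilbert V →L[ℂ] PathHilbert V))
    (fun p => leftVertex_mul_leftPath p) hT

theorem mul_leftVertex_of_mem_corner {a b : V} {T : PathHilbert V →L[ℂ] PathHilbert V}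
    (hT : T ∈ corner a b) : T * leftVertex a = T :=
  eq_of_mem_corner ((ContinuousLinearMap.mul ℂ (PathHilbert V →L[ℂ] PathHilbert V)).flip (leftVertex a)) (ContinuousLinearMap.id ℂ (PathHilbert V →L[ℂ] PathHilbert V))
    (fun p => leftPath_mul_leftVertex p) hT

/-- Compression fixes L_p for p from a to b and kills every other L_p; continuity does the rest. -/
theorem compress_mem_corner (a b : V) {T : PathHilbert V →L[ℂ] PathHilbert V}
    (hT : T ∈ tensorAlgebra V) : leftVertex b * T * leftVertex a ∈ corner a b := by
  let f : (PathHilbert V →L[ℂ] PathHilbert V) →L[ℂ] (PathHilbert V →L[ℂ] PathHilbert V) :=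
    ((ContinuousLinearMap.mul ℂ (PathHilbert V →L[ℂ] PathHilbert V)).flip (leftVertex a)).comp
      (ContinuousLinearMap.mul ℂ (PathHilbert V →L[ℂ] PathHilbert V) (leftVertex b))
  let M : Submodule ℂ (PathHilbert V →L[ℂ] PathHilbert V) := (corner a b).comap (f : _ →ₗ[ℂ] _)
  have hM : IsClosed (M : Set (PathHilbert V →L[ℂ] PathHilbert V)) :=
    (isClosed_corner a b).preimage f.continuous
  refine tensorAlgebra_induction (M := M) hM (fun x y p => ?_) hT
  change leftVertex b * leftPath p * leftVertex a ∈ corner a b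
  by_cases hy : y = b
  · subst hy
    rw [leftVertex_mul_leftPath]
    by_cases hx : x = a
    · subst hx
      rw [leftPath_mul_leftVertex]
      exact leftPath_mem_corner p
    · rw [leftPath_mul_leftVertex_of_ne _ (Ne.symm hx)]
      exact zero_mem _
  · rw [leftVertex_mul_leftPath_of_ne _ hy, zero_mul]
    exact zero_mem _

/-- If the closed paths at `x` commute, then so do the elements of the corner at `x` and the
operators `L_r`, for the closed paths `r` at `x`. -/
theorem commute_of_mem_corner {x : V} (hcomm : ∀ c d : Path x x, c.comp d = d.comp c)
    {T : PathHilbert V →L[ℂ] PathHilbert V} (hT : T ∈ corner x x) (r : Path x x) :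
    leftPath r * T = T * leftPath r :=
  eq_of_mem_corner (ContinuousLinearMap.mul ℂ (PathHilbert V →L[ℂ] PathHilbert V) (leftPath r))
    ((ContinuousLinearMap.mul ℂ (PathHilbert V →L[ℂ] PathHilbert V)).flip (leftPath r))
    (fun p => by
      change leftPath r * leftPath p = leftPath p * leftPath r
      rw [leftPath_mul, leftPath_mul, hcomm]) hT

/-- Division of an element of a corner by `L_s`. -/
theorem exists_leftPath_mul_eq {x y : V} {s : Path x y} (hs : ∀ p : Path x y, ∃ r : Path x x, p = r.comp s)
    {T : PathHilbert V →L[ℂ] PathHilbert V} (hT : T ∈ corner x y) :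
    ∃ H ∈ corner x x, leftPath s * H = T := by
  have h1 : ∀ r : Path x x, leftPathInv s * leftPath (r.comp s) = leftPath r := by
    intro r
    rw [← leftPath_mul, ← mul_assoc, leftPathInv_mul_leftPath, leftVertex_mul_leftPath]
  refine ⟨leftPathInv s * T, map_mem_corner (ContinuousLinearMap.mul ℂ (PathHilbert V →L[ℂ] PathHilbert V) (leftPathInv s))
    (fun p => ?_) hT, ?_⟩
  · obtain ⟨r, rfl⟩ := hs p
    change leftPathInv s * leftPath (r.comp s) ∈ _
    rw [h1]
    exact leftPath_mem_corner r
  · refine eq_of_mem_corner ((ContinuousLinearMap.mul ℂ (PathHilbert V →L[ℂ] PathHilbert V) (leftPath s)).comp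
      (ContinuousLinearMap.mul ℂ (PathHilbert V →L[ℂ] PathHilbert V) (leftPathInv s))) (ContinuousLinearMap.id ℂ (PathHilbert V →L[ℂ] PathHilbert V)) (fun p => ?_) hT
    obtain ⟨r, rfl⟩ := hs p
    change leftPath s * (leftPathInv s * leftPath (r.comp s)) = leftPath (r.comp s)
    rw [h1, leftPath_mul]

/-- L_s is isometric on the paths ending at x and is undone there by `leftPathInv s`. -/
theorem eq_zero_of_leftPath_mul {x y : V} (s : Path x y) {T : PathHilbert V →L[ℂ] PathHilbert V}
    (hT : leftVertex x * T = T) (h : leftPath s * T = 0) : T = 0 := by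
  rw [← hT, ← leftPathInv_mul_leftPath s, mul_assoc, h, mul_zero]

theorem exists_smul_of_mem_corner {x y : V} {e : x ⟶ y} (h : ∀ p : Path x y, p = e.toPath)
    {T : PathHilbert V →L[ℂ] PathHilbert V} (hT : T ∈ corner x y) :
    ∃ c : ℂ, T = c • leftEdge e := by
  have h1 : corner x y ≤ Submodule.span ℂ {leftEdge e} := by
    refine corner_le (Submodule.closed_of_finiteDimensional _) fun p => ?_
    rw [h p, leftPath_toPath]
    exact Submodule.mem_span_singleton_self _
  obtain ⟨c, hc⟩ := Submodule.mem_span_singleton.1 (h1 hT)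
  exact ⟨c, hc.symm⟩

end Corners

/-! ### Bounded derivations on fruit trees without in-fruits -/

section Derivations

variable {V : Type u} [Quiver.{v} V]

/-- A bounded derivation of the tensor algebra, as a map into the bounded operators. -/
structure IsOperatorDerivation (δ : tensorAlgebra V → PathHilbert V →L[ℂ] PathHilbert V) :
    Prop where
  continuous : Continuous δ
  mem : ∀ A, δ A ∈ tensorAlgebra V
  map_add : ∀ A B, δ (A + B) = δ A + δ B
  map_smul : ∀ (c : ℂ) A, δ (c • A) = c • δ A
  map_mul : ∀ A B, δ (A * B) = δ A * B.1 + A.1 * δ B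

variable {δ : tensorAlgebra V → PathHilbert V →L[ℂ] PathHilbert V}

theorem IsOperatorDerivation.map_zero (hδ : IsOperatorDerivation δ) : δ 0 = 0 := by
  have := hδ.map_smul 0 0
  rwa [zero_smul, zero_smul] at this

variable (δ) in
/-- The value at `L_p` of a map on the tensor algebra. -/
noncomputable def valueAt {a b : V} (p : Path a b) : PathHilbert V →L[ℂ] PathHilbert V :=
  δ ⟨leftPath p, leftPath_mem p⟩

theorem valueAt_comp (hδ : IsOperatorDerivation δ) {a b c : V} (p : Path a b) (q : Path b c) :
    valueAt δ (p.comp q) = valueAt δ q * leftPath p + leftPath q * valueAt δ p := by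
  have h1 := hδ.map_mul ⟨leftPath q, leftPath_mem q⟩ ⟨leftPath p, leftPath_mem p⟩
  have h2 : (⟨leftPath q, leftPath_mem q⟩ * ⟨leftPath p, leftPath_mem p⟩ : tensorAlgebra V) =
      ⟨leftPath (p.comp q), leftPath_mem _⟩ := Subtype.ext (leftPath_mul q p)
  rw [h2] at h1
  exact h1

/-- As δ vanishes at the vertex projections, the Leibniz rule makes it linear over them, so it
preserves the two-sided support of L_p. -/
theorem valueAt_mem_corner (hδ : IsOperatorDerivation δ)
    (hv : ∀ x : V, valueAt δ (Path.nil : Path x x) = 0) {a b : V} (p : Path a b) :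
    valueAt δ p ∈ corner a b := by
  have h1 := valueAt_comp hδ p Path.nil
  have h2 := valueAt_comp hδ Path.nil p
  rw [Path.comp_nil, hv, zero_mul, zero_add, leftPath_nil] at h1
  rw [Path.nil_comp, hv, mul_zero, add_zero, leftPath_nil] at h2
  have h3 : leftVertex b * valueAt δ p * leftVertex a ∈ corner a b :=
    compress_mem_corner a b (hδ.mem ⟨leftPath p, leftPath_mem p⟩)
  rwa [← h1, ← h2] at h3

/-- A bounded derivation that vanishes at the vertices vanishes at all closed paths that commute
with all closed paths at the same vertex. -/
theorem valueAt_closed_eq_zero (hδ : IsOperatorDerivation δ)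
    (hv : ∀ x : V, valueAt δ (Path.nil : Path x x) = 0) {x : V}
    (hcomm : ∀ c d : Path x x, c.comp d = d.comp c) (r : Path x x) : valueAt δ r = 0 := by
  have hr := valueAt_mem_corner hδ hv r
  -- Commutativity of the corner turns the Leibniz rule into the usual derivative of a power.
  have hpow : ∀ k : ℕ, valueAt δ (pathPow r (k + 1)) =
      ((k : ℂ) + 1) • (leftPath (pathPow r k) * valueAt δ r) := by
    intro k
    induction k with
    | zero =>
      have h1 := (leftVertex_mul_of_mem_corner hr).symm
      simpa [pathPow, leftPath_nil] using h1
    | succ k ih =>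
      rw [pathPow, valueAt_comp hδ, ih, smul_mul_assoc, mul_assoc,
        ← commute_of_mem_corner hcomm hr, ← mul_assoc, leftPath_mul]
      have h2 : r.comp (pathPow r k) = pathPow r (k + 1) := rfl
      rw [h2, Nat.cast_succ, add_smul ((k : ℂ) + 1), one_smul]
  have hnorm : ∀ k : ℕ, ‖valueAt δ r‖ ≤ ‖leftPath (pathPow r k) * valueAt δ r‖ := by
    intro k
    have h1 : leftPathInv (pathPow r k) * (leftPath (pathPow r k) * valueAt δ r) =
        valueAt δ r := by
      rw [← mul_assoc, leftPathInv_mul_leftPath, leftVertex_mul_of_mem_corner hr]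
    calc ‖valueAt δ r‖ = ‖leftPathInv (pathPow r k) * (leftPath (pathPow r k) * valueAt δ r)‖ := by
          rw [h1]
      _ ≤ _ := (norm_mul_le _ _).trans
          (mul_le_of_le_one_left (norm_nonneg _) (norm_leftPathInv_le _))
  -- The powers divided by k + 1 tend to 0 in norm, while their images have norm at least that of
  -- δ(L_r); continuity at 0 forces δ(L_r) = 0.
  let A : ℕ → tensorAlgebra V := fun k =>
    ((k : ℂ) + 1)⁻¹ • ⟨leftPath (pathPow r (k + 1)), leftPath_mem _⟩
  have hA : ∀ k, δ (A k) = leftPath (pathPow r k) * valueAt δ r := by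
    intro k
    have h1 : ((k : ℂ) + 1) ≠ 0 := Nat.cast_add_one_ne_zero k
    rw [hδ.map_smul]
    change ((k : ℂ) + 1)⁻¹ • valueAt δ (pathPow r (k + 1)) = _
    rw [hpow, smul_smul, inv_mul_cancel₀ h1, one_smul]
  have hA0 : Tendsto A atTop (𝓝 0) := by
    rw [tendsto_subtype_rng]
    refine tendsto_zero_iff_norm_tendsto_zero.2 ?_
    refine squeeze_zero (fun k => norm_nonneg _) (fun k => ?_)
      tendsto_one_div_add_atTop_nhds_zero_nat
    change ‖((k : ℂ) + 1)⁻¹ • leftPath (pathPow r (k + 1))‖ ≤ _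
    have h2 : ‖((k : ℂ) + 1)‖ = (k : ℝ) + 1 := by
      rw [← Nat.cast_succ, Complex.norm_natCast, Nat.cast_succ]
    rw [norm_smul, norm_inv, h2, one_div]
    exact mul_le_of_le_one_right (by positivity) (norm_leftPath_le _)
  have h1 := ((hδ.continuous.tendsto 0).comp hA0).norm
  rw [hδ.map_zero, norm_zero] at h1
  have h2 : ‖valueAt δ r‖ ≤ 0 := ge_of_tendsto' h1 fun k => by
    rw [Function.comp_apply, hA]
    exact hnorm k
  exact norm_le_zero_iff.1 h2

theorem eq_commutator_of_valueAt (hδ : IsOperatorDerivation δ)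
    {T : PathHilbert V →L[ℂ] PathHilbert V}
    (hv : ∀ x : V, valueAt δ (Path.nil : Path x x) = leftVertex x * T - T * leftVertex x)
    (he : ∀ (x y : V) (e : x ⟶ y), valueAt δ e.toPath = leftEdge e * T - T * leftEdge e)
    (A : tensorAlgebra V) : δ A = A.1 * T - T * A.1 := by
  have hp : ∀ {a b : V} (p : Path a b), valueAt δ p = leftPath p * T - T * leftPath p := by
    intro a b p
    induction p with
    | nil => rw [hv, leftPath_nil]
    | cons p e ih =>
      have h1 := valueAt_comp hδ p e.toPath
      rw [Path.comp_toPath_eq_cons] at h1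
      rw [h1, ih, he, leftPath_cons, leftPath_toPath]
      noncomm_ring
  let S : Set (tensorAlgebra V) := {A | δ A = A.1 * T - T * A.1}
  have hS : IsClosed S := isClosed_eq hδ.continuous
    ((continuous_subtype_val.mul continuous_const).sub
      (continuous_const.mul continuous_subtype_val))
  -- The equality set is moved into the ambient operators, where `tensorAlgebra_induction` applies;
  -- it stays closed because 𝒜 is closed.
  let M : Submodule ℂ (PathHilbert V →L[ℂ] PathHilbert V) :=
    { carrier := Subtype.val '' S
      add_mem' := by
        rintro _ _ ⟨A, hA, rfl⟩ ⟨B, hB, rfl⟩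
        refine ⟨A + B, ?_, rfl⟩
        change δ (A + B) = (A.1 + B.1) * T - T * (A.1 + B.1)
        rw [hδ.map_add, show δ A = _ from hA, show δ B = _ from hB]
        noncomm_ring
      zero_mem' := ⟨0, by
        change δ 0 = 0 * T - T * 0
        rw [hδ.map_zero, zero_mul, mul_zero, sub_zero], rfl⟩
      smul_mem' := by
        rintro c _ ⟨A, hA, rfl⟩
        refine ⟨c • A, ?_, rfl⟩
        change δ (c • A) = (c • A.1) * T - T * (c • A.1)
        rw [hδ.map_smul, show δ A = _ from hA, smul_mul_assoc, mul_smul_comm, smul_sub] }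
  have hM : IsClosed (M : Set (PathHilbert V →L[ℂ] PathHilbert V)) :=
    isClosed_tensorAlgebra.isClosedEmbedding_subtypeVal.isClosedMap _ hS
  obtain ⟨B, hB, hBA⟩ := tensorAlgebra_induction (M := M) hM
    (fun a b p => ⟨⟨leftPath p, leftPath_mem p⟩, hp p, rfl⟩) A.2
  obtain rfl : B = A := Subtype.ext hBA
  exact hB

/-- At the vertices, every derivation agrees with an inner derivation. -/
theorem exists_normalization [Finite V]
    (hδ : IsOperatorDerivation δ) :
    ∃ T ∈ tensorAlgebra V, ∀ x : V, valueAt δ (Path.nil : Path x x) =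
      leftVertex x * T - T * leftVertex x := by
  classical
  have := Fintype.ofFinite V
  let P : V → PathHilbert V →L[ℂ] PathHilbert V := leftVertex
  let d : V → PathHilbert V →L[ℂ] PathHilbert V := fun x => valueAt δ (Path.nil : Path x x)
  have hPP : ∀ x, P x * P x = P x := fun x => by
    have := leftVertex_mul_leftPath (Path.nil : Path x x)
    rwa [leftPath_nil] at this
  have hPQ : ∀ x z, x ≠ z → P z * P x = 0 := fun x z hxz => by
    have := leftVertex_mul_leftPath_of_ne (Path.nil : Path x x) hxz
    rwa [leftPath_nil] at this
  have hd : ∀ x, d x = d x * P x + P x * d x := fun x => by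
    have := valueAt_comp hδ (Path.nil : Path x x) Path.nil
    rwa [Path.comp_nil, leftPath_nil] at this
  have hdQ : ∀ x z, x ≠ z → d z * P x + P z * d x = 0 := fun x z hxz => by
    have h1 := hδ.map_mul ⟨leftPath (Path.nil : Path z z), leftPath_mem _⟩
      ⟨leftPath (Path.nil : Path x x), leftPath_mem _⟩
    have h2 : (⟨leftPath (Path.nil : Path z z), leftPath_mem _⟩ *
        ⟨leftPath (Path.nil : Path x x), leftPath_mem _⟩ : tensorAlgebra V) = 0 :=
      Subtype.ext ((congrArg₂ (· * ·) (leftPath_nil z) (leftPath_nil x)).trans (hPQ x z hxz))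
    rw [h2, hδ.map_zero] at h1
    have h3 : d z * leftPath (Path.nil : Path x x) + leftPath (Path.nil : Path z z) * d x = 0 :=
      h1.symm
    rwa [leftPath_nil, leftPath_nil] at h3
  have hsum : ∑ x, P x = 1 := by
    refine clm_ext_ket fun a b p => ?_
    rw [sum_apply, Finset.sum_eq_single b]
    · exact leftVertex_ket p
    · exact fun x _ hx => leftVertex_ket_of_ne p hx.symm
    · simp
  -- For x ≠ z, differentiating P_z P_x = 0 gives P_z d_x = -d_z P_x. As the finitely many P_x sum
  -- to 1, the commutator of P_z with this operator collapses to d_z.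
  refine ⟨-∑ x, d x * P x, neg_mem (sum_mem fun x _ => mul_mem (hδ.mem _) (leftVertex_mem x)),
    fun z => ?_⟩
  change d z = P z * (-∑ x, d x * P x) - (-∑ x, d x * P x) * P z
  have e1 : (∑ x, d x * P x) * P z = d z * P z := by
    rw [Finset.sum_mul, Finset.sum_eq_single z]
    · rw [mul_assoc, hPP]
    · intro x _ hx
      rw [mul_assoc, hPQ z x hx.symm, mul_zero]
    · simp
  have e2 : P z * ∑ x, d x * P x = d z * P z - d z := by
    have h3 : ∀ x, P z * (d x * P x) = (if x = z then d z * P z else 0) - d z * P x := by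
      intro x
      by_cases hx : x = z
      · subst hx
        have h4 : P x * d x = d x - d x * P x := by
          rw [eq_sub_iff_add_eq, add_comm]; exact (hd x).symm
        rw [if_pos rfl, ← mul_assoc, h4, sub_mul, mul_assoc, hPP]
      · rw [if_neg hx, zero_sub, ← mul_assoc, eq_neg_of_add_eq_zero_right (hdQ x z hx), neg_mul,
          mul_assoc, hPP]
    rw [Finset.mul_sum, Finset.sum_congr rfl fun x _ => h3 x, Finset.sum_sub_distrib,
      ← Finset.mul_sum, hsum, mul_one]
    simp
  rw [mul_neg, neg_mul, e1, e2]
  abel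

/-- A bounded derivation that vanishes at the vertices of a fruit tree without in-fruits is
inner. -/
theorem exists_eq_commutator_of_normalized (hV : IsFruitTreeWithoutInFruit V)
    (hδ : IsOperatorDerivation δ) (hv : ∀ x : V, valueAt δ (Path.nil : Path x x) = 0) :
    ∃ T ∈ tensorAlgebra V, ∀ A, δ A = A.1 * T - T * A.1 := by
  classical
  obtain ⟨F, y, s, hs, hes, hcomm, hnil, hedge, hpot⟩ :=
    exists_structure_of_isFruitTreeWithoutInFruit hV
  have := hV.1
  have := Fintype.ofFinite V
  have hc : ∀ e : Total V, ∃ c : ℂ, e.left ∉ F → valueAt δ e.hom.toPath = c • leftEdge e.hom := by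
    intro e
    by_cases he : e.left ∈ F
    · exact ⟨0, fun h => (h he).elim⟩
    · obtain ⟨c, hc⟩ := exists_smul_of_mem_corner (hedge _ he _ e.hom).2
        (valueAt_mem_corner hδ hv e.hom.toPath)
      exact ⟨c, fun _ => hc⟩
  choose c hc using hc
  obtain ⟨t, ht⟩ := hpot c
  -- The implementing operator is sought as a diagonal sum of T_x, so that δ(L_p) = L_p T_a - T_b
  -- L_p for p from a to b. Outside F it is the scalar potential; on F the equation for the exit
  -- path p = s x determines T_x, since L_{s x} can be divided out.
  have hT : ∀ x : V, ∃ T ∈ corner x x,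
      leftPath (s x) * T = valueAt δ (s x) + t (y x) • leftPath (s x) ∧
      (x ∉ F → T = t x • leftVertex x) := by
    intro x
    by_cases hx : x ∈ F
    · obtain ⟨T, hT, hT'⟩ := exists_leftPath_mul_eq (hs x hx)
        (add_mem (valueAt_mem_corner hδ hv (s x))
          (Submodule.smul_mem _ (t (y x)) (leftPath_mem_corner (s x))))
      exact ⟨T, hT, hT', fun h => (h hx).elim⟩
    · have h1 := hnil x hx
      have h2 : valueAt δ (s x) = 0 :=
        (congrArg (fun w : Σ b, Quiver.Path x b => valueAt δ w.2) h1).trans (hv x)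
      have h3 : y x = x := congrArg Sigma.fst h1
      have h4 : leftVertex x ∈ corner x x := by
        rw [← leftPath_nil]; exact leftPath_mem_corner _
      refine ⟨t x • leftVertex x, Submodule.smul_mem _ _ h4, ?_, fun _ => rfl⟩
      rw [h2, zero_add, congrArg t h3, mul_smul_comm, leftPath_mul_leftVertex]
  choose T hTc hTs hTn using hT
  have hLT : ∀ {a b : V} (p : Path a b), leftPath p * ∑ x, T x = leftPath p * T a := by
    intro a b p
    rw [Finset.mul_sum, Finset.sum_eq_single a]
    · intro x _ hx
      rw [← leftVertex_mul_of_mem_corner (hTc x), ← mul_assoc,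
        leftPath_mul_leftVertex_of_ne _ hx, zero_mul]
    · simp
  have hTL : ∀ {a b : V} (p : Path a b), (∑ x, T x) * leftPath p = T b * leftPath p := by
    intro a b p
    rw [Finset.sum_mul, Finset.sum_eq_single b]
    · intro x _ hx
      rw [← mul_leftVertex_of_mem_corner (hTc x), mul_assoc,
        leftVertex_mul_leftPath_of_ne _ hx.symm, mul_zero]
    · simp
  refine ⟨∑ x, T x, sum_mem fun x _ => corner_le_tensorAlgebra x x (hTc x),
    eq_commutator_of_valueAt hδ (fun x => ?_) fun x x' e => ?_⟩
  · rw [hv, ← leftPath_nil, hLT, hTL, leftPath_nil, leftVertex_mul_of_mem_corner (hTc x),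
      mul_leftVertex_of_mem_corner (hTc x), sub_self]
  rw [← leftPath_toPath, hLT, hTL]
  by_cases hx : x ∈ F
  · obtain ⟨r, hr⟩ := hes x hx x' e
    have h1 : leftPath (s x') * leftPath e.toPath = leftPath (s x) * leftPath r := by
      rw [leftPath_mul, leftPath_mul]
      exact congrArg (fun w : Σ b, Quiver.Path x b => leftPath w.2) hr
    have h2 : valueAt δ (e.toPath.comp (s x')) = valueAt δ (r.comp (s x)) :=
      congrArg (fun w : Σ b, Quiver.Path x b => valueAt δ w.2) hr
    have h3 : y x' = y x := congrArg Sigma.fst hr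
    rw [valueAt_comp hδ, valueAt_comp hδ, valueAt_closed_eq_zero hδ hv (hcomm x hx), mul_zero,
      add_zero] at h2
    rw [← sub_eq_zero]
    -- After multiplication by L_{s x'} the path "e, s x'" becomes "r, s x" with r closed. Since
    -- δ(L_r) = 0 and T_x commutes with L_r, the defining equations of T_x and T_{x'} give the
    -- claim.
    refine eq_zero_of_leftPath_mul (s x') ?_ ?_
    · rw [mul_sub, mul_sub, leftVertex_mul_of_mem_corner (valueAt_mem_corner hδ hv e.toPath),
        ← mul_assoc, leftVertex_mul_leftPath, ← mul_assoc, leftVertex_mul_of_mem_corner (hTc x')]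
    · rw [mul_sub, mul_sub, ← mul_assoc, h1, mul_assoc, commute_of_mem_corner (hcomm x hx) (hTc x),
        ← mul_assoc, ← mul_assoc, hTs, hTs, congrArg t h3, add_mul, add_mul, smul_mul_assoc, smul_mul_assoc,
        h1, ← h2]
      abel
  · have h1 : valueAt δ e.toPath = c ⟨x, x', e⟩ • leftEdge e := hc ⟨x, x', e⟩ hx
    rw [h1, ← ht x hx x' e, hTn x hx, hTn x' (hedge x hx x' e).1, mul_smul_comm, smul_mul_assoc,
      leftPath_mul_leftVertex, leftVertex_mul_leftPath, sub_smul, leftPath_toPath]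

theorem exists_eq_commutator (hV : IsFruitTreeWithoutInFruit V) (hδ : IsOperatorDerivation δ) :
    ∃ T ∈ tensorAlgebra V, ∀ A, δ A = A.1 * T - T * A.1 := by
  have := hV.1
  obtain ⟨T₀, hT₀, h₀⟩ := exists_normalization hδ
  let d : tensorAlgebra V → PathHilbert V →L[ℂ] PathHilbert V :=
    fun A => δ A - (A.1 * T₀ - T₀ * A.1)
  have hd : ∀ A, d A = δ A - (A.1 * T₀ - T₀ * A.1) := fun A => rfl
  obtain ⟨T, hT, hT'⟩ := exists_eq_commutator_of_normalized (δ := d) hV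
    { continuous := hδ.continuous.sub ((continuous_subtype_val.mul continuous_const).sub
        (continuous_const.mul continuous_subtype_val))
      mem := fun A => sub_mem (hδ.mem A) (sub_mem (mul_mem A.2 hT₀) (mul_mem hT₀ A.2))
      map_add := fun A B => by
        rw [hd, hd, hd, hδ.map_add]
        change δ A + δ B - ((A.1 + B.1) * T₀ - T₀ * (A.1 + B.1)) = _
        noncomm_ring
      map_smul := fun c A => by
        rw [hd, hd, hδ.map_smul]
        change c • δ A - ((c • A.1) * T₀ - T₀ * (c • A.1)) = _
        rw [smul_mul_assoc, mul_smul_comm, smul_sub, smul_sub]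
      map_mul := fun A B => by
        rw [hd, hd, hd, hδ.map_mul]
        change _ - (A.1 * B.1 * T₀ - T₀ * (A.1 * B.1)) = _
        noncomm_ring }
    (fun x => by
      have h1 := h₀ x
      have h2 : valueAt d (Path.nil : Path x x) = valueAt δ (Path.nil : Path x x) -
        (leftPath (Path.nil : Path x x) * T₀ - T₀ * leftPath (Path.nil : Path x x)) := rfl
      rw [h2, h1, leftPath_nil, sub_self])
  refine ⟨T₀ + T, add_mem hT₀ hT, fun A => ?_⟩
  have h1 := hT' A
  rw [hd, sub_eq_iff_eq_add] at h1
  rw [h1]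
  noncomm_ring

/-- All bounded derivations of the tensor algebra of a fruit tree without in-fruits are inner. -/
theorem isInner_of_isFruitTreeWithoutInFruit (hV : IsFruitTreeWithoutInFruit V) :
    ∀ δ : tensorAlgebra V →L[ℂ] tensorAlgebra V, IsDerivation δ → IsInner δ := by
  intro δ hδ
  have h1 : ∀ A B : tensorAlgebra V, δ (A * B) = δ A * B + A * δ B := hδ
  obtain ⟨T, hT, hT'⟩ := exists_eq_commutator (δ := fun A => (δ A).1) hV
    { continuous := continuous_subtype_val.comp δ.cont
      mem := fun A => (δ A).2
      map_add := fun A B => congrArg Subtype.val (δ.map_add' A B)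
      map_smul := fun c A => congrArg Subtype.val (δ.map_smul' c A)
      map_mul := fun A B => congrArg Subtype.val (h1 A B) }
  exact ⟨⟨T, hT⟩, fun A => Subtype.ext (hT' A)⟩

end Derivations

end DiGraph

theorem mainTheorem5 {V : Type u} [Quiver.{v} V]
    (hconn : DiGraph.IsConnected V) (hns : ¬ Quiver.IsStronglyConnected V) :
    (∀ δ : DiGraph.tensorAlgebra V →L[ℂ] DiGraph.tensorAlgebra V,
        DiGraph.IsDerivation δ → DiGraph.IsInner δ) ↔
      DiGraph.IsFruitTreeWithoutInFruit V := by
  exact ⟨DiGraph.isFruitTreeWithoutInFruit_of_forall_isInner hconn hns,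
    DiGraph.isInner_of_isFruitTreeWithoutInFruit⟩
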